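/- Let $p$ be a prime number and let $F$ be an extension of $\mathbb{Q}_p$ of degree $[F:\mathbb{Q}_p]=2$, with ring of integers $\mathcal{O}_F$ and uniformizer $\varpi$. Let $G=\mathrm{GL}_2(F)$, let $Z$ be its centre, $\mathcal{K}=Z\,\mathrm{GL}_2(\mathcal{O}_F)$ and $\alpha=\left(\begin{smallmatrix}\varpi&0\\0&1\end{smallmatrix}\right)$. Let $k$ be a field of characteristic $p$ with an embedding $\mathcal{O}_F/\varpi\hookrightarrow k$ of the residue field of $F$; all representations are $k$-linear. A representation is smooth if all stabilizers of vectors are open, and admissible if moreover its space of $H$-fixed vectors is finite-dimensional for every compact open subgroup $H$. Let $(\sigma,V)$ be a smooth irreducible representation of $\mathcal{K}$, and let $\mathrm{ind}_{\mathcal K}^G(\sigma)$ be the space of functions $\varphi:G\to V$ with $\varphi(gh)=\sigma(h^{-1})\varphi(g)$ for $g\in G$, $h\in\mathcal{K}$, and with support compact modulo $\mathcal{K}$, on which $G$ acts by left translation. For $v\in V$ let $[1,v]$ be the element with support in $\mathcal{K}$ and value $v$ at $1$. A $G$-endomorphism $T$ of $\mathrm{ind}_{\mathcal K}^G(\sigma)$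 corresponds to the function $f_T:G\to\mathrm{End}_k(V)$, $f_T(g)v=(T[1,v])(g^{-1})$. Then there is a nonzero $G$-endomorphism $T$ of $\mathrm{ind}_{\mathcal K}^G(\sigma)$ such that $f_T$ has support in $\mathcal{K}\alpha\mathcal{K}$, and for every such $T$ the representation $$\pi(\sigma,0)=\mathrm{ind}_{\mathcal K}^G(\sigma)/T(\mathrm{ind}_{\mathcal K}^G(\sigma))$$ of $G$ is not admissible. -/

import Mathlib

open scoped Pointwise MatrixGroups

section SmoothRepresentations

variable {k G V : Type*} [Field k] [Group G] [TopologicalSpace G] [AddCommGroup V] [Module k V]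

/-- A representation of a topological group is smooth if the stabilizer of every vector is open. -/
def IsSmoothRep (ρ : Representation k G V) : Prop :=
  ∀ v : V, IsOpen {g : G | ρ g v = v}

/-- The subspace `V^H` of vectors fixed by a subgroup `H`. -/
noncomputable def fixedVectors (ρ : Representation k G V) (H : Subgroup G) : Submodule k V :=
  Representation.invariants (ρ.comp H.subtype)

/-- A representation is admissible if it is smooth and `V^H` is finite-dimensional for every
compact open subgroup `H`. -/
def IsAdmissibleRep (ρ : Representation k G V) : Prop :=
  IsSmoothRep ρ ∧
    ∀ H : Subgroup G, IsOpen (H : Set G) → IsCompact (H : Set G) →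
      FiniteDimensional k (fixedVectors ρ H)

end SmoothRepresentations

section CompactInduction

variable {k G V : Type*} [Field k] [Group G] [TopologicalSpace G] [IsTopologicalGroup G]
  [AddCommGroup V] [Module k V] {H : Subgroup G}

/-- The space of the compact induction `ind_H^G σ`: functions `f : G → V` such that
`f (g h) = σ (h⁻¹) (f g)` for `h ∈ H`, with support compact modulo `H`, that is, contained in
`C H` for some compact subset `C` of `G`. -/
def compactInd (σ : Representation k H V) : Submodule k (G → V) where
  carrier := {f | (∀ (g : G) (h : H), f (g * h) = σ h⁻¹ (f g)) ∧
    ∃ C : Set G, IsCompact C ∧ Function.support f ⊆ C * (H : Set G)}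
  zero_mem' := ⟨fun g h => by simp, ∅, isCompact_empty, by simp⟩
  add_mem' := by
    rintro f₁ f₂ ⟨h₁, C₁, hC₁, hs₁⟩ ⟨h₂, C₂, hC₂, hs₂⟩
    refine ⟨fun g h => by simp [h₁, h₂], C₁ ∪ C₂, hC₁.union hC₂, ?_⟩
    rw [Set.union_mul]
    exact (Function.support_add f₁ f₂).trans (Set.union_subset_union hs₁ hs₂)
  smul_mem' := by
    rintro c f ⟨h, C, hC, hs⟩
    exact ⟨fun g x => by simp [h], C, hC, (Function.support_const_smul_subset c f).trans hs⟩

/-- The action of `G` on `ind_H^G σ` by left translation: `(x • f) g = f (x⁻¹ g)`. -/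
def compactIndRep (σ : Representation k H V) : Representation k G (compactInd σ) where
  toFun x :=
    { toFun := fun f => ⟨fun g => f.1 (x⁻¹ * g), by
        obtain ⟨f, hf, C, hC, hs⟩ := f
        refine ⟨fun g h => by simp [← mul_assoc, hf], x • C, hC.smul x, ?_⟩
        intro g hg
        obtain ⟨c, hc, h, hh, e⟩ := hs (show x⁻¹ * g ∈ Function.support f from hg)
        refine ⟨x * c, ⟨c, hc, rfl⟩, h, hh, ?_⟩
        simp only [] at e ⊢
        rw [mul_assoc, e, mul_inv_cancel_left]⟩
      map_add' := fun _ _ => rfl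
      map_smul' := fun _ _ => rfl }
  map_one' := by
    ext f g
    simp
  map_mul' x y := by
    ext f g
    simp [mul_assoc]

open Classical in
/-- The element `[g, v]` of `ind_H^G σ`: the function with support in `g H` whose value at
`g` is `v`; thus `[g, v] (g h) = σ (h⁻¹) v` for `h ∈ H`. -/
noncomputable def compactIndSingle (σ : Representation k H V) (g : G) : V →ₗ[k] compactInd σ where
  toFun v := ⟨fun x => if hx : x⁻¹ * g ∈ H then σ ⟨x⁻¹ * g, hx⟩ v else 0, by
    refine ⟨fun x h => ?_, {g}, isCompact_singleton, fun x hx => ?_⟩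
    · have key : (x * (h : G))⁻¹ * g = (h : G)⁻¹ * (x⁻¹ * g) := by group
      by_cases hx : x⁻¹ * g ∈ H
      · have hx' : (x * (h : G))⁻¹ * g ∈ H := key ▸ H.mul_mem (H.inv_mem h.2) hx
        simp only [dif_pos hx, dif_pos hx']
        rw [← Module.End.mul_apply, ← map_mul]
        congr 2
        exact Subtype.ext key
      · have hx' : (x * (h : G))⁻¹ * g ∉ H := fun hmem =>
          hx ((H.mul_mem_cancel_left (H.inv_mem h.2)).1 (key ▸ hmem))
        simp only [dif_neg hx, dif_neg hx', map_zero]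
    · by_cases hmem : x⁻¹ * g ∈ H
      · refine ⟨g, rfl, g⁻¹ * x, ?_, by simp⟩
        simpa using H.inv_mem hmem
      · exact absurd (dif_neg hmem) hx⟩
  map_add' v w := by
    ext x
    by_cases hx : x⁻¹ * g ∈ H <;> simp [hx]
  map_smul' c v := by
    ext x
    by_cases hx : x⁻¹ * g ∈ H <;> simp [hx]

/-- The function `G → End_k(σ)` which corresponds to an endomorphism `T` of `ind_H^G σ` by
Frobenius reciprocity: its value at `g` sends `v` to `(T [1, v]) (g⁻¹)`. It determines `T`, and it
satisfies `f (h₁ g h₂) = σ h₁ ∘ f g ∘ σ h₂` for `h₁, h₂ ∈ H`. -/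
noncomputable def heckeFunction {σ : Representation k H V}
    (T : Representation.IntertwiningMap (compactIndRep σ) (compactIndRep σ)) (g : G) :
    Module.End k V :=
  LinearMap.proj g⁻¹ ∘ₗ (compactInd σ).subtype ∘ₗ T.toLinearMap ∘ₗ compactIndSingle σ 1

/-- The representation of `G` on the cokernel `ind_H^G σ / T (ind_H^G σ)`. -/
def cokernelRep {σ : Representation k H V}
    (T : Representation.IntertwiningMap (compactIndRep σ) (compactIndRep σ)) :
    Representation k G (compactInd σ ⧸ LinearMap.range T.toLinearMap) :=
  (compactIndRep σ).quotient (LinearMap.range T.toLinearMap) (by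
    rintro g _ ⟨f, rfl⟩
    exact ⟨compactIndRep σ g f, Representation.IntertwiningMap.isIntertwining _ _ T g f⟩)

end CompactInduction

section GL2

variable (p : ℕ) [Fact p.Prime] (F : Type*) [NormedField F] [NormedAlgebra ℚ_[p] F]
  [Algebra ℤ_[p] F]

/-- The subgroup `𝒦 = Z · GL₂(𝒪_F)` of `GL₂(F)`, where `𝒪_F` is the integral closure of `ℤ_p`
in `F`. -/
noncomputable def groupZK : Subgroup (GL (Fin 2) F) :=
  Subgroup.center (GL (Fin 2) F) ⊔
    (Matrix.GeneralLinearGroup.map (n := Fin 2)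
      (algebraMap (integralClosure ℤ_[p] F) F)).range

variable {p F}

/-- The matrix `α = diag(ϖ, 1)` of `GL₂(F)`, for a uniformizer `ϖ` of `𝒪_F`. -/
noncomputable def alphaGL (ϖ : integralClosure ℤ_[p] F) (hϖ : Irreducible ϖ) : GL (Fin 2) F :=
  Matrix.GeneralLinearGroup.mkOfDetNeZero !![(ϖ : F), 0; 0, 1] (by
    simpa [Matrix.det_fin_two] using hϖ.ne_zero)

/-- `T` is a nonzero endomorphism of `ind_𝒦^G σ` which corresponds to a function
`G → End_k(σ)` with support in the double coset `𝒦 α 𝒦`. -/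
def IsHeckeOperatorT {k V : Type*} [Field k] [AddCommGroup V] [Module k V]
    (ϖ : integralClosure ℤ_[p] F) (hϖ : Irreducible ϖ)
    {σ : Representation k (groupZK p F) V}
    (T : Representation.IntertwiningMap (compactIndRep σ) (compactIndRep σ)) : Prop :=
  T ≠ 0 ∧ Function.support (heckeFunction T) ⊆
    DoubleCoset.doubleCoset (alphaGL ϖ hϖ) (groupZK p F : Set (GL (Fin 2) F))
      (groupZK p F : Set (GL (Fin 2) F))

end GL2

/-!
The restriction of `σ` to `GL₂(𝒪_F)` factors through `GL₂` of the residue field `𝔽`, with `q`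
elements, and is a space of monomials `g 0, …, g r`, `r < q`, over the field of scalars generated by
the centre (`exists_isMonomialFamily`, `exists_isWeight`): the upper unipotent matrices act by
`u_b (g i) = ∑ (i + t choose i) b^t g (i + t)`, the permutation matrix by `w (g i) = ε g (r - i)`,
and `g i ≠ 0` if and only if `p` does not divide `(r choose i)`. An endomorphism `T` with support in
`𝒦 α 𝒦` is determined by the value `Ψ` of its function at `α`. Conversely, each `Ψ` with the evident
equivariance properties gives such an endomorphism, and the projection to the line of `g 0` is an
example (`exists_isHeckeOperatorT`). For any nonzero `T` the value `Φ` at `α⁻¹` kills all `g i` with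
`i ≠ r`, and `d = Φ (g r)` is a nonzero multiple of `g r` (`IsWeight.heckeFunction_apply`).

To refute admissibility, one finds an infinite linearly independent family in the vectors of the
cokernel which are fixed by the compact open subgroup of the matrices of `GL₂(𝒪_F)` that are upper
unipotent modulo `ϖ ^ m`. The operator `S = ∑ u_x α`, where `x` runs over representatives of `𝔽`,
preserves these vectors. If a function `y` lives on the vertices `u_x α` and its values there are
not of the form `Φ (u_x⁻¹ v)`, then looking at the outermost vertices of the tree shows that the
`S ^ n y` are linearly independent modulo the image of `T` (`linearIndependent_iterate`). So it is
enough to find `y` with this property such that `y` or `S y` is fixed in the cokernel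
(`not_isAdmissibleRep_of_isDetected`).

The image under `T` of `[1, g (r - t)]` shows that `∑ λ^t [u_λ α, d]` vanishes in the cokernel
whenever `p` does not divide `(r choose t)` and `t ≠ r`, and that it is a multiple of `[w α, d]` for
`t = r`. The candidate is `y = ∑ λ^s [u_λ α, d]`, where `p` divides `(r choose s)`.
* If `q = p ^ 2` and `0 < r < q - 1`, there is such an `s` for which all `t < s` with `(s choose t)`
  prime to `p` differ from `r` and have `(r choose t)` prime to `p`, by Lucas' theorem. The binomial
  formula then shows that `y` is fixed.
* If `r = 0`, or if `q = p` and `r < q - 1`, take `s = r + 1`. Now `y` is fixed only up to multiples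
  of `[w α, d]`, and in `S y` the resulting errors add up to a sum over `𝔽` of translates of `g 0`,
  weighted by the carries in the addition of the representatives. It vanishes: the carries sum to
  zero modulo `ϖ` because `ϖ ^ 2` divides `q`; and if `q = p`, they are all equal, because
  `ϖ ^ 2` divides `p`.
* If `r = q - 1`, then `y = ∑ [u_λ α, v]` with `v` a multiple of `g (r - 1)` is fixed, again since
  the carries sum to zero.

The divisibility of `q` by `ϖ ^ 2`, which holds since `e f = 2`, is the only way in which the degree
of `F` enters apart from the two possibilities for `q`.
-/

set_option linter.unusedSectionVars false

/-! ### Polynomial functions on a finite field with values in a vector space -/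

section PolynomialFunctions

variable {𝔽 k V : Type*} [Field 𝔽] [Fintype 𝔽] [CommRing k] [AddCommGroup V] [Module k V]
  (τ : 𝔽 →+* k)

lemma sum_map_pow_eq_zero {i : ℕ} (hi : i < Fintype.card 𝔽 - 1) :
    ∑ x : 𝔽, τ x ^ i = 0 := by
  simpa using congrArg τ (FiniteField.sum_pow_lt_card_sub_one 𝔽 i hi)

lemma sum_pow_card_sub_one_eq : ∑ x : 𝔽, x ^ (Fintype.card 𝔽 - 1) = -1 := by
  classical
  have h1 : 1 < Fintype.card 𝔽 := Fintype.one_lt_card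
  have h : ∀ x : 𝔽, x ^ (Fintype.card 𝔽 - 1) = if x = 0 then 0 else 1 := by
    intro x
    split_ifs with hx
    · subst hx; exact zero_pow (by omega)
    · exact FiniteField.pow_card_sub_one_eq_one x hx
  simp only [h]
  rw [Finset.sum_ite, Finset.sum_const_zero, zero_add, Finset.sum_const, Finset.filter_ne',
    Finset.card_erase_of_mem (Finset.mem_univ _), Finset.card_univ, nsmul_eq_mul,
    Nat.cast_sub h1.le, FiniteField.cast_card_eq_zero]
  simp

lemma sum_map_pow_card_sub_one : ∑ x : 𝔽, τ x ^ (Fintype.card 𝔽 - 1) = -1 := by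
  simpa using congrArg τ (sum_pow_card_sub_one_eq (𝔽 := 𝔽))

lemma sum_map_pow_eq_ite {i : ℕ} (hi : i < 2 * (Fintype.card 𝔽 - 1)) :
    ∑ x : 𝔽, τ x ^ i = if i = Fintype.card 𝔽 - 1 then -1 else 0 := by
  have h1 : 1 < Fintype.card 𝔽 := Fintype.one_lt_card
  split_ifs with h
  · rw [h, sum_map_pow_card_sub_one]
  · rcases lt_or_gt_of_ne h with h | h
    · exact sum_map_pow_eq_zero τ h
    · rw [← sum_map_pow_eq_zero τ (i := i - (Fintype.card 𝔽 - 1)) (by omega)]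
      refine Finset.sum_congr rfl fun x _ => ?_
      have e : i = Fintype.card 𝔽 + (i - (Fintype.card 𝔽 - 1) - 1) := by omega
      rw [e, pow_add, ← map_pow, FiniteField.pow_card, ← pow_succ']
      congr 1
      omega

/-- The coefficients of the polynomial of degree less than `|𝔽|` that interpolates `h`. -/
noncomputable def interpCoeff (h : 𝔽 → V) (i : ℕ) : V :=
  if i < Fintype.card 𝔽 then
    if i = 0 then h 0 else -∑ y : 𝔽, τ y ^ (Fintype.card 𝔽 - 1 - i) • h y
  else 0

lemma interpCoeff_of_card_le (h : 𝔽 → V) {i : ℕ} (hi : Fintype.card 𝔽 ≤ i) :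
    interpCoeff τ h i = 0 := if_neg hi.not_gt

lemma interpCoeff_zero (h : 𝔽 → V) : interpCoeff τ h 0 = h 0 := by
  rw [interpCoeff, if_pos Fintype.card_pos, if_pos rfl]

lemma interpCoeff_of_pos (h : 𝔽 → V) {i : ℕ} (hi : i ≠ 0) (hq : i < Fintype.card 𝔽) :
    interpCoeff τ h i = -∑ y : 𝔽, τ y ^ (Fintype.card 𝔽 - 1 - i) • h y := by
  rw [interpCoeff, if_pos hq, if_neg hi]

/-- The kernel of Lagrange interpolation on `𝔽`, by the factorization of `x ^ q - y ^ q`. -/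
lemma lagrange_kernel_eq_ite [DecidableEq 𝔽] (x y : 𝔽) :
    (if y = 0 then 1 else 0) -
      ∑ i ∈ Finset.range (Fintype.card 𝔽 - 1), x ^ (i + 1) * y ^ (Fintype.card 𝔽 - 1 - (i + 1)) =
      if y = x then 1 else 0 := by
  have h1 : 1 < Fintype.card 𝔽 := Fintype.one_lt_card
  obtain ⟨n, hn⟩ : ∃ n, Fintype.card 𝔽 = n + 1 := ⟨Fintype.card 𝔽 - 1, by omega⟩
  have hgs := (Commute.all x y).geom_sum₂_mul (n + 1)
  rw [← hn, FiniteField.pow_card, FiniteField.pow_card, hn, Finset.sum_range_succ'] at hgs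
  simp only [Nat.add_sub_cancel, hn, pow_zero, one_mul, Nat.sub_zero] at hgs ⊢
  by_cases hxy : y = x
  · subst hxy
    rw [if_pos rfl]
    by_cases hy : y = 0
    · subst hy
      simp
    · rw [if_neg hy]
      have : ∀ i ∈ Finset.range n, y ^ (i + 1) * y ^ (n - (i + 1)) = 1 := by
        intro i hi
        have := Finset.mem_range.1 hi
        rw [← pow_add, show i + 1 + (n - (i + 1)) = Fintype.card 𝔽 - 1 by omega]
        exact FiniteField.pow_card_sub_one_eq_one y hy
      rw [Finset.sum_congr rfl this]
      have := FiniteField.cast_card_eq_zero 𝔽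
      rw [hn] at this
      push_cast at this
      simp only [Finset.sum_const, Finset.card_range, nsmul_eq_mul, mul_one]
      linear_combination -this
  · rw [if_neg hxy]
    have h2 := mul_right_cancel₀ (sub_ne_zero.2 (Ne.symm hxy)) (hgs.trans (one_mul _).symm)
    by_cases hy : y = 0
    · subst hy
      rw [zero_pow (by omega), add_zero] at h2
      rw [h2]; simp
    · have h3 := FiniteField.pow_card_sub_one_eq_one y hy
      rw [hn, Nat.add_sub_cancel] at h3
      rw [h3] at h2
      rw [if_neg hy]
      linear_combination -h2

lemma sum_interpCoeff (h : 𝔽 → V) (x : 𝔽) :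
    ∑ i ∈ Finset.range (Fintype.card 𝔽), τ x ^ i • interpCoeff τ h i = h x := by
  classical
  have h1 : 1 < Fintype.card 𝔽 := Fintype.one_lt_card
  obtain ⟨n, hn⟩ : ∃ n, Fintype.card 𝔽 = n + 1 := ⟨Fintype.card 𝔽 - 1, by omega⟩
  have key : ∀ y : 𝔽, (if y = 0 then (1 : k) else 0) -
      ∑ i ∈ Finset.range n, τ x ^ (i + 1) * τ y ^ (n - (i + 1)) =
      if y = x then 1 else 0 := by
    intro y
    have := congrArg τ (lagrange_kernel_eq_ite x y)
    simpa [hn, apply_ite τ] using this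
  rw [hn, Finset.sum_range_succ', pow_zero, one_smul, interpCoeff_zero]
  have e : ∀ i ∈ Finset.range n, τ x ^ (i + 1) • interpCoeff τ h (i + 1) =
      -∑ y : 𝔽, (τ x ^ (i + 1) * τ y ^ (n - (i + 1))) • h y := by
    intro i hi
    have := Finset.mem_range.1 hi
    rw [interpCoeff_of_pos τ h (by omega) (by omega), smul_neg, Finset.smul_sum, hn]
    simp only [smul_smul, Nat.add_sub_cancel]
  rw [Finset.sum_congr rfl e, Finset.sum_neg_distrib, Finset.sum_comm]
  simp only [← Finset.sum_smul]
  have h0 : h 0 = ∑ y : 𝔽, (if y = 0 then (1 : k) else 0) • h y := by simp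
  rw [h0, ← Finset.sum_neg_distrib, ← Finset.sum_add_distrib]
  have : ∀ y : 𝔽, -((∑ i ∈ Finset.range n, τ x ^ (i + 1) * τ y ^ (n - (i + 1))) • h y) +
      (if y = 0 then (1 : k) else 0) • h y = (if y = x then (1 : k) else 0) • h y := by
    intro y
    rw [← key y, sub_smul]
    abel
  rw [Finset.sum_congr rfl fun y _ => this y]
  simp

/-- A polynomial function on `𝔽` of degree less than `|𝔽|` determines its coefficients. -/
lemma coeff_eq_zero_of_polyFun_eq_zero {a : ℕ → V}
    (h : ∀ x : 𝔽, ∑ i ∈ Finset.range (Fintype.card 𝔽), τ x ^ i • a i = 0)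
    {j : ℕ} (hj : j < Fintype.card 𝔽) : a j = 0 := by
  have h1 : 1 < Fintype.card 𝔽 := Fintype.one_lt_card
  by_cases hj0 : j = 0
  · have := h 0
    rw [Finset.sum_eq_single 0] at this
    · simpa [hj0] using this
    · intro i _ hi
      simp [zero_pow hi]
    · intro h; simp at h
  · have h2 : ∑ x : 𝔽, τ x ^ (Fintype.card 𝔽 - 1 - j) •
        ∑ i ∈ Finset.range (Fintype.card 𝔽), τ x ^ i • a i = 0 := by simp [h]
    simp only [Finset.smul_sum, smul_smul, ← pow_add] at h2
    rw [Finset.sum_comm] at h2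
    simp only [← Finset.sum_smul] at h2
    rw [Finset.sum_eq_single j] at h2
    · rw [sum_map_pow_eq_ite τ (by omega), if_pos (by omega)] at h2
      simpa using h2
    · intro i hi hij
      have := Finset.mem_range.1 hi
      rw [sum_map_pow_eq_ite τ (by omega), if_neg (by omega), zero_smul]
    · intro h; exact absurd (Finset.mem_range.2 hj) h

lemma coeff_eq_of_polyFun_eq {a b : ℕ → V}
    (h : ∀ x : 𝔽, ∑ i ∈ Finset.range (Fintype.card 𝔽), τ x ^ i • a i =
      ∑ i ∈ Finset.range (Fintype.card 𝔽), τ x ^ i • b i)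
    {j : ℕ} (hj : j < Fintype.card 𝔽) : a j = b j := by
  refine sub_eq_zero.1 (coeff_eq_zero_of_polyFun_eq_zero τ (a := fun i => a i - b i) ?_ hj)
  intro x
  simp only [smul_sub, Finset.sum_sub_distrib, h, sub_self]

end PolynomialFunctions

/-! ### The divisibility order on exponents -/

section ChooseOrder

/-- `choose j i` is prime to `p`; by Lucas' theorem this says that the digits of `i` in base `p`
are bounded by those of `j`. -/
def ChooseLE (p i j : ℕ) : Prop := ¬ p ∣ j.choose i

variable {p : ℕ}

lemma ChooseLE.le {i j : ℕ} (h : ChooseLE p i j) : i ≤ j := by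
  by_contra hij
  exact h (by rw [Nat.choose_eq_zero_of_lt (not_le.1 hij)]; exact dvd_zero p)

lemma chooseLE_refl (hp : p.Prime) (i : ℕ) : ChooseLE p i i := by
  simp [ChooseLE, hp.one_lt.ne']

lemma chooseLE_zero (hp : p.Prime) (i : ℕ) : ChooseLE p 0 i := by
  simp [ChooseLE, hp.one_lt.ne']

lemma ChooseLE.trans (hp : p.Prime) {i j l : ℕ} (h : ChooseLE p i j) (h' : ChooseLE p j l) :
    ChooseLE p i l := by
  intro hd
  have := Nat.choose_mul (n := l) h.le
  have hd' : p ∣ l.choose j * j.choose i := by rw [this]; exact dvd_mul_of_dvd_left hd _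
  rcases (hp.dvd_mul).1 hd' with h1 | h1
  · exact h' h1
  · exact h h1

lemma ChooseLE.sub {i j : ℕ} (h : ChooseLE p i j) : ChooseLE p (j - i) j := by
  rw [ChooseLE, Nat.choose_symm h.le]; exact h

lemma ChooseLE.cast_ne_zero {i j : ℕ} (k : Type*) [CommRing k] [CharP k p] (h : ChooseLE p i j) :
    (j.choose i : k) ≠ 0 := fun h' => h ((CharP.cast_eq_zero_iff k p _).1 h')

lemma cast_choose_eq_zero {i j : ℕ} (k : Type*) [CommRing k] [CharP k p] (h : ¬ ChooseLE p i j) :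
    (j.choose i : k) = 0 := (CharP.cast_eq_zero_iff k p _).2 (not_not.1 h)

lemma chooseLE_of_le_of_lt (hp : p.Prime) {i j : ℕ} (hij : i ≤ j) (hj : j < p) :
    ChooseLE p i j := by
  intro h
  have h1 : p ∣ j.factorial := by
    rw [← Nat.choose_mul_factorial_mul_factorial hij, mul_assoc]
    exact dvd_mul_of_dvd_left h _
  exact absurd ((hp.dvd_factorial).1 h1) (by omega)

/-- Lucas' theorem: `ChooseLE` compares the digits in base `p`. -/
lemma chooseLE_add_mul_iff (hp : p.Prime) {a b c d : ℕ} (ha : a < p) (hc : c < p) :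
    ChooseLE p (a + p * b) (c + p * d) ↔ ChooseLE p a c ∧ ChooseLE p b d := by
  have : Fact p.Prime := ⟨hp⟩
  have h := Choose.choose_modEq_choose_mod_mul_choose_div_nat (p := p) (n := c + p * d)
    (k := a + p * b)
  rw [Nat.add_mul_mod_self_left, Nat.add_mul_mod_self_left, Nat.mod_eq_of_lt ha,
    Nat.mod_eq_of_lt hc, Nat.add_mul_div_left _ _ hp.pos, Nat.add_mul_div_left _ _ hp.pos,
    Nat.div_eq_of_lt ha, Nat.div_eq_of_lt hc, zero_add, zero_add] at h
  rw [ChooseLE, ChooseLE, ChooseLE, h.dvd_iff dvd_rfl, hp.dvd_mul, not_or]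

/-- For a two-digit exponent `r` other than `0` and `p ^ 2 - 1` there is an exponent `s` which is
not below `r` but has only exponents other than `r` and below `r` under it. -/
lemma exists_minimal_not_chooseLE (hp : p.Prime) {r : ℕ} (h0 : r ≠ 0)
    (hr : r < p ^ 2 - 1) : ∃ s < p ^ 2, ¬ ChooseLE p s r ∧
      ∀ t < s, ChooseLE p t s → ChooseLE p t r ∧ t ≠ r := by
  have hp2 := hp.two_le
  obtain ⟨a, b, ha, rfl⟩ : ∃ a b, a < p ∧ r = a + p * b :=
    ⟨r % p, r / p, Nat.mod_lt _ hp.pos, (Nat.mod_add_div r p).symm⟩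
  have hb : b < p := by
    by_contra hb
    have := Nat.mul_le_mul_left p (not_lt.1 hb)
    rw [pow_two] at hr
    omega
  -- `s` is obtained from the digits `a`, `b` of `r`: it is `a + 1` if this is a digit other than
  -- `r + 1`, and `p * (b + 1)` otherwise.
  by_cases hcase : a < p - 1 ∧ b ≠ 0
  · obtain ⟨h1, h2⟩ := hcase
    have hpb : p ≤ p * b := Nat.le_mul_of_pos_right p (Nat.pos_of_ne_zero h2)
    refine ⟨a + 1, by nlinarith, fun h => ?_, fun t ht _ => ⟨?_, by omega⟩⟩
    · have h3 : ChooseLE p ((a + 1) + p * 0) (a + p * b) := by rwa [mul_zero, add_zero]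
      have := ((chooseLE_add_mul_iff hp (by omega) ha).1 h3).1.le
      omega
    · have h3 := (chooseLE_add_mul_iff hp (a := t) (b := 0) (d := b) (by omega) ha).2
        ⟨chooseLE_of_le_of_lt hp (by omega) ha, chooseLE_zero hp _⟩
      rwa [mul_zero, add_zero] at h3
  · have hb1 : b + 1 < p := by
      by_contra hb1
      have hb2 : b = p - 1 := by omega
      obtain ⟨n, rfl⟩ : ∃ n, p = n + 1 := ⟨p - 1, by omega⟩
      have ha2 : a = n := by
        by_contra
        exact hcase ⟨by omega, by omega⟩
      subst ha2
      rw [hb2, Nat.add_sub_cancel, pow_two] at hr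
      have : (a + 1) * (a + 1) = a + (a + 1) * a + 1 := by ring
      omega
    refine ⟨p * (b + 1), by nlinarith, fun h => ?_, fun t ht hts => ?_⟩
    · have h3 : ChooseLE p (0 + p * (b + 1)) (a + p * b) := by rwa [zero_add]
      have := ((chooseLE_add_mul_iff hp hp.pos ha).1 h3).2.le
      omega
    · obtain ⟨t₀, t₁, ht₀, rfl⟩ : ∃ t₀ t₁, t₀ < p ∧ t = t₀ + p * t₁ :=
        ⟨t % p, t / p, Nat.mod_lt _ hp.pos, (Nat.mod_add_div t p).symm⟩
      have h3 : ChooseLE p (t₀ + p * t₁) (0 + p * (b + 1)) := by rwa [zero_add]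
      have h4 := ((chooseLE_add_mul_iff hp ht₀ hp.pos).1 h3).1.le
      obtain rfl : t₀ = 0 := by omega
      rw [zero_add] at ht ⊢
      have ht1 : t₁ ≤ b := by
        have := Nat.lt_of_mul_lt_mul_left ht
        omega
      constructor
      · have h5 := (chooseLE_add_mul_iff hp (a := 0) (b := t₁) (d := b) hp.pos ha).2
          ⟨chooseLE_zero hp _, chooseLE_of_le_of_lt hp ht1 hb⟩
        rwa [zero_add] at h5
      · intro he
        have ha0 : a = 0 := by
          have := congrArg (· % p) he
          simpa [Nat.mod_eq_of_lt ha] using this.symm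
        exact hcase ⟨by omega, fun hb0 => h0 (by rw [ha0, hb0, mul_zero, zero_add])⟩

end ChooseOrder

/-! ### Vectors fixed by a group of `p`-power exponent in characteristic `p` -/

/-- A group acting through operators of `p`-power order on a nonzero vector space of characteristic
`p`, with a finite orbit, fixes a nonzero vector: the additive group generated by the orbit is a
finite `p`-group. -/
lemma exists_fixed_vector_of_pow_eq_one {k V P : Type*} [CommRing k] [AddCommGroup V] [Module k V]
    [Group P] (p : ℕ) [Fact p.Prime] [CharP k p] (ρ : Representation k P V) {v : V} (hv : v ≠ 0)
    (hfin : (Set.range fun g => ρ g v).Finite) (hpow : ∀ g, ∃ n : ℕ, ρ (g ^ p ^ n) = 1) :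
    ∃ w : V, w ≠ 0 ∧ ∀ g, ρ g w = w := by
  classical
  let : Algebra (ZMod p) k := ZMod.algebra k p
  let : Module (ZMod p) V := Module.compHom V (algebraMap (ZMod p) k)
  let W : Submodule (ZMod p) V := Submodule.span (ZMod p) (Set.range fun g => ρ g v)
  have : Module.Finite (ZMod p) W := Module.Finite.span_of_finite _ hfin
  have : Finite W := Module.finite_of_finite (ZMod p)
  have hsm : ∀ (g : P) (c : ZMod p) (x : V), ρ g (c • x) = c • ρ g x := fun g c x =>
    (ρ g).map_smul (algebraMap (ZMod p) k c) x
  have hW : ∀ (g : P) (x : V), x ∈ W → ρ g x ∈ W := by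
    intro g x hx
    induction hx using Submodule.span_induction with
    | mem x hx =>
      obtain ⟨g', rfl⟩ := hx
      refine Submodule.subset_span ⟨g * g', ?_⟩
      simp
    | zero => simp
    | add x y _ _ hx hy => rw [map_add]; exact W.add_mem hx hy
    | smul c x _ hx => rw [hsm]; exact W.smul_mem _ hx
  let : MulAction P W :=
    { smul := fun g x => ⟨ρ g x, hW g x x.2⟩
      one_smul := fun x => Subtype.ext (by change ρ 1 (x : V) = x; simp)
      mul_smul := fun g h x => Subtype.ext (by
        change ρ (g * h) (x : V) = ρ g (ρ h x); simp) }
  have hsmul : ∀ (g : P) (x : W), ((g • x : W) : V) = ρ g x := fun _ _ => rfl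
  let Q := (MulAction.toPermHom P W).range
  have hQ : IsPGroup p Q := by
    rintro ⟨_, g, rfl⟩
    obtain ⟨n, hn⟩ := hpow g
    refine ⟨n, Subtype.ext ?_⟩
    change (MulAction.toPermHom P W g) ^ p ^ n = 1
    rw [← map_pow]
    ext x
    change ρ (g ^ p ^ n) (x : V) = x
    rw [hn]; rfl
  have hvW : v ∈ W := Submodule.subset_span ⟨1, by simp⟩
  have hcard : p ∣ Nat.card W := by
    have : Nontrivial W := ⟨⟨v, hvW⟩, 0, fun h => hv (congrArg Subtype.val h)⟩
    have hpW : IsPGroup p (Multiplicative W) := by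
      intro x
      refine ⟨1, ?_⟩
      change (p ^ 1) • (Multiplicative.toAdd x) = (0 : W)
      rw [pow_one]
      apply Subtype.ext
      change ((p • Multiplicative.toAdd x : W) : V) = 0
      rw [Submodule.coe_smul_of_tower, ← Nat.cast_smul_eq_nsmul k, CharP.cast_eq_zero, zero_smul]
    obtain ⟨n, hn0, hn⟩ := hpW.nontrivial_iff_card.1 inferInstance
    change Nat.card W = p ^ n at hn
    rw [hn]; exact dvd_pow_self _ hn0.ne'
  have h0 : (0 : W) ∈ MulAction.fixedPoints Q W := by
    rintro ⟨_, g, rfl⟩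
    apply Subtype.ext
    change ρ g ((0 : W) : V) = 0
    simp
  obtain ⟨b, hb, hb0⟩ := hQ.exists_fixed_point_of_prime_dvd_card_of_fixed_point W hcard h0
  refine ⟨b, fun h => hb0 (Subtype.ext h.symm), fun g => ?_⟩
  exact congrArg Subtype.val (hb ⟨_, g, rfl⟩)

/-! ### Generators of `GL₂` over a local ring -/

section Generators

variable {R : Type*} [CommRing R]

/-- The upper unipotent matrix with entry `x`. -/
def uGL (x : R) : GL (Fin 2) R where
  val := !![1, x; 0, 1]
  inv := !![1, -x; 0, 1]
  val_inv := by ext i j; fin_cases i <;> fin_cases j <;> simp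
  inv_val := by ext i j; fin_cases i <;> fin_cases j <;> simp

variable (R) in
/-- The permutation matrix of `GL₂`. -/
def wGL : GL (Fin 2) R where
  val := !![0, 1; 1, 0]
  inv := !![0, 1; 1, 0]
  val_inv := by ext i j; fin_cases i <;> fin_cases j <;> simp
  inv_val := by ext i j; fin_cases i <;> fin_cases j <;> simp

/-- The diagonal matrix with entries `a`, `d`. -/
def dGL (a d : Rˣ) : GL (Fin 2) R where
  val := !![(a : R), 0; 0, (d : R)]
  inv := !![((a⁻¹ : Rˣ) : R), 0; 0, ((d⁻¹ : Rˣ) : R)]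
  val_inv := by ext i j; fin_cases i <;> fin_cases j <;> simp
  inv_val := by ext i j; fin_cases i <;> fin_cases j <;> simp

@[simp] lemma coe_uGL (x : R) : (uGL x : Matrix (Fin 2) (Fin 2) R) = !![1, x; 0, 1] := rfl
@[simp] lemma coe_wGL : (wGL R : Matrix (Fin 2) (Fin 2) R) = !![0, 1; 1, 0] := rfl
@[simp] lemma coe_dGL (a d : Rˣ) :
    (dGL a d : Matrix (Fin 2) (Fin 2) R) = !![(a : R), 0; 0, (d : R)] := rfl

lemma uGL_add (x y : R) : uGL (x + y) = uGL x * uGL y := by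
  ext i j; fin_cases i <;> fin_cases j <;> simp [add_comm]

lemma uGL_zero : uGL (0 : R) = 1 := by
  ext i j; fin_cases i <;> fin_cases j <;> simp

lemma uGL_inv (x : R) : (uGL x)⁻¹ = uGL (-x) := by
  rw [inv_eq_iff_mul_eq_one, ← uGL_add, add_neg_cancel, uGL_zero]

lemma wGL_mul_self : wGL R * wGL R = 1 := by
  ext i j; fin_cases i <;> fin_cases j <;> simp

lemma dGL_mul (a b a' b' : Rˣ) : dGL (a * a') (b * b') = dGL a b * dGL a' b' := by
  ext i j; fin_cases i <;> fin_cases j <;> simp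

lemma dGL_one : dGL (1 : Rˣ) 1 = 1 := by
  ext i j; fin_cases i <;> fin_cases j <;> simp

lemma dGL_mul_uGL (a b : Rˣ) (x : R) :
    dGL a b * uGL x = uGL (a * x * ((b⁻¹ : Rˣ) : R)) * dGL a b := by
  ext i j; fin_cases i <;> fin_cases j <;> simp [mul_assoc]

lemma wGL_mul_dGL (a b : Rˣ) : wGL R * dGL a b = dGL b a * wGL R := by
  ext i j; fin_cases i <;> fin_cases j <;> simp

lemma wGL_uGL_wGL (x : Rˣ) : wGL R * uGL (x : R) * wGL R =
    uGL ((x⁻¹ : Rˣ) : R) * wGL R * dGL x (-x⁻¹) * uGL ((x⁻¹ : Rˣ) : R) := by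
  ext i j; fin_cases i <;> fin_cases j <;> simp

lemma map_uGL {S : Type*} [CommRing S] (f : R →+* S) (x : R) :
    Matrix.GeneralLinearGroup.map f (uGL x) = uGL (f x) := by
  ext i j; fin_cases i <;> fin_cases j <;> simp

lemma map_wGL {S : Type*} [CommRing S] (f : R →+* S) :
    Matrix.GeneralLinearGroup.map f (wGL R) = wGL S := by
  ext i j; fin_cases i <;> fin_cases j <;> simp

lemma map_dGL {S : Type*} [CommRing S] (f : R →+* S) (a b : Rˣ) :
    Matrix.GeneralLinearGroup.map f (dGL a b) = dGL (Units.map f a) (Units.map f b) := by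
  ext i j; fin_cases i <;> fin_cases j <;> simp

/-- A matrix whose lower right entry is invertible lies in `U U⁻ T`; here `w u_y w` is the lower
unipotent matrix with entry `y`. -/
lemma exists_eq_upper_lower_diag {g : GL (Fin 2) R} (hg : IsUnit (g 1 1)) :
    ∃ (x y : R) (a d : Rˣ), g 0 1 = x * g 1 1 ∧
      g = uGL x * (wGL R * uGL y * wGL R) * dGL a d := by
  obtain ⟨d, hd⟩ := hg
  let δ : Rˣ := Matrix.GeneralLinearGroup.det g
  have hδ : (δ : R) = g 0 0 * g 1 1 - g 0 1 * g 1 0 := by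
    change (g : Matrix (Fin 2) (Fin 2) R).det = _
    rw [Matrix.det_fin_two]
  have hdd : ((d⁻¹ : Rˣ) : R) * d = 1 := by simp
  have hδδ : ((δ⁻¹ : Rˣ) : R) * δ = 1 := by simp
  refine ⟨g 0 1 * (d⁻¹ : Rˣ), g 1 0 * ((δ * d⁻¹)⁻¹ : Rˣ), δ * d⁻¹, d, ?_, ?_⟩
  · rw [← hd, mul_assoc, hdd, mul_one]
  · ext i j; fin_cases i <;> fin_cases j
    · simp [hδ, ← hd]
      generalize ((d⁻¹ : Rˣ) : R) = e at *
      generalize ((δ⁻¹ : Rˣ) : R) = e' at *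
      rw [← hd] at hδ
      linear_combination -(g 0 0) * hdd + e ^ 2 * g 0 1 * g 1 0 * d * e' * hδ -
        e * g 0 1 * g 1 0 * (e * d * hδδ + hdd)
    · simp [mul_assoc]
    · simp [mul_assoc]
    · simp [hd]

/-- Over a local ring, a property of matrices in `GL₂` that is stable under products holds as soon
as it holds for `u_x`, `w` and the diagonal matrices. -/
lemma gl2_induction [IsLocalRing R] {P : GL (Fin 2) R → Prop} (hu : ∀ x, P (uGL x))
    (hw : P (wGL R)) (hd : ∀ a d, P (dGL a d)) (hmul : ∀ g h, P g → P h → P (g * h))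
    (g : GL (Fin 2) R) : P g := by
  have key : ∀ g : GL (Fin 2) R, IsUnit (g 1 1) → P g := by
    intro g hg
    obtain ⟨x, y, a, d, -, rfl⟩ := exists_eq_upper_lower_diag hg
    exact hmul _ _ (hmul _ _ (hu x) (hmul _ _ (hmul _ _ hw (hu y)) hw)) (hd a d)
  by_cases h : IsUnit (g 1 1)
  · exact key g h
  · have h2 : IsUnit (g 0 1) := by
      by_contra h2
      have h3 : IsUnit (g 0 0 * g 1 1 - g 0 1 * g 1 0) := by
        have := (Matrix.GeneralLinearGroup.det g).isUnit
        change IsUnit ((g : Matrix (Fin 2) (Fin 2) R).det) at this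
        rwa [Matrix.det_fin_two] at this
      have h4 : g 0 0 * g 1 1 - g 0 1 * g 1 0 ∈ IsLocalRing.maximalIdeal R :=
        Ideal.sub_mem _ (Ideal.mul_mem_left _ _ ((IsLocalRing.mem_maximalIdeal _).2 h))
          (Ideal.mul_mem_right _ _ ((IsLocalRing.mem_maximalIdeal _).2 h2))
      exact (IsLocalRing.mem_maximalIdeal _).1 h4 h3
    have h5 : P (wGL R * g) := by
      refine key _ ?_
      simpa [Matrix.mul_apply, Fin.sum_univ_two] using h2
    have := hmul _ _ hw h5
    rwa [← mul_assoc, wGL_mul_self, one_mul] at this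

end Generators

/-! ### Irreducible representations of `GL₂` of a finite field in its own characteristic -/

section FiniteGL2

variable {𝔽 L V : Type*} [Field 𝔽] [Fintype 𝔽] [CommRing L] [AddCommGroup V] [Module L V]
  (τ : 𝔽 →+* L)

lemma sum_eq_zero_add_sum_units [DecidableEq 𝔽] {M : Type*} [AddCommMonoid M] (f : 𝔽 → M) :
    ∑ x, f x = f 0 + ∑ x : 𝔽ˣ, f x := by
  rw [← Fintype.sum_subtype_add_sum_subtype (fun x : 𝔽 => x = 0) f]
  congr 1
  · simp
    rfl
  · exact (Fintype.sum_equiv unitsEquivNeZero _ _ fun x => rfl).symm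

/-- A commuting family of operators indexed by `𝔽ˣ` has an eigenvector in every stable nonzero
subspace, with eigenvalues a power of `τ`: the sum of the eigencomponents of `v` is `-v`. -/
lemma exists_eigenvector_units [DecidableEq 𝔽] (χ : 𝔽ˣ →* Module.End L V) (W : Submodule L V)
    (hW : W ≠ ⊥)
    (hstab : ∀ a, ∀ x ∈ W, χ a x ∈ W) :
    ∃ (m : ℕ) (v : V), v ∈ W ∧ v ≠ 0 ∧ ∀ a : 𝔽ˣ, χ a v = τ a ^ m • v := by
  obtain ⟨v, hv, hv0⟩ := (Submodule.ne_bot_iff _).1 hW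
  let c : ℕ → V := fun m => ∑ a : 𝔽ˣ, τ ((a⁻¹ : 𝔽ˣ) : 𝔽) ^ m • χ a v
  have hc : ∀ m (b : 𝔽ˣ), χ b (c m) = τ b ^ m • c m := by
    intro m b
    simp only [c, map_sum, map_smul, Finset.smul_sum]
    refine Fintype.sum_equiv (Equiv.mulLeft b) _ _ fun a => ?_
    have : τ b ^ m * τ (((b * a)⁻¹ : 𝔽ˣ) : 𝔽) ^ m = τ ((a⁻¹ : 𝔽ˣ) : 𝔽) ^ m := by
      rw [← mul_pow, ← map_mul]
      congr 2
      rw [← Units.val_mul]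
      rw [mul_inv_rev, mul_comm, mul_assoc, inv_mul_cancel, mul_one]
    rw [Equiv.coe_mulLeft, smul_smul, this, map_mul, Module.End.mul_apply]
  by_contra hcon
  push Not at hcon
  have hc0 : ∀ m, c m = 0 := by
    intro m
    by_contra h
    obtain ⟨a, ha⟩ := hcon m (c m) (W.sum_mem fun a _ => W.smul_mem _ (hstab a v hv)) h
    exact ha (hc m a)
  have h1 : 1 < Fintype.card 𝔽 := Fintype.one_lt_card
  have hg : ∀ x : 𝔽ˣ, ∑ m ∈ Finset.range (Fintype.card 𝔽 - 1), τ x ^ m =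
      if x = 1 then -1 else 0 := by
    intro x
    split_ifs with hx
    · have := congrArg τ (FiniteField.cast_card_eq_zero 𝔽)
      simp only [map_natCast, map_zero] at this
      simp [hx, Nat.cast_sub h1.le, this]
    · have h2 : (x : 𝔽) - 1 ≠ 0 := fun h => hx (Units.ext (by simpa using sub_eq_zero.1 h))
      have h3 := geom_sum_mul (x : 𝔽) (Fintype.card 𝔽 - 1)
      rw [FiniteField.pow_card_sub_one_eq_one _ x.ne_zero, sub_self] at h3
      have := congrArg τ ((mul_eq_zero.1 h3).resolve_right h2)
      simpa using this
  have : ∑ m ∈ Finset.range (Fintype.card 𝔽 - 1), c m = -v := by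
    simp only [c]
    rw [Finset.sum_comm]
    simp only [← Finset.sum_smul, hg]
    simp
  rw [Finset.sum_eq_zero fun m _ => hc0 m] at this
  exact hv0 (neg_eq_zero.1 this.symm)

/-- A family `g` of weight vectors spanning a representation of `GL₂(𝔽)` on which the group acts as
on the monomials `g_i = (r choose i) X^i Y^(r-i)`, `(r choose i) ≠ 0` in `𝔽`, by substitution in
`X`, `Y` and up to a character of the determinant. -/
structure IsMonomialFamily (p : ℕ) (ρ : Representation L (GL (Fin 2) 𝔽) V) (r : ℕ) (ε : L)
    (g : ℕ → V) : Prop where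
  r_lt : r < Fintype.card 𝔽
  eps : ε * ε = 1
  ne_zero_iff : ∀ i, g i ≠ 0 ↔ ChooseLE p i r
  u_apply : ∀ (b : 𝔽) (i : ℕ), ρ (uGL b) (g i) =
    ∑ t ∈ Finset.range (Fintype.card 𝔽), τ b ^ t • ((i + t).choose i : L) • g (i + t)
  w_apply : ∀ i, ChooseLE p i r → ρ (wGL 𝔽) (g i) = ε • g (r - i)
  d_apply : ∀ (a b : 𝔽ˣ) (i : ℕ), ∃ c : L, ρ (dGL a b) (g i) = c • g i
  span_eq_top : Submodule.span L (Set.range g) = ⊤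

lemma sum_add_pow_smul {q : ℕ} {g : ℕ → V} (hg : ∀ i, q ≤ i → g i = 0) (a b : L) :
    ∑ n ∈ Finset.range q, (a + b) ^ n • g n =
      ∑ i ∈ Finset.range q, a ^ i • ∑ t ∈ Finset.range q,
        b ^ t • ((i + t).choose i : L) • g (i + t) := by
  simp only [Finset.smul_sum]
  rw [← Finset.sum_product' (f := fun i t => a ^ i • b ^ t • ((i + t).choose i : L) • g (i + t))]
  have hsub : ((Finset.range q ×ˢ Finset.range q).filter fun m => m.1 + m.2 < q) ⊆
      Finset.range q ×ˢ Finset.range q := Finset.filter_subset _ _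
  rw [← Finset.sum_subset hsub, ← Finset.sum_fiberwise_of_maps_to (t := Finset.range q)
    (g := fun m : ℕ × ℕ => m.1 + m.2)]
  · refine Finset.sum_congr rfl fun n hn => ?_
    have hn' := Finset.mem_range.1 hn
    rw [(Commute.all a b).add_pow', Finset.sum_smul]
    refine Finset.sum_congr ?_ ?_
    · ext m
      simp only [Finset.HasAntidiagonal.mem_antidiagonal, Finset.mem_filter, Finset.mem_product,
        Finset.mem_range]
      omega
    · intro m hm
      have : m.1 + m.2 = n := by simpa using (Finset.mem_filter.1 hm).2
      rw [this, smul_smul, smul_smul, nsmul_eq_mul]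
      congr 1
      ring
  · intro m hm
    simpa using (Finset.mem_filter.1 hm).2
  · intro m hm hm'
    have : q ≤ m.1 + m.2 := by
      by_contra h
      exact hm' (Finset.mem_filter.2 ⟨hm, not_le.1 h⟩)
    rw [hg _ this]
    simp

section Shift

variable {g : ℕ → V} {ρ : Representation L (GL (Fin 2) 𝔽) V}

lemma uGL_apply_sum
    (hu : ∀ (b : 𝔽) (i : ℕ), ρ (uGL b) (g i) = ∑ t ∈ Finset.range (Fintype.card 𝔽),
      τ b ^ t • ((i + t).choose i : L) • g (i + t))
    (s : Finset ℕ) (l : ℕ → L) (b : 𝔽) :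
    ρ (uGL b) (∑ i ∈ s, l i • g i) =
      ∑ t ∈ Finset.range (Fintype.card 𝔽),
        τ b ^ t • ∑ i ∈ s, l i • ((i + t).choose i : L) • g (i + t) := by
  simp only [map_sum, map_smul, hu, Finset.smul_sum]
  rw [Finset.sum_comm]
  refine Finset.sum_congr rfl fun t _ => Finset.sum_congr rfl fun i _ => ?_
  exact smul_comm _ _ _

lemma eq_zero_of_chooseLE {p : ℕ} [CharP L p]
    (hu : ∀ (b : 𝔽) (i : ℕ), ρ (uGL b) (g i) = ∑ t ∈ Finset.range (Fintype.card 𝔽),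
      τ b ^ t • ((i + t).choose i : L) • g (i + t))
    (htf : ∀ (l : L) (x : V), l • x = 0 → l = 0 ∨ x = 0)
    (hg : ∀ i, Fintype.card 𝔽 ≤ i → g i = 0) {i j : ℕ} (hij : ChooseLE p i j) (hi : g i = 0) :
    g j = 0 := by
  by_cases hj : Fintype.card 𝔽 ≤ j
  · exact hg j hj
  have hle := hij.le
  have := coeff_eq_zero_of_polyFun_eq_zero τ
    (a := fun t => ((i + t).choose i : L) • g (i + t)) (j := j - i)
    (fun x => by rw [← hu x i, hi, map_zero]) (by omega)
  simp only [Nat.add_sub_cancel' hle] at this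
  exact (htf _ _ this).resolve_left (hij.cast_ne_zero L)

lemma uGL_apply_of_maximal {p : ℕ} [CharP L p]
    (hu : ∀ (b : 𝔽) (i : ℕ), ρ (uGL b) (g i) = ∑ t ∈ Finset.range (Fintype.card 𝔽),
      τ b ^ t • ((i + t).choose i : L) • g (i + t)) {i : ℕ}
    (hi : ∀ j, i < j → ChooseLE p i j → g j = 0) (b : 𝔽) : ρ (uGL b) (g i) = g i := by
  rw [hu, Finset.sum_eq_single 0]
  · simp
  · intro t _ ht
    by_cases h : ChooseLE p i (i + t)
    · rw [hi _ (by omega) h, smul_zero, smul_zero]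
    · rw [cast_choose_eq_zero L h, zero_smul, smul_zero]
  · intro h
    exact absurd (Finset.mem_range.2 Fintype.card_pos) h

lemma uGL_apply_sub_mem
    (hu : ∀ (b : 𝔽) (i : ℕ), ρ (uGL b) (g i) = ∑ t ∈ Finset.range (Fintype.card 𝔽),
      τ b ^ t • ((i + t).choose i : L) • g (i + t))
    (b : 𝔽) (i : ℕ) :
    ρ (uGL b) (g i) - g i ∈ Submodule.span L (g '' Set.Ioi 0) := by
  obtain ⟨n, hn⟩ : ∃ n, Fintype.card 𝔽 = n + 1 := ⟨Fintype.card 𝔽 - 1, by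
    have := Fintype.card_pos (α := 𝔽); omega⟩
  rw [hu, hn, Finset.sum_range_succ']
  simp only [pow_zero, add_zero, Nat.choose_self, Nat.cast_one, one_smul, add_sub_cancel_right]
  refine Submodule.sum_mem _ fun t _ => Submodule.smul_mem _ _ (Submodule.smul_mem _ _ ?_)
  exact Submodule.subset_span ⟨i + (t + 1), by simp, rfl⟩

/-- The unipotent group acts nilpotently on the span of the `g_i`, so that the cyclic vector `g_0`
cannot lie in the augmentation submodule. -/
lemma zero_notMem_span_pos
    (hu : ∀ (b : 𝔽) (i : ℕ), ρ (uGL b) (g i) = ∑ t ∈ Finset.range (Fintype.card 𝔽),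
      τ b ^ t • ((i + t).choose i : L) • g (i + t))
    (hg : ∀ i, Fintype.card 𝔽 ≤ i → g i = 0) (h0 : g 0 ≠ 0) :
    g 0 ∉ Submodule.span L (g '' Set.Ioi 0) := by
  intro hmem
  have hstep : ∀ i, g i ∈ Submodule.span L (g '' Set.Ioi i) := by
    intro i
    by_cases hi : Fintype.card 𝔽 ≤ i
    · rw [hg i hi]; exact Submodule.zero_mem _
    obtain ⟨s, l, hs, hl⟩ : ∃ (s : Finset ℕ) (l : ℕ → L), (∀ j ∈ s, 0 < j) ∧
        g 0 = ∑ j ∈ s, l j • g j := by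
      rw [Finsupp.mem_span_image_iff_linearCombination] at hmem
      obtain ⟨l, hl, hl'⟩ := hmem
      exact ⟨l.support, l, fun j hj => hl hj, hl'.symm⟩
    have e : g i = ∑ j ∈ s, l j • ((j + i).choose j : L) • g (j + i) := by
      refine coeff_eq_of_polyFun_eq τ (a := fun t => g t)
        (b := fun t => ∑ j ∈ s, l j • ((j + t).choose j : L) • g (j + t)) (j := i) ?_ (not_le.1 hi)
      intro x
      rw [← uGL_apply_sum τ hu, ← hl, hu]
      simp
    rw [e]
    refine Submodule.sum_mem _ fun j hj => Submodule.smul_mem _ _ (Submodule.smul_mem _ _ ?_)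
    exact Submodule.subset_span ⟨j + i, by have := hs j hj; simpa using this, rfl⟩
  have hzero : ∀ n i, Fintype.card 𝔽 ≤ i + n → g i = 0 := by
    intro n
    induction n with
    | zero => exact fun i hi => hg i hi
    | succ n ih =>
      intro i hi
      have := hstep i
      rwa [Submodule.span_eq_bot.2, Submodule.mem_bot] at this
      rintro _ ⟨j, hj, rfl⟩
      exact ih j (by have : i < j := hj; omega)
  exact h0 (hzero _ 0 (by rw [zero_add]))

end Shift

/-- An irreducible representation of `GL₂(𝔽)` is spanned by `v` and the vectors `u_x w v`, for any
highest weight vector `v`, by the Bruhat decomposition. -/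
lemma span_eq_top_of_highest {𝔽 : Type*} [Field 𝔽] {ρ : Representation L (GL (Fin 2) 𝔽) V}
    (hirr : ∀ W : Submodule L V, (∀ g, ∀ x ∈ W, ρ g x ∈ W) → W = ⊥ ∨ W = ⊤)
    {v : V} (hv : v ≠ 0) (hvu : ∀ b, ρ (uGL b) v = v)
    (hvd : ∀ a b, ∃ c : L, ρ (dGL a b) v = c • v) :
    Submodule.span L ({v} ∪ Set.range fun x : 𝔽 => ρ (uGL x) (ρ (wGL 𝔽) v)) = ⊤ := by
  set W := Submodule.span L ({v} ∪ Set.range fun x : 𝔽 => ρ (uGL x) (ρ (wGL 𝔽) v)) with hW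
  have hvW : v ∈ W := Submodule.subset_span (Or.inl rfl)
  have hxW : ∀ x, ρ (uGL x) (ρ (wGL 𝔽) v) ∈ W := fun x => Submodule.subset_span (Or.inr ⟨x, rfl⟩)
  have hmul : ∀ (a b : GL (Fin 2) 𝔽) (y : V), ρ a (ρ b y) = ρ (a * b) y := fun a b y => by
    rw [map_mul, Module.End.mul_apply]
  have hstab : ∀ g : GL (Fin 2) 𝔽, (ρ g v ∈ W) → (∀ x, ρ g (ρ (uGL x) (ρ (wGL 𝔽) v)) ∈ W) →
      ∀ x ∈ W, ρ g x ∈ W := by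
    intro g h1 h2 x hx
    have : W ≤ W.comap (ρ g) := by
      rw [hW, Submodule.span_le]
      rintro _ (rfl | ⟨x, rfl⟩)
      · exact h1
      · exact h2 x
    exact this hx
  have hall : ∀ g : GL (Fin 2) 𝔽, ∀ x ∈ W, ρ g x ∈ W := by
    refine gl2_induction ?_ ?_ ?_ ?_
    · intro b
      refine hstab _ (by rw [hvu]; exact hvW) fun x => ?_
      rw [hmul, ← uGL_add]
      exact hxW _
    · refine hstab _ (by simpa [uGL_zero] using hxW 0) fun x => ?_
      by_cases hx : x = 0
      · rw [hx, uGL_zero, map_one, Module.End.one_apply, hmul, wGL_mul_self, map_one]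
        exact hvW
      · have e : ρ (wGL 𝔽) (ρ (uGL x) (ρ (wGL 𝔽) v)) =
            ρ (wGL 𝔽 * uGL ((Units.mk0 x hx : 𝔽ˣ) : 𝔽) * wGL 𝔽) v := by
          simp
        obtain ⟨c, hc⟩ := hvd (Units.mk0 x hx) (-(Units.mk0 x hx)⁻¹)
        rw [e, wGL_uGL_wGL]
        simp only [map_mul, Module.End.mul_apply, hvu, hc, map_smul]
        exact W.smul_mem _ (hxW _)
    · intro a b
      obtain ⟨c, hc⟩ := hvd a b
      refine hstab _ (by rw [hc]; exact W.smul_mem _ hvW) fun x => ?_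
      obtain ⟨c, hc⟩ := hvd b a
      rw [hmul, hmul, dGL_mul_uGL, mul_assoc, ← wGL_mul_dGL]
      simp only [map_mul, Module.End.mul_apply, hc, map_smul]
      exact W.smul_mem _ (hxW _)
    · intro g h hg hh x hx
      rw [map_mul]
      exact hg _ (hh x hx)
  rcases hirr W hall with h | h
  · rw [h] at hvW
    exact absurd ((Submodule.mem_bot L).1 hvW) hv
  · exact h

end FiniteGL2

section FiniteGL2

variable {𝔽 L V : Type*} [Field 𝔽] [Fintype 𝔽] [CommRing L] [AddCommGroup V] [Module L V]
  (τ : 𝔽 →+* L)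

lemma exists_highest_weight_vector [Nontrivial V] (p : ℕ) [Fact p.Prime] [CharP L p] [CharP 𝔽 p]
    (ρ : Representation L (GL (Fin 2) 𝔽) V) :
    ∃ (m n : ℕ) (v : V), v ≠ 0 ∧ (∀ b, ρ (uGL b) v = v) ∧
      ∀ a b : 𝔽ˣ, ρ (dGL a b) v = (τ a ^ m * τ b ^ n) • v := by
  classical
  have hmul : ∀ (a b : GL (Fin 2) 𝔽) (y : V), ρ a (ρ b y) = ρ (a * b) y := fun a b y => by
    rw [map_mul, Module.End.mul_apply]
  let U : Multiplicative 𝔽 →* GL (Fin 2) 𝔽 :=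
    { toFun := fun x => uGL (Multiplicative.toAdd x)
      map_one' := uGL_zero
      map_mul' := fun x y => uGL_add _ _ }
  obtain ⟨v₀, hv₀⟩ := exists_ne (0 : V)
  obtain ⟨v₁, hv₁, hv₁u⟩ := exists_fixed_vector_of_pow_eq_one p (ρ.comp U) hv₀
    (Set.finite_range _) (fun x => ⟨1, by
      have hx : x ^ p ^ 1 = 1 := by
        change (p ^ 1) • (Multiplicative.toAdd x) = 0
        rw [pow_one, nsmul_eq_mul, CharP.cast_eq_zero, zero_mul]
      rw [hx, map_one]⟩)
  let W₀ : Submodule L V :=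
    { carrier := {x | ∀ b, ρ (uGL b) x = x}
      add_mem' := fun {x y} hx hy b => by rw [map_add, hx b, hy b]
      zero_mem' := fun b => map_zero _
      smul_mem' := fun c x hx b => by rw [map_smul, hx b] }
  have hdW₀ : ∀ a b, ∀ x ∈ W₀, ρ (dGL a b) x ∈ W₀ := by
    intro a b x hx c
    have e : uGL c * dGL a b = dGL a b * uGL ((a⁻¹ : 𝔽ˣ) * c * b) := by
      rw [dGL_mul_uGL]
      congr 2
      simp [← mul_assoc]
    rw [hmul, e, ← hmul, hx]
  have hd1 : ∀ a b : 𝔽ˣ, dGL a b = dGL a 1 * dGL 1 b := fun a b => by rw [← dGL_mul]; simp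
  have hd2 : ∀ a b : 𝔽ˣ, dGL a b = dGL 1 b * dGL a 1 := fun a b => by rw [← dGL_mul]; simp
  let χ₁ : 𝔽ˣ →* Module.End L V := ρ.comp
    { toFun := fun a => dGL a 1
      map_one' := dGL_one
      map_mul' := fun a b => by rw [← dGL_mul, one_mul] }
  let χ₂ : 𝔽ˣ →* Module.End L V := ρ.comp
    { toFun := fun a => dGL 1 a
      map_one' := dGL_one
      map_mul' := fun a b => by rw [← dGL_mul, one_mul] }
  obtain ⟨m, v₂, hv₂, hv₂0, hm⟩ := exists_eigenvector_units τ χ₁ W₀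
    ((Submodule.ne_bot_iff _).2 ⟨v₁, fun b => hv₁u (Multiplicative.ofAdd b), hv₁⟩)
    (fun a x hx => hdW₀ a 1 x hx)
  let W₁ : Submodule L V :=
    { carrier := {x | x ∈ W₀ ∧ ∀ a : 𝔽ˣ, ρ (dGL a 1) x = τ a ^ m • x}
      add_mem' := fun {x y} hx hy => ⟨W₀.add_mem hx.1 hy.1, fun a => by
        rw [map_add, hx.2, hy.2, smul_add]⟩
      zero_mem' := ⟨W₀.zero_mem, fun a => by simp⟩
      smul_mem' := fun c x hx => ⟨W₀.smul_mem c hx.1, fun a => by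
        rw [map_smul, hx.2, smul_comm]⟩ }
  obtain ⟨n, v, hv, hv0, hn⟩ := exists_eigenvector_units τ χ₂ W₁
    ((Submodule.ne_bot_iff _).2 ⟨v₂, ⟨hv₂, hm⟩, hv₂0⟩)
    (fun a x hx => ⟨hdW₀ 1 a x hx.1, fun b => by
      change ρ (dGL b 1) (ρ (dGL 1 a) x) = τ b ^ m • ρ (dGL 1 a) x
      rw [hmul, ← hd1, hd2, ← hmul, hx.2, map_smul]⟩)
  refine ⟨m, n, v, hv0, hv.1, fun a b => ?_⟩
  have e : ρ (dGL 1 b) v = τ b ^ n • v := hn b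
  rw [hd2, ← hmul, hv.2, map_smul, e, smul_smul]

lemma chooseLE_card_sub_one (p : ℕ) [Fact p.Prime] [CharP 𝔽 p] {i : ℕ}
    (hi : i < Fintype.card 𝔽) : ChooseLE p i (Fintype.card 𝔽 - 1) := by
  have hp : p.Prime := Fact.out
  obtain ⟨f, -, hf⟩ := FiniteField.card 𝔽 p
  induction i with
  | zero => exact chooseLE_zero hp _
  | succ i ih =>
    intro hd
    obtain ⟨n, hn⟩ : ∃ n, Fintype.card 𝔽 = n + 1 := ⟨Fintype.card 𝔽 - 1, by omega⟩
    have h1 : p ∣ (Fintype.card 𝔽).choose (i + 1) := by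
      rw [hf]
      exact hp.dvd_choose_pow (by omega) (by rw [← hf]; omega)
    have ih' := ih (by omega)
    rw [ChooseLE] at ih'
    rw [hn, Nat.add_sub_cancel] at hd ih'
    rw [hn, Nat.choose_succ_succ] at h1
    exact ih' ((Nat.dvd_add_left hd).1 h1)

/-- Every irreducible representation of `GL₂(𝔽)` in the characteristic of `𝔽`, over a ring of
coefficients acting without torsion, has a family of weight vectors that behaves like the
monomials.

For a highest weight vector `v` the `g_i` are the coefficients of the polynomial function
`x ↦ u_x w v`. A vector `g_i` which is fixed by the unipotent group is again a highest weight
vector, so that `g_i` and `w g_i` generate the coinvariants of the unipotent group, in which only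
the images of `g_0` and `v` survive. This leaves only one such index. -/
theorem exists_isMonomialFamily [Nontrivial V] (p : ℕ) [Fact p.Prime] [CharP L p] [CharP 𝔽 p]
    (ρ : Representation L (GL (Fin 2) 𝔽) V)
    (htf : ∀ (l : L) (x : V), l • x = 0 → l = 0 ∨ x = 0)
    (hirr : ∀ W : Submodule L V, (∀ g, ∀ x ∈ W, ρ g x ∈ W) → W = ⊥ ∨ W = ⊤) :
    ∃ (r : ℕ) (ε : L) (g : ℕ → V), IsMonomialFamily τ p ρ r ε g := by
  classical
  have hp : p.Prime := Fact.out
  have hmul : ∀ (a b : GL (Fin 2) 𝔽) (y : V), ρ a (ρ b y) = ρ (a * b) y := fun a b y => by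
    rw [map_mul, Module.End.mul_apply]
  have hcard : 1 < Fintype.card 𝔽 := Fintype.one_lt_card
  obtain ⟨m, n, v, hv0, hvu, hvd⟩ := exists_highest_weight_vector τ p ρ
  obtain ⟨q₁, hq⟩ : ∃ q₁, Fintype.card 𝔽 = q₁ + 1 := ⟨Fintype.card 𝔽 - 1, by omega⟩
  have hq₁ : 0 < q₁ := by omega
  have hpow : ∀ y : 𝔽ˣ, y ^ q₁ = 1 := fun y => by
    have := FiniteField.pow_card_sub_one_eq_one (y : 𝔽) y.ne_zero
    rw [hq, Nat.add_sub_cancel] at this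
    exact Units.ext (by simpa using this)
  set wv := ρ (wGL 𝔽) v with hwv
  have hwwv : ρ (wGL 𝔽) wv = v := by rw [hwv, hmul, wGL_mul_self, map_one]; rfl
  set h : 𝔽 → V := fun x => ρ (uGL x) wv with hh
  set g : ℕ → V := interpCoeff τ h with hgdef
  have hg : ∀ i, Fintype.card 𝔽 ≤ i → g i = 0 := fun i hi => interpCoeff_of_card_le τ h hi
  have hg' : ∀ i, q₁ < i → g i = 0 := fun i hi => hg i (by omega)
  have hsum : ∀ x, ∑ i ∈ Finset.range (Fintype.card 𝔽), τ x ^ i • g i = ρ (uGL x) wv :=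
    sum_interpCoeff τ h
  have hg0 : g 0 = wv := by
    rw [hgdef, interpCoeff_zero, hh]
    simp [uGL_zero]
  have hwv0 : wv ≠ 0 := fun h => hv0 (by rw [← hwwv, h, map_zero])
  -- The action of the unipotent group and of the diagonal matrices.
  have hu : ∀ (b : 𝔽) (i : ℕ), ρ (uGL b) (g i) = ∑ t ∈ Finset.range (Fintype.card 𝔽),
      τ b ^ t • ((i + t).choose i : L) • g (i + t) := by
    intro b i
    by_cases hi : Fintype.card 𝔽 ≤ i
    · rw [hg i hi, map_zero]
      exact (Finset.sum_eq_zero fun t _ => by rw [hg _ (by omega)]; simp).symm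
    · refine coeff_eq_of_polyFun_eq τ (a := fun i => ρ (uGL b) (g i))
        (b := fun i => ∑ t ∈ Finset.range (Fintype.card 𝔽),
          τ b ^ t • ((i + t).choose i : L) • g (i + t)) (fun a => ?_) (not_le.1 hi)
      rw [← sum_add_pow_smul hg, ← map_add, hsum]
      simp only [← map_smul, ← map_sum, hsum]
      rw [hmul, ← uGL_add, add_comm]
  have hd : ∀ (a b : 𝔽ˣ) (i : ℕ), ρ (dGL a b) (g i) =
      ((τ b ^ m * τ a ^ n) * τ (a * (b⁻¹ : 𝔽ˣ)) ^ i) • g i := by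
    intro a b i
    by_cases hi : Fintype.card 𝔽 ≤ i
    · rw [hg i hi, map_zero, smul_zero]
    · refine coeff_eq_of_polyFun_eq τ (a := fun i => ρ (dGL a b) (g i))
        (b := fun i => ((τ b ^ m * τ a ^ n) * τ (a * (b⁻¹ : 𝔽ˣ)) ^ i) • g i) (fun x => ?_)
        (not_le.1 hi)
      simp only [← map_smul, ← map_sum, hsum]
      rw [hmul, dGL_mul_uGL, ← hmul, hwv, hmul (dGL a b), ← wGL_mul_dGL, ← hmul, hvd, map_smul,
        map_smul, ← hwv, ← hsum, Finset.smul_sum]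
      refine Finset.sum_congr rfl fun i _ => ?_
      rw [smul_smul, smul_smul]
      congr 1
      simp only [map_mul, mul_pow]
      ring
  -- The action of `w`, through the sums `A e = ∑ y ^ e u_y w v`.
  -- The torus acts on `v` through `x ↦ x ^ m * x⁻¹ ^ n` on `diag(x, x⁻¹)`; `r₀` is the exponent of
  -- this character modulo `q₁ = |𝔽| - 1`.
  set ε : L := (-1) ^ n with hε
  have hεε : ε * ε = 1 := by rw [hε, ← mul_pow]; simp
  set r₀ := (m + n * (q₁ - 1)) % q₁ with hr₀
  have hr₀lt : r₀ < q₁ := Nat.mod_lt _ hq₁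
  have hchar : ∀ x : 𝔽ˣ, x ^ m * (x⁻¹) ^ n = x ^ r₀ := by
    intro x
    have e : x⁻¹ = x ^ (q₁ - 1) := by
      rw [inv_eq_iff_mul_eq_one, ← pow_succ', Nat.sub_add_cancel hq₁, hpow]
    have e2 : x ^ (m + n * (q₁ - 1)) = x ^ r₀ := by
      conv_lhs => rw [← Nat.mod_add_div (m + n * (q₁ - 1)) q₁, pow_add, pow_mul, hpow, one_pow,
        mul_one]
    rw [e, ← pow_mul, ← pow_add, mul_comm (q₁ - 1) n, e2]
  let A : ℤ → V := fun e => ∑ y : 𝔽ˣ, τ ((y ^ e : 𝔽ˣ) : 𝔽) • ρ (uGL (y : 𝔽)) wv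
  have hwA : ∀ e, ρ (wGL 𝔽) (A e) = ε • A (-e - r₀) := by
    intro e
    simp only [A, map_sum, map_smul, Finset.smul_sum]
    refine Fintype.sum_equiv (Equiv.inv 𝔽ˣ) _ _ fun y => ?_
    have e1 : ρ (wGL 𝔽) (ρ (uGL (y : 𝔽)) wv) =
        (τ y ^ m * τ ((-y⁻¹ : 𝔽ˣ) : 𝔽) ^ n) • ρ (uGL ((y⁻¹ : 𝔽ˣ) : 𝔽)) wv := by
      rw [hwv, hmul, hmul, wGL_uGL_wGL]
      simp only [map_mul, Module.End.mul_apply, hvu, hvd, map_smul]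
    rw [e1, smul_smul, smul_smul]
    congr 1
    have e2 : (y⁻¹ : 𝔽ˣ) ^ (-e - (r₀ : ℤ)) = y ^ e * (y ^ m * (y⁻¹) ^ n) := by
      rw [hchar, ← zpow_natCast, ← zpow_add, inv_zpow']
      congr 1
      ring
    rw [Equiv.inv_apply, e2]
    simp only [Units.val_mul, Units.val_pow_eq_pow_val, map_mul, map_pow, Units.val_neg, map_neg,
      hε]
    rw [neg_pow]
    ring
  have hAper : ∀ e, A (e + q₁) = A e := by
    intro e
    simp only [A]
    refine Finset.sum_congr rfl fun y _ => ?_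
    rw [zpow_add, zpow_natCast, hpow, mul_one]
  have hgA : ∀ i, 0 < i → i < q₁ → g i = -A (-i) := by
    intro i hi hi'
    rw [hgdef, interpCoeff_of_pos τ h hi.ne' (by omega), sum_eq_zero_add_sum_units, hq,
      Nat.add_sub_cancel, map_zero, zero_pow (by omega), zero_smul, zero_add]
    congr 1
    refine Finset.sum_congr rfl fun y _ => ?_
    congr 1
    have : y ^ (-(i : ℤ)) = y ^ (q₁ - i) := by
      rw [← zpow_natCast, Nat.cast_sub hi'.le, sub_eq_add_neg, zpow_add, zpow_natCast, hpow,
        one_mul]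
    rw [this]
    simp
  have hgq : g q₁ = -A 0 - wv := by
    rw [hgdef, interpCoeff_of_pos τ h hq₁.ne' (by omega), sum_eq_zero_add_sum_units, hq]
    simp only [Nat.add_sub_cancel, Nat.sub_self, pow_zero, one_smul, A, zpow_zero, Units.val_one,
      map_one, hh, uGL_zero, Module.End.one_apply]
    abel
  have hw1 : ∀ i, 0 < i → i < r₀ → ρ (wGL 𝔽) (g i) = ε • g (r₀ - i) := by
    intro i hi hi'
    rw [hgA i hi (by omega), hgA (r₀ - i) (by omega) (by omega), map_neg, hwA, smul_neg]
    congr 3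
    rw [Nat.cast_sub hi'.le]
    ring
  have hw2 : ∀ i, 0 < i → r₀ < i → i < q₁ → ρ (wGL 𝔽) (g i) = ε • g (r₀ + q₁ - i) := by
    intro i hi hi' hi''
    rw [hgA i hi (by omega), hgA (r₀ + q₁ - i) (by omega) (by omega), map_neg, hwA, smul_neg,
      ← hAper (-((r₀ + q₁ - i : ℕ) : ℤ))]
    congr 3
    rw [Nat.cast_sub (by omega)]
    push_cast
    ring
  have hw3 : ρ (wGL 𝔽) (g q₁) = -(ε • A (-r₀)) - v := by
    rw [hgq, map_sub, map_neg, hwA, hwwv]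
    simp
  -- The coinvariants of the unipotent group.
  set N := Submodule.span L (g '' Set.Ioi 0) with hN
  have hgN : ∀ i, 0 < i → g i ∈ N := fun i hi => Submodule.subset_span ⟨i, hi, rfl⟩
  have hg0N : g 0 ∉ N := zero_notMem_span_pos τ hu hg (hg0 ▸ hwv0)
  have hVspan : Submodule.span L ({v} ∪ Set.range g) = ⊤ := by
    rw [eq_top_iff, ← span_eq_top_of_highest hirr hv0 hvu fun a b => ⟨_, hvd a b⟩,
      Submodule.span_le]
    rintro _ (rfl | ⟨x, rfl⟩)
    · exact Submodule.subset_span (Or.inl rfl)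
    · change ρ (uGL x) wv ∈ _
      rw [← hsum]
      exact Submodule.sum_mem _ fun i _ => Submodule.smul_mem _ _
        (Submodule.subset_span (Or.inr ⟨i, rfl⟩))
  have hUN : ∀ (b : 𝔽) (x : V), ρ (uGL b) x - x ∈ N := by
    intro b x
    have hx : x ∈ Submodule.span L ({v} ∪ Set.range g) := hVspan ▸ Submodule.mem_top
    have : Submodule.span L ({v} ∪ Set.range g) ≤ N.comap (ρ (uGL b) - LinearMap.id) := by
      rw [Submodule.span_le]
      rintro _ (rfl | ⟨i, rfl⟩)
      · simp [hvu]
      · simpa using uGL_apply_sub_mem τ hu b i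
    simpa using this hx
  have hcoinv : ∀ v' : V, v' ≠ 0 → (∀ b, ρ (uGL b) v' = v') →
      (∀ a b, ∃ c : L, ρ (dGL a b) v' = c • v') →
      ∀ x, x ∈ Submodule.span L {v', ρ (wGL 𝔽) v'} ⊔ N := by
    intro v' h0 hu' hd' x
    have hx : x ∈ (⊤ : Submodule L V) := Submodule.mem_top
    rw [← span_eq_top_of_highest hirr h0 hu' hd'] at hx
    refine Submodule.span_le.2 ?_ hx
    rintro _ (rfl | ⟨b, rfl⟩)
    · exact Submodule.mem_sup_left (Submodule.subset_span (Or.inl rfl))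
    · have := hUN b (ρ (wGL 𝔽) v')
      change ρ (uGL b) (ρ (wGL 𝔽) v') ∈ _
      rw [show (ρ (uGL b)) (ρ (wGL 𝔽) v') = ρ (wGL 𝔽) v' +
        (ρ (uGL b) (ρ (wGL 𝔽) v') - ρ (wGL 𝔽) v') by abel]
      exact Submodule.add_mem _
        (Submodule.mem_sup_left (Submodule.subset_span (Or.inr rfl)))
        (Submodule.mem_sup_right this)
  have hdc : ∀ (a b : 𝔽ˣ) (i : ℕ), ∃ c : L, ρ (dGL a b) (g i) = c • g i :=
    fun a b i => ⟨_, hd a b i⟩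
  have hgqu : ∀ b, ρ (uGL b) (g q₁) = g q₁ :=
    uGL_apply_of_maximal (p := p) τ hu fun j hj _ => hg' j hj
  have hspan : ∀ r, v = ε • g r → Submodule.span L (Set.range g) = ⊤ := by
    intro r hr
    rw [eq_top_iff, ← hVspan, Submodule.span_le]
    rintro _ (rfl | ⟨i, rfl⟩)
    · rw [hr]
      exact Submodule.smul_mem _ _ (Submodule.subset_span ⟨r, rfl⟩)
    · exact Submodule.subset_span ⟨i, rfl⟩
  have hwg0 : ρ (wGL 𝔽) (g 0) = v := by rw [hg0, hwwv]
  have hwg : ∀ r, v = ε • g r → ρ (wGL 𝔽) (g r) = ε • g 0 := by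
    intro r hr
    have : g r = ε • v := by rw [hr, smul_smul, hεε, one_smul]
    rw [this, map_smul, ← hwv, hg0]
  -- If `r₀ = 0`, then `r` is `0` or `q₁`, according to whether `g q₁` vanishes.
  rcases Nat.eq_zero_or_pos r₀ with hr | hr
  · have hA0 : A (-r₀) = -(g q₁) - g 0 := by
      rw [hr, hgq, hg0]; simp
    rw [hA0] at hw3
    by_cases hgq0 : g q₁ = 0
    · have hvε : v = ε • g 0 := by
        rw [hgq0, map_zero, neg_zero, zero_sub, smul_neg, neg_neg] at hw3
        exact (sub_eq_zero.1 hw3.symm).symm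
      have hgi : ∀ i, 0 < i → g i = 0 := by
        intro i hi
        by_cases hiq : Fintype.card 𝔽 ≤ i
        · exact hg i hiq
        have := coeff_eq_of_polyFun_eq τ (a := g) (b := fun i => if i = 0 then g 0 else 0)
          (fun x => ?_) (not_le.1 hiq)
        · rw [this, if_neg hi.ne']
        · rw [hsum, ← hg0, Finset.sum_eq_single 0]
          · have : g 0 = ε • v := by rw [hvε, smul_smul, hεε, one_smul]
            simp [this, hvu]
          · intro j _ hj
            simp [hj]
          · intro h
            exact absurd (Finset.mem_range.2 Fintype.card_pos) h
      refine ⟨0, ε, g, by omega, hεε, fun i => ?_, hu, fun i hi => ?_, hdc, hspan 0 hvε⟩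
      · constructor
        · intro h
          have : i = 0 := by
            by_contra h'
            exact h (hgi i (Nat.pos_of_ne_zero h'))
          rw [this]
          exact chooseLE_refl hp 0
        · intro h
          rw [Nat.le_zero.1 h.le, hg0]
          exact hwv0
      · rw [Nat.le_zero.1 hi.le, hwg0, hvε]
    · have hmn : ∀ x : 𝔽ˣ, x ^ m = x ^ n := by
        intro x
        have := hchar x
        rw [hr, pow_zero, inv_pow, mul_inv_eq_one] at this
        exact this
      have hmn' : ∀ x : 𝔽ˣ, τ x ^ m = τ x ^ n := fun x => by
        have := congrArg (fun y : 𝔽ˣ => τ (y : 𝔽)) (hmn x)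
        simpa using this
      have hvq : v = ε • g q₁ := by
        by_contra hne
        -- Otherwise `v - ε g q₁` is a highest weight vector and an eigenvector of `w`, so that it
        -- generates a representation on which the unipotent group acts trivially.
        have hne' : v - ε • g q₁ ≠ 0 := sub_ne_zero.2 hne
        have hwd : ρ (wGL 𝔽) (v - ε • g q₁) = ε • (v - ε • g q₁) := by
          rw [map_sub, map_smul, hw3, ← hwv, ← hg0]
          simp only [smul_sub, smul_neg, smul_smul, hεε, one_smul]
          abel
        have htop := span_eq_top_of_highest hirr hne'
          (fun b => by rw [map_sub, map_smul, hvu, hgqu]) (fun a b => ⟨τ a ^ m * τ b ^ n, by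
            have := hpow (a * b⁻¹)
            have h1 : τ (a * (b⁻¹ : 𝔽ˣ)) ^ q₁ = 1 := by
              have := congrArg (fun y : 𝔽ˣ => τ (y : 𝔽)) this
              simpa using this
            rw [map_sub, map_smul, hvd, hd, smul_sub, smul_comm ε, h1, mul_one, hmn' b, ← hmn' a,
              mul_comm (τ b ^ n)]⟩)
        have hfix : ∀ (b : 𝔽) (x : V), ρ (uGL b) x = x := by
          intro b x
          have hx : x ∈ (⊤ : Submodule L V) := Submodule.mem_top
          rw [← htop] at hx
          have : Submodule.span L ({v - ε • g q₁} ∪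
              Set.range fun x : 𝔽 => ρ (uGL x) (ρ (wGL 𝔽) (v - ε • g q₁))) ≤
              LinearMap.ker (ρ (uGL b) - LinearMap.id) := by
            rw [Submodule.span_le]
            rintro _ (rfl | ⟨c, rfl⟩)
            · simp [hvu, hgqu]
            · simp [hwd, hvu, hgqu]
          exact sub_eq_zero.1 (by simpa using this hx)
        apply hgq0
        have := coeff_eq_of_polyFun_eq τ (a := g) (b := fun i => if i = 0 then g 0 else 0)
          (fun x => ?_) (j := q₁) (by omega)
        · rw [this, if_neg hq₁.ne']
        · rw [hsum, ← hg0, Finset.sum_eq_single 0]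
          · simp [hfix]
          · intro j _ hj
            simp [hj]
          · intro h
            exact absurd (Finset.mem_range.2 Fintype.card_pos) h
      refine ⟨q₁, ε, g, by omega, hεε, fun i => ?_, hu, fun i hi => ?_, hdc, hspan q₁ hvq⟩
      · constructor
        · intro h
          have : i < Fintype.card 𝔽 := by
            by_contra h'
            exact h (hg i (not_lt.1 h'))
          have := chooseLE_card_sub_one p this
          rwa [hq, Nat.add_sub_cancel] at this
        · exact fun h h0 => hgq0 (eq_zero_of_chooseLE τ hu htf hg h h0)
      · have hi' := hi.le
        rcases Nat.eq_zero_or_pos i with h0 | h0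
        · rw [h0, hwg0, Nat.sub_zero, hvq]
        · rcases hi'.lt_or_eq with h1 | h1
          · rw [hw2 i h0 (by omega) h1, hr, zero_add]
          · rw [h1, Nat.sub_self, hwg q₁ hvq]
  · have hA0 : A (-r₀) = -(g r₀) := by rw [hgA r₀ hr hr₀lt, neg_neg]
    rw [hA0, smul_neg, neg_neg] at hw3
    have hgq0 : g q₁ = 0 := by
      by_contra hne
      -- Otherwise `g 0` is a multiple of `v` in the coinvariants, but their weights differ.
      have hmem := hcoinv (g q₁) hne hgqu (fun a b => hdc a b q₁) (g 0)
      have hle : Submodule.span L {g q₁, ρ (wGL 𝔽) (g q₁)} ⊔ N ≤ Submodule.span L {v} ⊔ N := by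
        refine sup_le (Submodule.span_le.2 ?_) le_sup_right
        rintro _ (rfl | rfl)
        · exact Submodule.mem_sup_right (hgN _ hq₁)
        · rw [hw3]
          exact Submodule.sub_mem _
            (Submodule.mem_sup_right (N.smul_mem _ (hgN _ hr)))
            (Submodule.mem_sup_left (Submodule.subset_span rfl))
      obtain ⟨y, hy, z, hz, hyz⟩ := Submodule.mem_sup.1 (hle hmem)
      obtain ⟨l, rfl⟩ := Submodule.mem_span_singleton.1 hy
      have hdN : ∀ a b, ρ (dGL a b) z ∈ N := by
        intro a b
        have : N ≤ N.comap (ρ (dGL a b)) := by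
          rw [hN, Submodule.span_le]
          rintro _ ⟨i, hi, rfl⟩
          change ρ (dGL a b) (g i) ∈ N
          rw [hd]
          exact N.smul_mem _ (hgN i hi)
        exact this hz
      obtain ⟨a, ha⟩ : ∃ a : 𝔽ˣ, a ^ m ≠ a ^ n := by
        by_contra hcon
        push Not at hcon
        have : ∀ x : 𝔽ˣ, x ^ r₀ = 1 := fun x => by
          rw [← hchar, hcon, ← mul_pow, mul_inv_cancel, one_pow]
        have := (FiniteField.forall_pow_eq_one_iff 𝔽 r₀).1 this
        rw [hq, Nat.add_sub_cancel] at this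
        exact absurd (Nat.le_of_dvd hr this) (by omega)
      have h1 : ((τ a ^ n - τ a ^ m : L)) • g 0 ∈ N := by
        have e1 := hd a 1 0
        have e2 := hvd a 1
        simp only [Units.val_one, map_one, one_pow, one_mul, pow_zero, mul_one] at e1 e2
        have : ((τ a ^ n - τ a ^ m : L)) • g 0 = ρ (dGL a 1) z - τ a ^ m • z := by
          rw [sub_smul, ← e1]
          conv_lhs => rw [← hyz]
          rw [map_add, map_smul, e2, smul_add, smul_comm l]
          abel
        rw [this]
        exact N.sub_mem (hdN a 1) (N.smul_mem _ hz)
      have h2 : (a : 𝔽) ^ n - (a : 𝔽) ^ m ≠ 0 := fun h =>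
        ha (Units.ext (by simpa using (sub_eq_zero.1 h).symm))
      apply hg0N
      have := N.smul_mem (τ ((a : 𝔽) ^ n - (a : 𝔽) ^ m)⁻¹) h1
      rwa [smul_smul, ← map_pow, ← map_pow, ← map_sub, ← map_mul, inv_mul_cancel₀ h2, map_one,
        one_smul] at this
    have hvr : v = ε • g r₀ := by
      rw [hgq0, map_zero] at hw3
      exact (sub_eq_zero.1 hw3.symm).symm
    have hgr0 : g r₀ ≠ 0 := fun h => hv0 (by rw [hvr, h, smul_zero])
    -- No index other than `r₀` is maximal for `ChooseLE` among those with `g i ≠ 0`.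
    have hmax : ∀ i, 0 < i → i < q₁ → i ≠ r₀ → g i ≠ 0 → ∃ j, i < j ∧ ChooseLE p i j ∧ g j ≠ 0 := by
      intro i hi hi' hir hgi
      by_contra hcon
      push Not at hcon
      have hmem := hcoinv (g i) hgi (uGL_apply_of_maximal τ hu hcon) (fun a b => hdc a b i) (g 0)
      have hle : Submodule.span L {g i, ρ (wGL 𝔽) (g i)} ⊔ N ≤ N := by
        refine sup_le (Submodule.span_le.2 ?_) le_rfl
        rintro _ (rfl | rfl)
        · exact hgN _ hi
        · rcases lt_or_gt_of_ne hir with h1 | h1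
          · rw [hw1 i hi h1]
            exact N.smul_mem _ (hgN _ (by omega))
          · rw [hw2 i hi h1 hi']
            exact N.smul_mem _ (hgN _ (by omega))
      exact hg0N (hle hmem)
    have hS : ∀ d i, q₁ ≤ i + d → g i ≠ 0 → ChooseLE p i r₀ := by
      intro d
      induction d with
      | zero =>
        intro i hi hgi
        rcases (show q₁ ≤ i from hi).lt_or_eq with h1 | h1
        · exact absurd (hg' i h1) hgi
        · exact absurd (h1 ▸ hgq0) hgi
      | succ d ih =>
        intro i hi hgi
        rcases Nat.eq_zero_or_pos i with h0 | h0
        · rw [h0]; exact chooseLE_zero hp _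
        by_cases hir : i = r₀
        · rw [hir]; exact chooseLE_refl hp _
        by_cases hiq : i < q₁
        · obtain ⟨j, hij, hle, hgj⟩ := hmax i h0 hiq hir hgi
          exact hle.trans hp (ih j (by omega) hgj)
        · exact ih i (by omega) hgi
    refine ⟨r₀, ε, g, by omega, hεε, fun i => ⟨hS q₁ i (by omega), fun h h0 =>
      hgr0 (eq_zero_of_chooseLE τ hu htf hg h h0)⟩, hu, fun i hi => ?_, hdc, hspan r₀ hvr⟩
    have hi' := hi.le
    rcases Nat.eq_zero_or_pos i with h0 | h0
    · rw [h0, hwg0, Nat.sub_zero, hvr]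
    · rcases hi'.lt_or_eq with h1 | h1
      · exact hw1 i h0 h1
      · rw [h1, Nat.sub_self, hwg r₀ hvr]

end FiniteGL2

namespace IsMonomialFamily

variable {𝔽 : Type*} [Field 𝔽] [Fintype 𝔽] {L V : Type*} [CommRing L] [AddCommGroup V] [Module L V]
  {τ : 𝔽 →+* L} {p : ℕ} {ρ : Representation L (GL (Fin 2) 𝔽) V} {r : ℕ} {ε : L} {g : ℕ → V}

lemma eq_zero_of_lt (h : IsMonomialFamily τ p ρ r ε g) {i : ℕ} (hi : r < i) : g i = 0 := by
  by_contra hne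
  exact absurd ((h.ne_zero_iff i).1 hne).le (by omega)

lemma choose_smul_eq_zero [Fact p.Prime] [CharP L p] (h : IsMonomialFamily τ p ρ r ε g) {j : ℕ}
    (hj : g j = 0) (t : ℕ) : ((j + t).choose j : L) • g (j + t) = 0 := by
  by_cases h1 : ChooseLE p j (j + t)
  · by_cases h2 : ChooseLE p (j + t) r
    · exact absurd hj ((h.ne_zero_iff j).2 (h1.trans Fact.out h2))
    · rw [show g (j + t) = 0 from by_contra fun hne => h2 ((h.ne_zero_iff _).1 hne), smul_zero]
  · rw [cast_choose_eq_zero L h1, zero_smul]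

lemma exists_eq_sum (h : IsMonomialFamily τ p ρ r ε g) (x : V) :
    ∃ l : ℕ → L, x = ∑ i ∈ Finset.range (r + 1), l i • g i := by
  have hx : x ∈ Submodule.span L (Set.range g) := h.span_eq_top ▸ Submodule.mem_top
  induction hx using Submodule.span_induction with
  | mem x hx =>
    obtain ⟨i, rfl⟩ := hx
    by_cases hi : i ≤ r
    · refine ⟨Pi.single i 1, ?_⟩
      rw [Finset.sum_eq_single i]
      · simp
      · intro j _ hj
        simp [Pi.single_eq_of_ne hj]
      · intro h
        simp at h
        omega
    · exact ⟨0, by simp [h.eq_zero_of_lt (not_le.1 hi)]⟩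
  | zero => exact ⟨0, by simp⟩
  | add x y _ _ hx hy =>
    obtain ⟨l, hl⟩ := hx
    obtain ⟨m, hm⟩ := hy
    exact ⟨l + m, by simp [hl, hm, add_smul, Finset.sum_add_distrib]⟩
  | smul c x _ hx =>
    obtain ⟨l, hl⟩ := hx
    exact ⟨c • l, by simp [hl, Finset.smul_sum, mul_smul]⟩

/-- The vectors fixed by the upper unipotent matrices are the multiples of `g r`. -/
lemma exists_eq_smul_of_invariant [Fact p.Prime] [CharP L p] (h : IsMonomialFamily τ p ρ r ε g)
    (htf : ∀ (l : L) (x : V), l • x = 0 → l = 0 ∨ x = 0)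
    {x : V} (hx : ∀ b, ρ (uGL b) x = x) : ∃ l : L, x = l • g r := by
  obtain ⟨l, hl⟩ := h.exists_eq_sum x
  have hcard := h.r_lt
  have hpoly : ∀ b : 𝔽, ∑ t ∈ Finset.range (Fintype.card 𝔽), τ b ^ t •
      ∑ i ∈ Finset.range (r + 1), l i • (((i + t).choose i : L) • g (i + t)) =
      ∑ t ∈ Finset.range (Fintype.card 𝔽), τ b ^ t • (if t = 0 then x else 0) := by
    intro b
    have e : ∑ t ∈ Finset.range (Fintype.card 𝔽), τ b ^ t • (if t = 0 then x else 0) = x := by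
      rw [Finset.sum_eq_single 0]
      · simp
      · intro t _ ht
        simp [ht]
      · intro h0
        simp at h0
    rw [e]
    conv_rhs => rw [← hx b, hl, map_sum]
    simp only [map_smul, h.u_apply, Finset.smul_sum]
    rw [Finset.sum_comm]
    refine Finset.sum_congr rfl fun i _ => Finset.sum_congr rfl fun t _ => ?_
    rw [smul_comm]
  have hgr : g r ≠ 0 := (h.ne_zero_iff r).2 (chooseLE_refl Fact.out r)
  have key : ∀ i < r, l i • g i = 0 := by
    intro i
    induction i using Nat.strong_induction_on with
    | _ i ih =>
      intro hi
      by_cases hgi : g i = 0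
      · rw [hgi, smul_zero]
      have hc := coeff_eq_of_polyFun_eq τ hpoly (j := r - i) (by omega)
      rw [if_neg (by omega), Finset.sum_eq_single i] at hc
      · rw [show i + (r - i) = r by omega] at hc
        rcases htf _ _ hc with h1 | h1
        · rw [h1, zero_smul]
        · rcases htf _ _ h1 with h2 | h2
          · exact absurd h2 (((h.ne_zero_iff i).1 hgi).cast_ne_zero L)
          · exact absurd h2 hgr
      · intro j _ hji
        rcases lt_or_gt_of_ne hji with hlt | hgt
        · rcases htf _ _ (ih j hlt (by omega)) with h1 | h1
          · rw [h1, zero_smul]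
          · rw [h.choose_smul_eq_zero h1, smul_zero]
        · rw [h.eq_zero_of_lt (by omega), smul_zero, smul_zero]
      · intro hn
        simp at hn
        omega
  refine ⟨l r, ?_⟩
  rw [hl, Finset.sum_range_succ, Finset.sum_eq_zero, zero_add]
  intro i hi
  exact key i (Finset.mem_range.1 hi)

lemma w_apply_top [Fact p.Prime] (h : IsMonomialFamily τ p ρ r ε g) :
    ρ (wGL 𝔽) (g r) = ε • g 0 := by
  rw [h.w_apply r (chooseLE_refl Fact.out r), Nat.sub_self]

lemma w_apply_zero [Fact p.Prime] (h : IsMonomialFamily τ p ρ r ε g) :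
    ρ (wGL 𝔽) (g 0) = ε • g r := by
  rw [h.w_apply 0 (chooseLE_zero Fact.out r), Nat.sub_zero]

lemma u_apply_top (h : IsMonomialFamily τ p ρ r ε g) (b : 𝔽) : ρ (uGL b) (g r) = g r := by
  rw [h.u_apply, Finset.sum_eq_single 0]
  · simp
  · intro t _ ht
    rw [h.eq_zero_of_lt (by omega), smul_zero, smul_zero]
  · intro h0
    simp at h0

/-- An endomorphism which is invariant under the upper unipotent matrices kills the `g j` with
`j > 0`. -/
lemma map_eq_zero_of_pos (h : IsMonomialFamily τ p ρ r ε g) (Ψ : V →ₗ[L] V)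
    (hu : ∀ b x, Ψ (ρ (uGL b) x) = Ψ x) {j : ℕ} (hj : j ≠ 0) : Ψ (g j) = 0 := by
  by_cases hq : j < Fintype.card 𝔽
  · have hpoly : ∀ b : 𝔽, ∑ t ∈ Finset.range (Fintype.card 𝔽), τ b ^ t • Ψ (g t) =
        ∑ t ∈ Finset.range (Fintype.card 𝔽), τ b ^ t • (if t = 0 then Ψ (g 0) else 0) := by
      intro b
      have e : ∑ t ∈ Finset.range (Fintype.card 𝔽), τ b ^ t • (if t = 0 then Ψ (g 0) else 0) =
          Ψ (g 0) := by
        rw [Finset.sum_eq_single 0]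
        · simp
        · intro t _ ht
          simp [ht]
        · intro h0
          simp at h0
      rw [e, ← hu b, h.u_apply, map_sum]
      refine Finset.sum_congr rfl fun t _ => ?_
      simp
    have hc := coeff_eq_of_polyFun_eq τ hpoly hq
    rwa [if_neg hj] at hc
  · have := h.r_lt
    rw [h.eq_zero_of_lt (by omega), map_zero]

/-- An endomorphism with values in the invariants of the lower unipotent matrices maps `g 0` to a
multiple of itself. -/
lemma map_zero_eq_smul [Fact p.Prime] [CharP L p] (h : IsMonomialFamily τ p ρ r ε g)
    (htf : ∀ (l : L) (x : V), l • x = 0 → l = 0 ∨ x = 0) (Ψ : V →ₗ[L] V)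
    (hw : ∀ b x, ρ (uGL b) (ρ (wGL 𝔽) (Ψ x)) = ρ (wGL 𝔽) (Ψ x)) :
    ∃ c : L, Ψ (g 0) = c • g 0 := by
  obtain ⟨l, hl⟩ := h.exists_eq_smul_of_invariant htf fun b => hw b (g 0)
  refine ⟨l * ε, ?_⟩
  have := congrArg (ρ (wGL 𝔽)) hl
  rw [map_smul, h.w_apply_top, ← Module.End.mul_apply, ← map_mul, wGL_mul_self, map_one] at this
  rw [mul_smul]
  exact this

/-- The endomorphism `-ε w ∑ₓ x ^ (q - 1 - r) uₓ` of `V` is the projection onto the line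
of `g 0` along the other `g j`. -/
lemma exists_projection [Fact p.Prime] [CharP L p] (h : IsMonomialFamily τ p ρ r ε g)
    : ∃ Ψ : V →ₗ[L] V, ∀ i, Ψ (g i) = if i = 0 then g 0 else 0 := by
  have hr := h.r_lt
  have hq : 2 ≤ Fintype.card 𝔽 := Fintype.one_lt_card
  refine ⟨(-ε) • (ρ (wGL 𝔽) ∘ₗ ∑ x : 𝔽, τ x ^ (Fintype.card 𝔽 - 1 - r) • ρ (uGL x)), fun i => ?_⟩
  have hsum : (∑ x : 𝔽, τ x ^ (Fintype.card 𝔽 - 1 - r) • ρ (uGL x)) (g i) =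
      if i = 0 then -g r else 0 := by
    simp only [LinearMap.sum_apply, LinearMap.smul_apply, h.u_apply, Finset.smul_sum]
    rw [Finset.sum_comm]
    have e : ∀ t ∈ Finset.range (Fintype.card 𝔽),
        ∑ x : 𝔽, τ x ^ (Fintype.card 𝔽 - 1 - r) • τ x ^ t • ((i + t).choose i : L) • g (i + t) =
        if t = r then -(((i + t).choose i : L) • g (i + t)) else 0 := by
      intro t ht
      rw [Finset.mem_range] at ht
      simp only [smul_smul (τ _ ^ _) (τ _ ^ _), ← pow_add]
      rw [← Finset.sum_smul]
      by_cases htr : i + t ≤ r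
      · rw [sum_map_pow_eq_ite τ (by omega)]
        by_cases h1 : t = r
        · rw [if_pos (by omega), if_pos h1, neg_one_smul]
        · rw [if_neg (by omega), if_neg h1, zero_smul]
      · rw [h.eq_zero_of_lt (not_le.1 htr)]
        simp
    rw [Finset.sum_congr rfl e, Finset.sum_ite_eq' (Finset.range (Fintype.card 𝔽)),
      if_pos (Finset.mem_range.2 hr)]
    by_cases hi : i = 0
    · subst hi
      simp
    · rw [if_neg hi, h.eq_zero_of_lt (by omega), smul_zero, neg_zero]
  rw [LinearMap.smul_apply, LinearMap.comp_apply, hsum]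
  by_cases hi : i = 0
  · rw [if_pos hi, if_pos hi, map_neg, h.w_apply_top, smul_neg, neg_smul, neg_neg, smul_smul,
      h.eps, one_smul]
  · rw [if_neg hi, if_neg hi, map_zero, smul_zero]

lemma projection_u (h : IsMonomialFamily τ p ρ r ε g) {Ψ : V →ₗ[L] V}
    (hΨ : ∀ i, Ψ (g i) = if i = 0 then g 0 else 0) (b : 𝔽) : Ψ ∘ₗ ρ (uGL b) = Ψ := by
  refine LinearMap.ext_on_range h.span_eq_top fun i => ?_
  rw [LinearMap.comp_apply, h.u_apply, map_sum, Finset.sum_eq_single 0]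
  · simp
  · intro t _ ht
    rw [map_smul, map_smul, hΨ, if_neg (by omega), smul_zero, smul_zero]
  · intro h0
    simp at h0

lemma projection_d (h : IsMonomialFamily τ p ρ r ε g) {Ψ : V →ₗ[L] V}
    (hΨ : ∀ i, Ψ (g i) = if i = 0 then g 0 else 0) (a b : 𝔽ˣ) :
    Ψ ∘ₗ ρ (dGL a b) = ρ (dGL a b) ∘ₗ Ψ := by
  refine LinearMap.ext_on_range h.span_eq_top fun i => ?_
  obtain ⟨c, hc⟩ := h.d_apply a b i
  rw [LinearMap.comp_apply, LinearMap.comp_apply, hc, map_smul, hΨ]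
  by_cases hi : i = 0
  · subst hi
    simp [hc]
  · simp [hi]

lemma u_w_projection [Fact p.Prime] (h : IsMonomialFamily τ p ρ r ε g) {Ψ : V →ₗ[L] V}
    (hΨ : ∀ i, Ψ (g i) = if i = 0 then g 0 else 0) (b : 𝔽) :
    ρ (uGL b) ∘ₗ ρ (wGL 𝔽) ∘ₗ Ψ = ρ (wGL 𝔽) ∘ₗ Ψ := by
  refine LinearMap.ext_on_range h.span_eq_top fun i => ?_
  simp only [LinearMap.comp_apply, hΨ]
  by_cases hi : i = 0
  · rw [if_pos hi, h.w_apply_zero, map_smul, h.u_apply_top]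
  · simp [hi]

end IsMonomialFamily

/-! ### The ring of integers of a quadratic extension of `ℚ_p` -/

section LocalField

variable {p : ℕ} [Fact p.Prime] {F : Type*} [NormedField F] [NormedAlgebra ℚ_[p] F]
  [Algebra ℤ_[p] F] [IsScalarTower ℤ_[p] ℚ_[p] F]

lemma mem_integralClosure_iff_norm_le_one [FiniteDimensional ℚ_[p] F] {x : F} :
    x ∈ integralClosure ℤ_[p] F ↔ ‖x‖ ≤ 1 := by
  have hint : IsIntegral ℚ_[p] x := Algebra.IsIntegral.isIntegral x
  rw [NormedAlgebra.norm_eq_spectralNorm (K := ℚ_[p]) x, spectralNorm,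
    spectralValue_le_one_iff (minpoly.monic hint)]
  constructor
  · intro hx n
    rw [minpoly.isIntegrallyClosed_eq_field_fractions' ℚ_[p] hx, Polynomial.coeff_map]
    exact PadicInt.norm_le_one _
  · intro h
    have hl : minpoly ℚ_[p] x ∈ Polynomial.lifts (algebraMap ℤ_[p] ℚ_[p]) := by
      rw [Polynomial.lifts_iff_coeff_lifts]
      exact fun n => ⟨⟨_, h n⟩, rfl⟩
    obtain ⟨P, hP, -, hPm⟩ := Polynomial.lifts_and_natDegree_eq_and_monic hl (minpoly.monic hint)
    refine ⟨P, hPm, ?_⟩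
    have := minpoly.aeval ℚ_[p] x
    rw [← hP, Polynomial.aeval_map_algebraMap] at this
    exact this

lemma isUltrametricDist_of_finiteDimensional [FiniteDimensional ℚ_[p] F] : IsUltrametricDist F := by
  refine IsUltrametricDist.isUltrametricDist_of_forall_norm_natCast_le_one fun n => ?_
  rw [← mem_integralClosure_iff_norm_le_one (p := p)]
  exact natCast_mem _ n

instance [FiniteDimensional ℚ_[p] F] : ValuationRing (integralClosure ℤ_[p] F) := by
  refine { cond' := ?_ }
  intro a b
  have key : ∀ a b : integralClosure ℤ_[p] F, ‖(b : F)‖ ≤ ‖(a : F)‖ → ∃ c, a * c = b := by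
    intro a b h
    by_cases ha : (a : F) = 0
    · refine ⟨0, Subtype.ext ?_⟩
      rw [ha, norm_zero] at h
      simp [norm_le_zero_iff.1 h]
    · refine ⟨⟨(b : F) / a, mem_integralClosure_iff_norm_le_one.2 ?_⟩, Subtype.ext ?_⟩
      · rw [norm_div]
        exact div_le_one_of_le₀ h (norm_nonneg _)
      · change (a : F) * (b / a) = b
        field_simp
  rcases le_total ‖(b : F)‖ ‖(a : F)‖ with h | h
  · exact ⟨(key a b h).choose, Or.inl (key a b h).choose_spec⟩
  · exact ⟨(key b a h).choose, Or.inr (key b a h).choose_spec⟩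

lemma maximalIdeal_eq_span [FiniteDimensional ℚ_[p] F] {ϖ : integralClosure ℤ_[p] F}
    (hϖ : Irreducible ϖ) :
    IsLocalRing.maximalIdeal (integralClosure ℤ_[p] F) = Ideal.span {ϖ} := by
  ext x
  rw [IsLocalRing.mem_maximalIdeal, mem_nonunits_iff, Ideal.mem_span_singleton]
  constructor
  · intro hx
    rcases ValuationRing.dvd_total ϖ x with h | ⟨c, hc⟩
    · exact h
    · rcases hϖ.isUnit_or_isUnit hc with h | h
      · exact absurd h hx
      · obtain ⟨u, rfl⟩ := h
        exact ⟨((u⁻¹ : (integralClosure ℤ_[p] F)ˣ) : integralClosure ℤ_[p] F), by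
          rw [hc, mul_assoc, Units.mul_inv, mul_one]⟩
  · rintro ⟨c, rfl⟩ h
    exact hϖ.not_isUnit (isUnit_of_mul_isUnit_left h)

lemma span_uniformizer_isMaximal [FiniteDimensional ℚ_[p] F] {ϖ : integralClosure ℤ_[p] F}
    (hϖ : Irreducible ϖ) : (Ideal.span {ϖ}).IsMaximal :=
  maximalIdeal_eq_span hϖ ▸ inferInstance

lemma isUnit_iff_norm_eq_one [FiniteDimensional ℚ_[p] F] {x : integralClosure ℤ_[p] F} :
    IsUnit x ↔ ‖(x : F)‖ = 1 := by
  constructor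
  · rintro ⟨u, rfl⟩
    have h1 := mem_integralClosure_iff_norm_le_one.1 (u : integralClosure ℤ_[p] F).2
    have h2 := mem_integralClosure_iff_norm_le_one.1
      ((u⁻¹ : (integralClosure ℤ_[p] F)ˣ) : integralClosure ℤ_[p] F).2
    have h3 : ‖((u : integralClosure ℤ_[p] F) : F)‖ *
        ‖(((u⁻¹ : (integralClosure ℤ_[p] F)ˣ) : integralClosure ℤ_[p] F) : F)‖ = 1 := by
      rw [← norm_mul]
      have := congrArg (fun y : integralClosure ℤ_[p] F => ‖(y : F)‖) (Units.mul_inv u)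
      rw [MulMemClass.coe_mul] at this
      rw [this, OneMemClass.coe_one, norm_one]
    nlinarith [norm_nonneg ((u : integralClosure ℤ_[p] F) : F)]
  · intro h
    have h0 : (x : F) ≠ 0 := by
      rw [← norm_pos_iff, h]; exact one_pos
    refine IsUnit.of_mul_eq_one ⟨(x : F)⁻¹, mem_integralClosure_iff_norm_le_one.2
      (by rw [norm_inv, h, inv_one])⟩ (Subtype.ext ?_)
    exact mul_inv_cancel₀ h0

lemma norm_uniformizer_lt_one [FiniteDimensional ℚ_[p] F] {ϖ : integralClosure ℤ_[p] F}
    (hϖ : Irreducible ϖ) : ‖(ϖ : F)‖ < 1 :=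
  lt_of_le_of_ne (mem_integralClosure_iff_norm_le_one.1 ϖ.2)
    fun h => hϖ.not_isUnit (isUnit_iff_norm_eq_one.2 h)

lemma norm_uniformizer_pos {ϖ : integralClosure ℤ_[p] F} (hϖ : Irreducible ϖ) :
    0 < ‖(ϖ : F)‖ :=
  norm_pos_iff.2 fun h => hϖ.ne_zero (Subtype.ext h)

lemma natCast_mem_span_uniformizer [FiniteDimensional ℚ_[p] F] {ϖ : integralClosure ℤ_[p] F}
    (hϖ : Irreducible ϖ) : (p : integralClosure ℤ_[p] F) ∈ Ideal.span {ϖ} := by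
  rw [← maximalIdeal_eq_span hϖ, IsLocalRing.mem_maximalIdeal, mem_nonunits_iff,
    isUnit_iff_norm_eq_one]
  have : ((p : integralClosure ℤ_[p] F) : F) = algebraMap ℚ_[p] F p := by simp
  rw [this, norm_algebraMap', Padic.norm_p]
  have : (1 : ℝ) < p := by exact_mod_cast (Fact.out : p.Prime).one_lt
  exact (inv_lt_one_of_one_lt₀ this).ne

lemma isCompact_integralClosure [FiniteDimensional ℚ_[p] F] :
    IsCompact (integralClosure ℤ_[p] F : Set F) := by
  have : ProperSpace F := FiniteDimensional.proper ℚ_[p] F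
  have e : (integralClosure ℤ_[p] F : Set F) = Metric.closedBall 0 1 := by
    ext x; simp [mem_integralClosure_iff_norm_le_one]
  rw [e]
  exact isCompact_closedBall _ _

instance [FiniteDimensional ℚ_[p] F] : Module.Finite ℤ_[p] (integralClosure ℤ_[p] F) :=
  IsIntegralClosure.finite ℤ_[p] ℚ_[p] F _

instance [FiniteDimensional ℚ_[p] F] : IsDedekindDomain (integralClosure ℤ_[p] F) :=
  integralClosure.isDedekindDomain ℤ_[p] ℚ_[p] F

instance [FiniteDimensional ℚ_[p] F] : FaithfulSMul ℤ_[p] F := by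
  rw [faithfulSMul_iff_algebraMap_injective, IsScalarTower.algebraMap_eq ℤ_[p] ℚ_[p] F]
  exact (algebraMap ℚ_[p] F).injective.comp (IsFractionRing.injective ℤ_[p] ℚ_[p])

/-- The equality `e f = 2`: in a quadratic extension of `ℚ_p`, either the residue field has `p`
elements and `p` is divisible by `ϖ ^ 2`, or the residue field has `p ^ 2` elements. -/
lemma card_residueField_of_finrank_eq_two (hF : Module.finrank ℚ_[p] F = 2)
    {ϖ : integralClosure ℤ_[p] F} (hϖ : Irreducible ϖ) :
    (Nat.card (integralClosure ℤ_[p] F ⧸ Ideal.span {ϖ}) = p ∧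
      ϖ ^ 2 ∣ (p : integralClosure ℤ_[p] F)) ∨
    Nat.card (integralClosure ℤ_[p] F ⧸ Ideal.span {ϖ}) = p ^ 2 := by
  have : FiniteDimensional ℚ_[p] F := Module.finite_of_finrank_eq_succ hF
  -- the fundamental identity for the only prime of `𝒪_F` over `p`
  let P := IsLocalRing.maximalIdeal ℤ_[p]
  have hP : P ≠ ⊥ := IsDiscreteValuationRing.not_a_field ℤ_[p]
  have : Module.IsTorsionFree ℤ_[p] F := inferInstance
  have : FaithfulSMul ℤ_[p] (integralClosure ℤ_[p] F) := inferInstance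
  have hprimes := IsLocalRing.primesOver_eq (integralClosure ℤ_[p] F) hP
  rw [maximalIdeal_eq_span hϖ] at hprimes
  have hmem : Ideal.span {ϖ} ∈ P.primesOver (integralClosure ℤ_[p] F) := hprimes ▸ rfl
  have : (Ideal.span {ϖ}).LiesOver P := hmem.2
  have : (Ideal.span {ϖ}).IsMaximal := span_uniformizer_isMaximal hϖ
  let : Unique (P.primesOver (integralClosure ℤ_[p] F)) :=
    { default := ⟨_, hmem⟩
      uniq := fun x => Subtype.ext (by
        have h : (x : Ideal (integralClosure ℤ_[p] F)) ∈ ({Ideal.span {ϖ}} : Set _) :=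
          hprimes ▸ x.2
        exact h) }
  have hsum := Ideal.sum_ramification_inertia_eq_finrank P (integralClosure ℤ_[p] F)
  rw [Fintype.sum_unique] at hsum
  have hrank : Module.finrank ℤ_[p] (integralClosure ℤ_[p] F) = 2 := by
    rw [IsIntegralClosure.rank ℤ_[p] ℚ_[p] F (integralClosure ℤ_[p] F), hF]
  rw [hrank] at hsum
  change (Ideal.span {ϖ}).ramificationIdx ℤ_[p] * (Ideal.span {ϖ}).inertiaDeg ℤ_[p] = 2 at hsum
  have hcard := Ideal.cardQuot_pow_inertiaDeg P (Ideal.span {ϖ})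
  have hP' : Submodule.cardQuot P = p := by
    rw [Submodule.cardQuot_apply]
    exact (Nat.card_congr (PadicInt.residueField (p := p)).toEquiv).trans (Nat.card_zmod p)
  rw [hP', Submodule.cardQuot_apply] at hcard
  have hram := Ideal.ramificationIdx'_eq_ramificationIdx P (Ideal.span {ϖ}) hP
  rcases (Nat.dvd_prime Nat.prime_two).1 (Dvd.intro _ hsum) with h | h
  · right
    rw [h, one_mul] at hsum
    rw [← hcard, hsum]
  · left
    rw [h] at hsum hram
    have h1 : (Ideal.span {ϖ}).inertiaDeg ℤ_[p] = 1 := by omega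
    refine ⟨by rw [← hcard, h1, pow_one], ?_⟩
    have hle := Ideal.le_pow_ramificationIdx' (p := P) (P := Ideal.span {ϖ})
    rw [hram, Ideal.span_singleton_pow] at hle
    rw [← Ideal.mem_span_singleton]
    refine hle ?_
    have h2 : (p : ℤ_[p]) ∈ P := by
      rw [show P = _ from PadicInt.maximalIdeal_eq_span_p]
      exact Ideal.mem_span_singleton_self _
    simpa using Ideal.mem_map_of_mem (algebraMap ℤ_[p] (integralClosure ℤ_[p] F)) h2

lemma finite_residueField {ϖ : integralClosure ℤ_[p] F}
    (hF : Module.finrank ℚ_[p] F = 2) (hϖ : Irreducible ϖ) :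
    Finite (integralClosure ℤ_[p] F ⧸ Ideal.span {ϖ}) := by
  refine Nat.finite_of_card_ne_zero ?_
  have := (Fact.out : p.Prime).pos
  rcases card_residueField_of_finrank_eq_two hF hϖ with ⟨h, -⟩ | h <;> rw [h] <;> positivity

end LocalField

/-! ### Cosets of `𝒦` in `GL₂(F)` -/

section Cosets

variable {p : ℕ} [Fact p.Prime] {F : Type*} [NormedField F] [NormedAlgebra ℚ_[p] F]
  [Algebra ℤ_[p] F]

/-- The embedding of `GL₂(𝒪_F)` in `𝒦`. -/
noncomputable def intGL : GL (Fin 2) (integralClosure ℤ_[p] F) →* groupZK p F :=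
  (Matrix.GeneralLinearGroup.map (n := Fin 2) (algebraMap (integralClosure ℤ_[p] F) F)).codRestrict
    _ fun κ => Subgroup.mem_sup_right ⟨κ, rfl⟩

variable (p) in
/-- The embedding of the centre in `𝒦`. -/
noncomputable def scalarZK : Fˣ →* groupZK p F :=
  (Matrix.GeneralLinearGroup.scalar (Fin 2)).codRestrict _ fun c => Subgroup.mem_sup_left <| by
    rw [Matrix.GeneralLinearGroup.center_eq_range_scalar]
    exact ⟨c, rfl⟩

lemma coe_scalarZK (c : Fˣ) :
    (scalarZK p c : GL (Fin 2) F) = Matrix.GeneralLinearGroup.scalar (Fin 2) c := rfl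

@[simp] lemma coe_intGL_apply (κ : GL (Fin 2) (integralClosure ℤ_[p] F)) (i j : Fin 2) :
    (intGL κ : GL (Fin 2) F) i j = κ i j := rfl

lemma coe_intGL_uGL (x : integralClosure ℤ_[p] F) :
    (intGL (uGL x) : GL (Fin 2) F) = uGL (x : F) := map_uGL _ x

variable (p F) in
lemma coe_intGL_wGL : (intGL (wGL (integralClosure ℤ_[p] F)) : GL (Fin 2) F) = wGL F := map_wGL _

lemma scalarZK_mul (c : Fˣ) (h : groupZK p F) : scalarZK p c * h = h * scalarZK p c :=
  Subtype.ext (Matrix.GeneralLinearGroup.scalar_commute (n := Fin 2) c h.1)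

lemma exists_eq_scalarZK_mul_intGL (h : groupZK p F) : ∃ c κ, h = scalarZK p c * intGL κ := by
  obtain ⟨h, hh⟩ := h
  rw [groupZK, Subgroup.mem_sup_of_normal_left] at hh
  obtain ⟨y, hy, z, ⟨κ, rfl⟩, e⟩ := hh
  rw [Matrix.GeneralLinearGroup.center_eq_range_scalar] at hy
  obtain ⟨c, rfl⟩ := hy
  exact ⟨c, κ, Subtype.ext e.symm⟩

lemma coe_alphaGL (ϖ : integralClosure ℤ_[p] F) (hϖ : Irreducible ϖ) :
    (alphaGL ϖ hϖ : Matrix (Fin 2) (Fin 2) F) = !![(ϖ : F), 0; 0, 1] := rfl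

lemma coe_alphaGL_pow (ϖ : integralClosure ℤ_[p] F) (hϖ : Irreducible ϖ) (n : ℕ) :
    ((alphaGL ϖ hϖ ^ n : GL (Fin 2) F) : Matrix (Fin 2) (Fin 2) F) =
      !![(ϖ : F) ^ n, 0; 0, 1] := by
  induction n with
  | zero => ext i j; fin_cases i <;> fin_cases j <;> simp
  | succ n ih =>
    rw [pow_succ, Matrix.GeneralLinearGroup.coe_mul, ih, coe_alphaGL]
    ext i j; fin_cases i <;> fin_cases j <;> simp [pow_succ]

lemma alphaGL_pow_mul_uGL (ϖ : integralClosure ℤ_[p] F) (hϖ : Irreducible ϖ) (n : ℕ) (x : F) :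
    alphaGL ϖ hϖ ^ n * uGL x = uGL (ϖ ^ n * x) * alphaGL ϖ hϖ ^ n := by
  ext i j
  rw [Matrix.GeneralLinearGroup.coe_mul, Matrix.GeneralLinearGroup.coe_mul, coe_alphaGL_pow]
  fin_cases i <;> fin_cases j <;> simp

/-- The uniformizer as a unit of `F`. -/
noncomputable def uniformizerUnit (ϖ : integralClosure ℤ_[p] F) (hϖ : Irreducible ϖ) : Fˣ :=
  Units.mk0 (ϖ : F) fun h => hϖ.ne_zero (Subtype.ext h)

lemma alphaGL_mul_wGL_mul_alphaGL (ϖ : integralClosure ℤ_[p] F) (hϖ : Irreducible ϖ) :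
    alphaGL ϖ hϖ * wGL F * alphaGL ϖ hϖ =
      wGL F * Matrix.GeneralLinearGroup.scalar (Fin 2) (uniformizerUnit ϖ hϖ) := by
  ext i j
  rw [Matrix.GeneralLinearGroup.coe_mul, Matrix.GeneralLinearGroup.coe_mul, coe_alphaGL]
  fin_cases i <;> fin_cases j <;> simp [uniformizerUnit, Matrix.mul_apply]

/-- Conjugation by `α` maps the matrices of `GL₂(𝒪_F)` with upper right entry divisible by `ϖ`
to `GL₂(𝒪_F)`. -/
lemma exists_mul_alphaGL_eq (ϖ : integralClosure ℤ_[p] F) (hϖ : Irreducible ϖ)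
    {κ : GL (Fin 2) (integralClosure ℤ_[p] F)} {b : integralClosure ℤ_[p] F}
    (hb : κ 0 1 = ϖ * b) :
    ∃ κ' : GL (Fin 2) (integralClosure ℤ_[p] F),
      (intGL κ : GL (Fin 2) F) * alphaGL ϖ hϖ = alphaGL ϖ hϖ * intGL κ' ∧
      (κ' : Matrix (Fin 2) (Fin 2) (integralClosure ℤ_[p] F)) =
        !![κ 0 0, b; ϖ * κ 1 0, κ 1 1] := by
  have hdet : IsUnit (!![κ 0 0, b; ϖ * κ 1 0, κ 1 1] :
      Matrix (Fin 2) (Fin 2) (integralClosure ℤ_[p] F)).det := by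
    have := (Matrix.GeneralLinearGroup.det κ).isUnit
    change IsUnit ((κ : Matrix (Fin 2) (Fin 2) (integralClosure ℤ_[p] F)).det) at this
    rw [Matrix.det_fin_two, hb] at this
    rw [Matrix.det_fin_two_of]
    convert this using 1
    ring
  have hb' : ((κ 0 1 : integralClosure ℤ_[p] F) : F) = ϖ * b := by rw [hb]; rfl
  refine ⟨Matrix.GeneralLinearGroup.mk'' _ hdet, ?_, rfl⟩
  ext i j
  rw [Matrix.GeneralLinearGroup.coe_mul, Matrix.GeneralLinearGroup.coe_mul, coe_alphaGL]
  have hk : ∀ i j, (intGL (Matrix.GeneralLinearGroup.mk'' _ hdet) : GL (Fin 2) F) i j =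
      ((!![κ 0 0, b; ϖ * κ 1 0, κ 1 1] i j : integralClosure ℤ_[p] F) : F) := fun i j => rfl
  fin_cases i <;> fin_cases j <;>
    simp [Matrix.mul_apply, Fin.sum_univ_two, hk, hb', mul_comm]

variable [IsScalarTower ℤ_[p] ℚ_[p] F] [FiniteDimensional ℚ_[p] F]

/-- The double coset `GL₂(𝒪_F) α 𝒦` is the union of the cosets of `u_x α`, for `x` in a system of
representatives of the residue field, and of `w α`. -/
lemma exists_mul_alphaGL_eq_or (ϖ : integralClosure ℤ_[p] F) (hϖ : Irreducible ϖ)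
    {𝔽 : Type*} [Field 𝔽] {π : integralClosure ℤ_[p] F →+* 𝔽} (hπ : ∀ x, π x = 0 ↔ ϖ ∣ x)
    {rep : 𝔽 → integralClosure ℤ_[p] F} (hrep : ∀ x, π (rep x) = x)
    (κ : GL (Fin 2) (integralClosure ℤ_[p] F)) :
    (∃ (x : 𝔽) (κ' : GL (Fin 2) (integralClosure ℤ_[p] F)),
      (intGL κ : GL (Fin 2) F) * alphaGL ϖ hϖ =
      (intGL (uGL (rep x)) : GL (Fin 2) F) * alphaGL ϖ hϖ * (intGL κ' : GL (Fin 2) F)) ∨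
    ∃ κ' : GL (Fin 2) (integralClosure ℤ_[p] F), (intGL κ : GL (Fin 2) F) * alphaGL ϖ hϖ =
      (intGL (wGL (integralClosure ℤ_[p] F)) : GL (Fin 2) F) * alphaGL ϖ hϖ *
        (intGL κ' : GL (Fin 2) F) := by
  by_cases hd : IsUnit (κ 1 1)
  · left
    obtain ⟨d, hd⟩ := hd
    set x := π (κ 0 1 * ((d⁻¹ : (integralClosure ℤ_[p] F)ˣ) : integralClosure ℤ_[p] F)) with hx
    have h1 : ϖ ∣ κ 0 1 - rep x * κ 1 1 := by
      rw [← hπ, map_sub, map_mul, hrep, hx, ← map_mul, mul_assoc, ← hd]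
      simp
    obtain ⟨b, hb⟩ := h1
    obtain ⟨κ', h2, -⟩ := exists_mul_alphaGL_eq ϖ hϖ (κ := (uGL (rep x))⁻¹ * κ) (b := b) (by
      rw [← hb, uGL_inv]
      simp [Matrix.mul_apply, Fin.sum_univ_two, sub_eq_add_neg])
    refine ⟨x, κ', ?_⟩
    rw [mul_assoc, ← h2, map_mul, map_inv]
    simp [mul_assoc]
  · right
    have h1 : κ 1 1 ∈ Ideal.span {ϖ} := by
      rw [← maximalIdeal_eq_span hϖ]
      exact (IsLocalRing.mem_maximalIdeal _).2 hd
    obtain ⟨b, hb⟩ := Ideal.mem_span_singleton.1 h1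
    obtain ⟨κ', h2, -⟩ := exists_mul_alphaGL_eq ϖ hϖ (κ := (wGL _)⁻¹ * κ) (b := b) (by
      rw [← hb, inv_eq_of_mul_eq_one_left (wGL_mul_self (R := integralClosure ℤ_[p] F))]
      simp [Matrix.mul_apply, Fin.sum_univ_two])
    refine ⟨κ', ?_⟩
    rw [mul_assoc, ← h2, map_mul, map_inv]
    simp [mul_assoc]

lemma norm_sq_le_norm_det {h : GL (Fin 2) F} (hh : h ∈ groupZK p F) (i j : Fin 2) :
    ‖h i j‖ ^ 2 ≤ ‖(h : Matrix (Fin 2) (Fin 2) F).det‖ := by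
  obtain ⟨c, κ, e⟩ := exists_eq_scalarZK_mul_intGL ⟨h, hh⟩
  have e' : (h : Matrix (Fin 2) (Fin 2) F) =
      Matrix.scalar (Fin 2) (c : F) * (intGL κ : GL (Fin 2) F) :=
    congrArg (fun x : groupZK p F => ((x : GL (Fin 2) F) : Matrix (Fin 2) (Fin 2) F)) e
  have hκ : ‖((intGL κ : GL (Fin 2) F) : Matrix (Fin 2) (Fin 2) F).det‖ = 1 := by
    have := isUnit_iff_norm_eq_one.1 (Matrix.GeneralLinearGroup.det κ).isUnit
    rw [← this]
    congr 1
  rw [e', Matrix.det_mul, norm_mul, hκ, mul_one]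
  have hc : (Matrix.scalar (Fin 2) (c : F)).det = (c : F) ^ 2 := by
    simp
  rw [hc, norm_pow]
  have h1 : (Matrix.scalar (Fin 2) (c : F) * (intGL κ : GL (Fin 2) F)) i j = c * κ i j := by
    simp
  rw [h1, norm_mul]
  have := mem_integralClosure_iff_norm_le_one.1 (κ i j).2
  gcongr
  exact mul_le_of_le_one_right (norm_nonneg _) this

/-- The cosets of the `u_x α^m`, with `x` modulo `ϖ^m`, are distinct. -/
lemma eq_of_alphaGL_pow_mem (ϖ : integralClosure ℤ_[p] F) (hϖ : Irreducible ϖ)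
    {x y : F} {m n : ℕ}
    (h : (uGL x * alphaGL ϖ hϖ ^ m)⁻¹ * (uGL y * alphaGL ϖ hϖ ^ n) ∈ groupZK p F) :
    m = n ∧ ‖y - x‖ ≤ ‖(ϖ : F)‖ ^ m := by
  set k := (uGL x * alphaGL ϖ hϖ ^ m)⁻¹ * (uGL y * alphaGL ϖ hϖ ^ n) with hk
  have e : uGL x * alphaGL ϖ hϖ ^ m * k = uGL y * alphaGL ϖ hϖ ^ n := by rw [hk]; group
  have hent := fun i j => congrArg (fun g : GL (Fin 2) F => g i j) e
  have h00 := hent 0 0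
  have h01 := hent 0 1
  have h10 := hent 1 0
  have h11 := hent 1 1
  simp only [Matrix.GeneralLinearGroup.coe_mul, coe_alphaGL_pow, coe_uGL] at h00 h01 h10 h11
  simp [Matrix.mul_apply, Fin.sum_univ_two] at h00 h01 h10 h11
  have hn := norm_sq_le_norm_det h
  rw [Matrix.det_fin_two, h10, h11] at hn
  simp only [mul_one, mul_zero, sub_zero] at hn
  have n00 := hn 0 0
  have n01 := hn 0 1
  have n11 := hn 1 1
  rw [h11] at n11
  simp only [norm_one, one_pow] at n11
  have hk0 : ‖k 0 0‖ = 1 := by nlinarith [norm_nonneg (k 0 0)]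
  rw [hk0] at n01
  have hk1 : ‖k 0 1‖ ≤ 1 := by nlinarith [norm_nonneg (k 0 1)]
  rw [h11, mul_one] at h01
  rw [h10, mul_zero, add_zero] at h00
  constructor
  · have h2 := congrArg norm h00
    simp only [norm_mul, norm_pow, hk0, mul_one] at h2
    exact pow_right_injective₀ (norm_uniformizer_pos hϖ) (norm_uniformizer_lt_one hϖ).ne h2
  · rw [← h01, add_sub_cancel_right, norm_mul, norm_pow]
    exact mul_le_of_le_one_right (by positivity) hk1

lemma wGL_coset_notMem (ϖ : integralClosure ℤ_[p] F) (hϖ : Irreducible ϖ)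
    (x : integralClosure ℤ_[p] F) :
    ((intGL (uGL x) : GL (Fin 2) F) * alphaGL ϖ hϖ)⁻¹ *
      (intGL (wGL (integralClosure ℤ_[p] F)) * alphaGL ϖ hϖ) ∉ groupZK p F := by
  intro h
  set k := ((intGL (uGL x) : GL (Fin 2) F) * alphaGL ϖ hϖ)⁻¹ *
      (intGL (wGL (integralClosure ℤ_[p] F)) * alphaGL ϖ hϖ) with hk
  have e : (intGL (uGL x) : GL (Fin 2) F) * alphaGL ϖ hϖ * k =
      intGL (wGL (integralClosure ℤ_[p] F)) * alphaGL ϖ hϖ := by rw [hk]; group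
  rw [coe_intGL_uGL, coe_intGL_wGL] at e
  have hent := fun i j => congrArg (fun g : GL (Fin 2) F => g i j) e
  have h01 := hent 0 1
  have h10 := hent 1 0
  have h11 := hent 1 1
  simp only [Matrix.GeneralLinearGroup.coe_mul, coe_alphaGL, coe_uGL, coe_wGL] at h01 h10 h11
  simp [Matrix.mul_apply, Fin.sum_univ_two] at h01 h10 h11
  have hn := norm_sq_le_norm_det h 0 1
  rw [Matrix.det_fin_two, h10, h11] at hn
  rw [h11] at h01
  simp only [mul_zero, zero_sub, norm_neg, add_zero] at hn h01
  rw [mul_comm (k 0 1), h01, norm_one] at hn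
  have h2 := congrArg norm h01
  rw [norm_mul, norm_one] at h2
  have h3 := norm_uniformizer_lt_one hϖ
  nlinarith [norm_nonneg (k 0 1), norm_uniformizer_pos hϖ]

end Cosets

/-! ### Congruence subgroups -/

section Congruence

variable {p : ℕ} [Fact p.Prime] {F : Type*} [NormedField F] [NormedAlgebra ℚ_[p] F]
  [Algebra ℤ_[p] F]

/-- The principal congruence subgroup of level `ϖ ^ m` of `GL₂(𝒪_F)`. -/
noncomputable def congrSubgroup (ϖ : integralClosure ℤ_[p] F) (m : ℕ) :
    Subgroup (GL (Fin 2) (integralClosure ℤ_[p] F)) :=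
  (Matrix.GeneralLinearGroup.map (n := Fin 2)
    (Ideal.Quotient.mk (Ideal.span {ϖ ^ m} : Ideal (integralClosure ℤ_[p] F)))).ker

/-- The subgroup of the matrices of `GL₂(𝒪_F)` that are upper unipotent modulo `ϖ ^ m`. -/
noncomputable def unipSubgroup (ϖ : integralClosure ℤ_[p] F) (m : ℕ) :
    Subgroup (GL (Fin 2) (integralClosure ℤ_[p] F)) :=
  (MonoidHom.range (MonoidHom.mk' (fun x : Multiplicative
    (integralClosure ℤ_[p] F ⧸ (Ideal.span {ϖ ^ m} : Ideal (integralClosure ℤ_[p] F))) =>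
      uGL x.toAdd) fun x y => uGL_add x.toAdd y.toAdd)).comap
  (Matrix.GeneralLinearGroup.map (n := Fin 2)
    (Ideal.Quotient.mk (Ideal.span {ϖ ^ m} : Ideal (integralClosure ℤ_[p] F))))

lemma mem_congrSubgroup_iff {ϖ : integralClosure ℤ_[p] F} {m : ℕ}
    {κ : GL (Fin 2) (integralClosure ℤ_[p] F)} :
    κ ∈ congrSubgroup ϖ m ↔ ∀ i j, ϖ ^ m ∣ κ i j - (1 : Matrix (Fin 2) (Fin 2) _) i j := by
  rw [congrSubgroup, MonoidHom.mem_ker, Matrix.GeneralLinearGroup.ext_iff]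
  refine forall_congr' fun i => forall_congr' fun j => ?_
  rw [← Ideal.mem_span_singleton, ← Ideal.Quotient.eq, Matrix.GeneralLinearGroup.map_apply]
  have : (Ideal.Quotient.mk (Ideal.span {ϖ ^ m}))
      ((1 : Matrix (Fin 2) (Fin 2) (integralClosure ℤ_[p] F)) i j) =
      ((1 : GL (Fin 2) (integralClosure ℤ_[p] F ⧸ Ideal.span {ϖ ^ m})) : Matrix _ _ _) i j := by
    rw [Matrix.GeneralLinearGroup.coe_one, Matrix.one_apply, Matrix.one_apply]
    split_ifs <;> simp
  rw [this]

lemma mem_unipSubgroup_iff {ϖ : integralClosure ℤ_[p] F} {m : ℕ}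
    {κ : GL (Fin 2) (integralClosure ℤ_[p] F)} :
    κ ∈ unipSubgroup ϖ m ↔ ϖ ^ m ∣ κ 0 0 - 1 ∧ ϖ ^ m ∣ κ 1 0 ∧ ϖ ^ m ∣ κ 1 1 - 1 := by
  simp only [unipSubgroup, Subgroup.mem_comap, MonoidHom.mem_range,
    ← Ideal.mem_span_singleton (y := ϖ ^ m)]
  rw [← Ideal.Quotient.eq, ← Ideal.Quotient.eq, ← Ideal.Quotient.eq_zero_iff_mem, map_one]
  constructor
  · rintro ⟨x, hx⟩
    have := fun i j => (Matrix.GeneralLinearGroup.ext_iff _ _).1 hx i j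
    refine ⟨?_, ?_, ?_⟩
    · simpa using (this 0 0).symm
    · simpa using (this 1 0).symm
    · simpa using (this 1 1).symm
  · rintro ⟨h1, h2, h3⟩
    refine ⟨Multiplicative.ofAdd (Ideal.Quotient.mk _ (κ 0 1)), ?_⟩
    ext i j
    fin_cases i <;> fin_cases j <;> simp [h1, h2, h3]

lemma uGL_mem_unipSubgroup (ϖ : integralClosure ℤ_[p] F) (m : ℕ) (x : integralClosure ℤ_[p] F) :
    uGL x ∈ unipSubgroup ϖ m := by
  rw [mem_unipSubgroup_iff]
  simp

lemma exists_eq_uGL_mul_of_mem_unipSubgroup {ϖ : integralClosure ℤ_[p] F} {m : ℕ}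
    {κ : GL (Fin 2) (integralClosure ℤ_[p] F)} (hκ : κ ∈ unipSubgroup ϖ m) :
    ∃ x, ∃ κ' ∈ congrSubgroup ϖ m, κ = uGL x * κ' := by
  refine ⟨κ 0 1, (uGL (κ 0 1))⁻¹ * κ, ?_, by group⟩
  rw [mem_unipSubgroup_iff] at hκ
  obtain ⟨h1, h2, h3⟩ := hκ
  rw [mem_congrSubgroup_iff, uGL_inv]
  intro i j
  fin_cases i <;> fin_cases j <;> simp [Matrix.mul_apply, Fin.sum_univ_two]
  · have := dvd_sub h1 (h2.mul_left (κ 0 1))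
    convert this using 1
    ring
  · have := (h3.mul_left (-κ 0 1))
    convert this using 1
    ring
  · exact h2
  · exact h3

lemma congrSubgroup_mono (ϖ : integralClosure ℤ_[p] F) {m n : ℕ} (h : m ≤ n) :
    congrSubgroup ϖ n ≤ congrSubgroup ϖ m := by
  intro κ hκ
  rw [mem_congrSubgroup_iff] at *
  exact fun i j => (pow_dvd_pow ϖ h).trans (hκ i j)

instance (ϖ : integralClosure ℤ_[p] F) (m : ℕ) : (congrSubgroup ϖ m).Normal := by
  rw [congrSubgroup]; infer_instance

/-- Conjugation by `u_x α` maps the congruence subgroup of level `m + 1` to that of level `m`. -/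
lemma exists_congrSubgroup_mul_eq (ϖ : integralClosure ℤ_[p] F) (hϖ : Irreducible ϖ) {m : ℕ}
    {κ : GL (Fin 2) (integralClosure ℤ_[p] F)} (hκ : κ ∈ congrSubgroup ϖ (m + 1))
    (x : integralClosure ℤ_[p] F) :
    ∃ κ' ∈ congrSubgroup ϖ m, (intGL κ : GL (Fin 2) F) * (intGL (uGL x) * alphaGL ϖ hϖ) =
      intGL (uGL x) * alphaGL ϖ hϖ * intGL κ' := by
  have hκ2 : (uGL x)⁻¹ * κ * uGL x ∈ congrSubgroup ϖ (m + 1) := by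
    have := (inferInstance : (congrSubgroup ϖ (m + 1)).Normal).conj_mem κ hκ (uGL x)⁻¹
    simpa using this
  set κ₂ := (uGL x)⁻¹ * κ * uGL x with h2
  rw [mem_congrSubgroup_iff] at hκ2
  have h01 := hκ2 0 1
  simp only [Matrix.one_apply_ne (show (0 : Fin 2) ≠ 1 by decide), sub_zero] at h01
  obtain ⟨b, hb⟩ := h01
  obtain ⟨κ', h3, h4⟩ := exists_mul_alphaGL_eq ϖ hϖ (κ := κ₂) (b := ϖ ^ m * b)
    (by rw [hb]; ring)
  refine ⟨κ', ?_, ?_⟩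
  · rw [mem_congrSubgroup_iff, h4]
    intro i j
    have hle : ϖ ^ m ∣ ϖ ^ (m + 1) := pow_dvd_pow ϖ (Nat.le_succ m)
    have h00 := hle.trans (hκ2 0 0)
    have h10 := hle.trans (hκ2 1 0)
    have h11 := hle.trans (hκ2 1 1)
    fin_cases i <;> fin_cases j <;> simp at h00 h10 h11 ⊢
    · exact h00
    · exact h10.mul_left _
    · exact h11
  · rw [mul_assoc, ← h3, h2, map_mul, map_mul, map_inv]
    simp [mul_assoc]

/-- Conjugation by `u_x α` maps a principal congruence subgroup to matrices which are upper
unipotent to the same level. -/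
lemma exists_unipSubgroup_mul_eq (ϖ : integralClosure ℤ_[p] F) (hϖ : Irreducible ϖ) {m : ℕ}
    (hm : m ≠ 0) {κ : GL (Fin 2) (integralClosure ℤ_[p] F)} (hκ : κ ∈ congrSubgroup ϖ m)
    (x : integralClosure ℤ_[p] F) :
    ∃ κ' ∈ unipSubgroup ϖ m, (intGL κ : GL (Fin 2) F) * (intGL (uGL x) * alphaGL ϖ hϖ) =
      intGL (uGL x) * alphaGL ϖ hϖ * intGL κ' := by
  have hκ2 : (uGL x)⁻¹ * κ * uGL x ∈ congrSubgroup ϖ m := by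
    have := (inferInstance : (congrSubgroup ϖ m).Normal).conj_mem κ hκ (uGL x)⁻¹
    simpa using this
  set κ₂ := (uGL x)⁻¹ * κ * uGL x with h2
  rw [mem_congrSubgroup_iff] at hκ2
  have h01 := hκ2 0 1
  simp only [Matrix.one_apply_ne (show (0 : Fin 2) ≠ 1 by decide), sub_zero] at h01
  obtain ⟨b, hb⟩ := (dvd_pow_self ϖ hm).trans h01
  obtain ⟨κ', h3, h4⟩ := exists_mul_alphaGL_eq ϖ hϖ (κ := κ₂) (b := b) hb
  refine ⟨κ', ?_, ?_⟩
  · rw [mem_unipSubgroup_iff, h4]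
    have h00 := hκ2 0 0
    have h10 := hκ2 1 0
    have h11 := hκ2 1 1
    simp at h00 h10 h11 ⊢
    exact ⟨h00, h10.mul_left _, h11⟩
  · rw [mul_assoc, ← h3, h2, map_mul, map_mul, map_inv]
    simp [mul_assoc]

variable [IsScalarTower ℤ_[p] ℚ_[p] F] [FiniteDimensional ℚ_[p] F]

lemma pow_dvd_iff_norm_le {ϖ : integralClosure ℤ_[p] F} (hϖ : Irreducible ϖ) (m : ℕ)
    (x : integralClosure ℤ_[p] F) : ϖ ^ m ∣ x ↔ ‖(x : F)‖ ≤ ‖(ϖ : F)‖ ^ m := by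
  have h0 := norm_uniformizer_pos hϖ
  constructor
  · rintro ⟨y, rfl⟩
    have := mem_integralClosure_iff_norm_le_one.1 y.2
    change ‖(ϖ : F) ^ m * y‖ ≤ _
    rw [norm_mul, norm_pow]
    exact mul_le_of_le_one_right (by positivity) this
  · intro h
    have h1 : (ϖ : F) ≠ 0 := norm_pos_iff.1 h0
    refine ⟨⟨(x : F) / ϖ ^ m, mem_integralClosure_iff_norm_le_one.2 ?_⟩, Subtype.ext ?_⟩
    · rw [norm_div, norm_pow]
      exact div_le_one_of_le₀ h (by positivity)
    · change (x : F) = ϖ ^ m * (x / ϖ ^ m)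
      field_simp

/-- The congruence subgroups are a basis of neighbourhoods of `1`. -/
lemma exists_congrSubgroup_subset {ϖ : integralClosure ℤ_[p] F} (hϖ : Irreducible ϖ)
    {U : Set (GL (Fin 2) F)} (hU : U ∈ nhds 1) :
    ∃ m, ∀ κ ∈ congrSubgroup ϖ m, (intGL κ : GL (Fin 2) F) ∈ U := by
  by_contra! hcon
  choose κ hκ hκU using hcon
  have key : ∀ κ : ℕ → GL (Fin 2) (integralClosure ℤ_[p] F), (∀ m, κ m ∈ congrSubgroup ϖ m) →
      Filter.Tendsto (fun m => ((intGL (κ m) : GL (Fin 2) F) : Matrix (Fin 2) (Fin 2) F))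
        Filter.atTop (nhds 1) := by
    intro κ hκ
    refine tendsto_pi_nhds.2 fun i => tendsto_pi_nhds.2 fun j => ?_
    rw [tendsto_iff_norm_sub_tendsto_zero]
    refine squeeze_zero (fun _ => norm_nonneg _) (g := fun m => ‖(ϖ : F)‖ ^ m) (fun m => ?_)
      (tendsto_pow_atTop_nhds_zero_of_lt_one (norm_nonneg _) (norm_uniformizer_lt_one hϖ))
    have h1 := (pow_dvd_iff_norm_le hϖ _ _).1 ((mem_congrSubgroup_iff.1 (hκ m)) i j)
    have e : ((κ m i j - (1 : Matrix (Fin 2) (Fin 2) (integralClosure ℤ_[p] F)) i j :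
        integralClosure ℤ_[p] F) : F) =
        (intGL (κ m) : GL (Fin 2) F) i j - (1 : Matrix (Fin 2) (Fin 2) F) i j := by
      rw [coe_intGL_apply, Matrix.one_apply, Matrix.one_apply]
      split_ifs <;> simp
    rw [e] at h1
    exact h1
  have hlim : Filter.Tendsto (fun m => (intGL (κ m) : GL (Fin 2) F)) Filter.atTop (nhds 1) := by
    rw [Units.isEmbedding_embedProduct.tendsto_nhds_iff]
    refine Filter.Tendsto.prodMk_nhds (key κ hκ) ?_
    have h2 := key (fun m => (κ m)⁻¹) fun m => inv_mem (hκ m)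
    have h3 := (MulOpposite.continuous_op.tendsto (1 : Matrix (Fin 2) (Fin 2) F)).comp h2
    simp only [map_inv] at h3
    exact h3
  obtain ⟨m, hm⟩ := (hlim.eventually hU).exists
  exact hκU m hm

lemma mem_map_unipSubgroup_iff {ϖ : integralClosure ℤ_[p] F} (hϖ : Irreducible ϖ) {m : ℕ}
    (hm : m ≠ 0) {h : GL (Fin 2) F} :
    h ∈ (unipSubgroup ϖ m).map ((groupZK p F).subtype.comp intGL) ↔
      ‖h 0 0 - 1‖ ≤ ‖(ϖ : F)‖ ^ m ∧ ‖h 1 0‖ ≤ ‖(ϖ : F)‖ ^ m ∧ ‖h 1 1 - 1‖ ≤ ‖(ϖ : F)‖ ^ m ∧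
        ‖h 0 1‖ ≤ 1 := by
  constructor
  · rintro ⟨κ, hκ, rfl⟩
    obtain ⟨h1, h2, h3⟩ := mem_unipSubgroup_iff.1 hκ
    rw [pow_dvd_iff_norm_le hϖ] at h1 h2 h3
    exact ⟨h1, h2, h3, mem_integralClosure_iff_norm_le_one.1 (κ 0 1).2⟩
  · rintro ⟨h1, h2, h3, h4⟩
    have hϖ1 : ‖(ϖ : F)‖ ^ m ≤ 1 := pow_le_one₀ (norm_nonneg _) (norm_uniformizer_lt_one hϖ).le
    have hO : ∀ {x : F}, ‖x‖ ≤ ‖(ϖ : F)‖ ^ m → x ∈ integralClosure ℤ_[p] F :=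
      fun hx => mem_integralClosure_iff_norm_le_one.2 (hx.trans hϖ1)
    have hO00 : h 0 0 ∈ integralClosure ℤ_[p] F := by
      have := add_mem (hO h1) (one_mem _)
      simpa using this
    have hO11 : h 1 1 ∈ integralClosure ℤ_[p] F := by
      have := add_mem (hO h3) (one_mem _)
      simpa using this
    let A : Matrix (Fin 2) (Fin 2) (integralClosure ℤ_[p] F) :=
      !![⟨h 0 0, hO00⟩, ⟨h 0 1, mem_integralClosure_iff_norm_le_one.2 h4⟩;
        ⟨h 1 0, hO h2⟩, ⟨h 1 1, hO11⟩]
    have d1 : ϖ ^ m ∣ A 0 0 - 1 := (pow_dvd_iff_norm_le hϖ _ _).2 h1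
    have d2 : ϖ ^ m ∣ A 1 0 := (pow_dvd_iff_norm_le hϖ _ _).2 h2
    have d3 : ϖ ^ m ∣ A 1 1 - 1 := (pow_dvd_iff_norm_le hϖ _ _).2 h3
    have hdet : IsUnit A.det := by
      by_contra hne
      have hmem : A.det ∈ IsLocalRing.maximalIdeal (integralClosure ℤ_[p] F) :=
        (IsLocalRing.mem_maximalIdeal _).2 hne
      rw [maximalIdeal_eq_span hϖ, Ideal.mem_span_singleton] at hmem
      have e1 := (dvd_pow_self ϖ hm).trans d1
      have e2 := (dvd_pow_self ϖ hm).trans d2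
      have e3 := (dvd_pow_self ϖ hm).trans d3
      have : ϖ ∣ 1 := by
        have e4 := dvd_sub (dvd_sub (dvd_sub hmem (e1.mul_right (A 1 1))) e3)
          (e2.mul_left (-A 0 1))
        rw [Matrix.det_fin_two] at e4
        convert e4 using 1
        ring
      exact hϖ.not_isUnit (isUnit_of_dvd_one this)
    refine ⟨Matrix.GeneralLinearGroup.mk'' A hdet, mem_unipSubgroup_iff.2 ⟨d1, d2, d3⟩, ?_⟩
    ext i j
    fin_cases i <;> fin_cases j <;> rfl

lemma isOpen_map_unipSubgroup {ϖ : integralClosure ℤ_[p] F} (hϖ : Irreducible ϖ) {m : ℕ}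
    (hm : m ≠ 0) :
    IsOpen ((unipSubgroup ϖ m).map ((groupZK p F).subtype.comp intGL) : Set (GL (Fin 2) F)) := by
  have := isUltrametricDist_of_finiteDimensional (p := p) (F := F)
  have hc : ∀ i j, Continuous fun h : GL (Fin 2) F => h i j := fun i j =>
    Units.continuous_val.matrix_elem i j
  have hb : ∀ (r : ℝ), r ≠ 0 → ∀ c : F, IsOpen {x : F | ‖x - c‖ ≤ r} := by
    intro r hr c
    have := IsUltrametricDist.isOpen_closedBall c hr
    convert this using 1
    ext x
    simp [dist_eq_norm]
  have h0 : ‖(ϖ : F)‖ ^ m ≠ 0 := (pow_pos (norm_uniformizer_pos hϖ) m).ne'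
  have h1 := (hb _ h0 1).preimage (hc 0 0)
  have h2 := (hb _ h0 0).preimage (hc 1 0)
  have h3 := (hb _ h0 1).preimage (hc 1 1)
  have h4 := (hb 1 one_ne_zero 0).preimage (hc 0 1)
  convert h1.inter (h2.inter (h3.inter h4)) using 1
  ext h
  rw [SetLike.mem_coe, mem_map_unipSubgroup_iff hϖ hm]
  simp

lemma map_unipSubgroup_le (ϖ : integralClosure ℤ_[p] F) (m : ℕ) :
    (unipSubgroup ϖ m).map ((groupZK p F).subtype.comp intGL) ≤ groupZK p F := by
  rintro _ ⟨κ, -, rfl⟩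
  exact (intGL κ).2

lemma isOpen_groupZK {ϖ : integralClosure ℤ_[p] F} (hϖ : Irreducible ϖ) :
    IsOpen (groupZK p F : Set (GL (Fin 2) F)) :=
  Subgroup.isOpen_mono (map_unipSubgroup_le ϖ 1) (isOpen_map_unipSubgroup hϖ one_ne_zero)

lemma isCompact_map_unipSubgroup {ϖ : integralClosure ℤ_[p] F} (hϖ : Irreducible ϖ) {m : ℕ}
    (hm : m ≠ 0) :
    IsCompact ((unipSubgroup ϖ m).map ((groupZK p F).subtype.comp intGL) :
      Set (GL (Fin 2) F)) := by
  let C : Set (Matrix (Fin 2) (Fin 2) F) :=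
    Set.pi Set.univ fun _ => Set.pi Set.univ fun _ => (integralClosure ℤ_[p] F : Set F)
  have hC : IsCompact C := isCompact_univ_pi fun _ => isCompact_univ_pi fun _ =>
    isCompact_integralClosure
  have hCC := hC.prod (hC.image MulOpposite.continuous_op)
  have hcomp := (Units.isClosedEmbedding_embedProduct
    (α := Matrix (Fin 2) (Fin 2) F)).isCompact_preimage hCC
  refine hcomp.of_isClosed_subset
    (Subgroup.isClosed_of_isOpen _ (isOpen_map_unipSubgroup hϖ hm)) ?_
  rintro _ ⟨κ, -, rfl⟩
  refine ⟨fun i _ j _ => (κ i j).2, _, fun i _ j _ => ((κ⁻¹) i j).2, ?_⟩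
  change _ = MulOpposite.op (((intGL κ)⁻¹ : groupZK p F) : GL (Fin 2) F).val
  rw [← map_inv]
  rfl

end Congruence

/-! ### Smooth irreducible representations of `𝒦` -/

section Weights

variable {p : ℕ} [Fact p.Prime] {F : Type*} [NormedField F] [NormedAlgebra ℚ_[p] F]
  [Algebra ℤ_[p] F]

/-- Raising to the power `p` increases the level of a congruence subgroup. -/
lemma pow_mem_congrSubgroup {ϖ : integralClosure ℤ_[p] F} (hp : ϖ ∣ (p : integralClosure ℤ_[p] F))
    {n : ℕ} (hn : n ≠ 0) {κ : GL (Fin 2) (integralClosure ℤ_[p] F)}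
    (hκ : κ ∈ congrSubgroup ϖ n) : κ ^ p ∈ congrSubgroup ϖ (n + 1) := by
  have hp2 := (Fact.out : p.Prime).two_le
  rw [mem_congrSubgroup_iff] at hκ ⊢
  choose B hB using hκ
  let B' : Matrix (Fin 2) (Fin 2) (integralClosure ℤ_[p] F) := B
  have e : (κ : Matrix (Fin 2) (Fin 2) (integralClosure ℤ_[p] F)) = ϖ ^ n • B' + 1 := by
    ext1 i j
    rw [Matrix.add_apply, Matrix.smul_apply, smul_eq_mul]
    exact (sub_eq_iff_eq_add.1 (hB i j))
  obtain ⟨c, hc⟩ := hp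
  obtain ⟨m, hm⟩ : ∃ m, n * p = (n + 1) + m :=
    Nat.exists_eq_add_of_le (by nlinarith [Nat.pos_of_ne_zero hn])
  intro i j
  have h1 : ((κ ^ p : GL (Fin 2) (integralClosure ℤ_[p] F)) :
      Matrix (Fin 2) (Fin 2) (integralClosure ℤ_[p] F)) =
      1 + ϖ ^ (n + 1) • (ϖ ^ m • B' ^ p + c • (B' * ∑ k ∈ Finset.Ioo 0 p,
        (ϖ ^ n • B') ^ (k - 1) * 1 ^ (p - k - 1) *
          ((p.choose k / p : ℕ) : Matrix (Fin 2) (Fin 2) (integralClosure ℤ_[p] F)))) := by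
    rw [Units.val_pow_eq_pow_val, e,
      (Commute.one_right (ϖ ^ n • B')).add_pow_prime_eq (Fact.out : p.Prime)]
    have h2 : (p : Matrix (Fin 2) (Fin 2) (integralClosure ℤ_[p] F)) =
        (ϖ * c) • (1 : Matrix (Fin 2) (Fin 2) (integralClosure ℤ_[p] F)) := by
      rw [← hc, Nat.cast_smul_eq_nsmul, nsmul_one]
    rw [h2]
    generalize ∑ k ∈ Finset.Ioo 0 p, (ϖ ^ n • B') ^ (k - 1) * 1 ^ (p - k - 1) *
          ((p.choose k / p : ℕ) : Matrix (Fin 2) (Fin 2) (integralClosure ℤ_[p] F)) = S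
    rw [smul_pow, ← pow_mul, hm, one_pow, smul_mul_assoc, one_mul, mul_one, smul_mul_assoc,
      smul_mul_assoc, smul_add, smul_smul, smul_smul, smul_smul, ← pow_add,
      show ϖ ^ (n + 1) * c = ϖ * c * ϖ ^ n by ring]
    abel
  rw [h1, Matrix.add_apply, Matrix.smul_apply, add_sub_cancel_left]
  exact dvd_mul_right _ _

variable {k V : Type*} [Field k] [AddCommGroup V] [Module k V]
  {σ : Representation k (groupZK p F) V}

lemma nontrivial_of_isIrreducible (hirr : σ.IsIrreducible) : Nontrivial V := by
  by_contra h
  rw [not_nontrivial_iff_subsingleton] at h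
  obtain ⟨a, b, hab⟩ := (hirr.toNontrivial).exists_pair_ne
  exact hab (SetLike.ext fun x => by
    rw [Subsingleton.elim x 0]
    exact ⟨fun _ => b.toSubmodule.zero_mem, fun _ => a.toSubmodule.zero_mem⟩)

lemma eq_bot_or_eq_top_of_isIrreducible (hirr : σ.IsIrreducible) (W : Submodule k V)
    (hW : ∀ h, ∀ x ∈ W, σ h x ∈ W) : W = ⊥ ∨ W = ⊤ := by
  rcases hirr.eq_bot_or_eq_top (⟨W, fun h x hx => hW h x hx⟩ : Subrepresentation σ) with h | h
  · exact Or.inl (congrArg Subrepresentation.toSubmodule h)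
  · exact Or.inr (congrArg Subrepresentation.toSubmodule h)

/-- If a congruence subgroup has a nonzero fixed vector then it acts trivially. -/
lemma congrSubgroup_acts_trivially (hirr : σ.IsIrreducible) {ϖ : integralClosure ℤ_[p] F} {m : ℕ}
    {v : V} (hv : v ≠ 0) (hfix : ∀ κ ∈ congrSubgroup ϖ m, σ (intGL κ) v = v) :
    ∀ κ ∈ congrSubgroup ϖ m, σ (intGL κ) = 1 := by
  let W : Submodule k V := ⨅ κ : congrSubgroup ϖ m, LinearMap.ker (σ (intGL κ.1) - 1)
  have hmem : ∀ x, x ∈ W ↔ ∀ κ ∈ congrSubgroup ϖ m, σ (intGL κ) x = x := by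
    intro x
    simp [W, Submodule.mem_iInf, sub_eq_zero]
  have hW : ∀ h, ∀ x ∈ W, σ h x ∈ W := by
    intro h x hx
    rw [hmem] at hx ⊢
    intro κ hκ
    obtain ⟨c, κ', rfl⟩ := exists_eq_scalarZK_mul_intGL h
    have h1 : κ'⁻¹ * κ * κ' ∈ congrSubgroup ϖ m := by
      have := (inferInstance : (congrSubgroup ϖ m).Normal).conj_mem κ hκ κ'⁻¹
      simpa using this
    have h2 : intGL κ * (scalarZK p c * intGL κ') =
        scalarZK p c * intGL κ' * intGL (κ'⁻¹ * κ * κ') := by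
      rw [← mul_assoc, ← scalarZK_mul, mul_assoc, mul_assoc, ← map_mul, ← map_mul]
      congr 2
      group
    rw [← Module.End.mul_apply, ← map_mul, h2, map_mul, Module.End.mul_apply, hx _ h1]
  rcases eq_bot_or_eq_top_of_isIrreducible hirr W hW with h | h
  · have : v ∈ W := (hmem v).2 hfix
    rw [h, Submodule.mem_bot] at this
    exact absurd this hv
  · intro κ hκ
    ext x
    exact (hmem x).1 (h ▸ Submodule.mem_top) κ hκ

variable [IsScalarTower ℤ_[p] ℚ_[p] F] [FiniteDimensional ℚ_[p] F]

/-- The congruence subgroup of level `ϖ` acts trivially: it acts through a finite `p`-group, so it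
has a nonzero fixed vector. -/
theorem intGL_eq_one_of_mem_congrSubgroup [CharP k p] (hσ : IsSmoothRep σ)
    (hirr : σ.IsIrreducible) {ϖ : integralClosure ℤ_[p] F} (hϖ : Irreducible ϖ)
    [Finite (integralClosure ℤ_[p] F ⧸ (Ideal.span {ϖ} : Ideal (integralClosure ℤ_[p] F)))] :
    ∀ κ ∈ congrSubgroup ϖ 1, σ (intGL κ) = 1 := by
  have := nontrivial_of_isIrreducible hirr
  obtain ⟨v, hv⟩ := exists_ne (0 : V)
  obtain ⟨m, hm⟩ : ∃ m, ∀ κ ∈ congrSubgroup ϖ m, σ (intGL κ) v = v := by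
    obtain ⟨U, hU, hUeq⟩ := isOpen_induced_iff.1 (hσ v)
    have h1 : (1 : GL (Fin 2) F) ∈ U := by
      have : (1 : groupZK p F) ∈ Subtype.val ⁻¹' U := by rw [hUeq]; simp
      exact this
    obtain ⟨m, hm⟩ := exists_congrSubgroup_subset hϖ (hU.mem_nhds h1)
    refine ⟨m, fun κ hκ => ?_⟩
    have : intGL κ ∈ Subtype.val ⁻¹' U := hm κ hκ
    rw [hUeq] at this
    exact this
  have htriv := congrSubgroup_acts_trivially hirr hv hm
  have hpdvd : ϖ ∣ (p : integralClosure ℤ_[p] F) :=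
    Ideal.mem_span_singleton.1 (natCast_mem_span_uniformizer hϖ)
  obtain ⟨w, hw, hwfix⟩ := exists_fixed_vector_of_pow_eq_one p
    (σ.comp (intGL.comp (congrSubgroup ϖ 1).subtype)) hv (by
      have hfin : Finite (integralClosure ℤ_[p] F ⧸
          (Ideal.span {ϖ ^ m} : Ideal (integralClosure ℤ_[p] F))) := by
        rw [← Ideal.span_singleton_pow]
        exact Ideal.finite_quotient_pow (IsNoetherian.noetherian _) m
      let q := Matrix.GeneralLinearGroup.map (n := Fin 2)
        (Ideal.Quotient.mk (Ideal.span {ϖ ^ m} : Ideal (integralClosure ℤ_[p] F)))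
      let f : GL (Fin 2) (integralClosure ℤ_[p] F) → V := fun κ => σ (intGL κ) v
      have hfac : f.FactorsThrough q := by
        intro κ κ' h
        have h1 : κ⁻¹ * κ' ∈ congrSubgroup ϖ m := by
          rw [congrSubgroup, MonoidHom.mem_ker, map_mul, map_inv]
          exact inv_mul_eq_one.2 h
        have h2 := htriv _ h1
        change σ (intGL κ) v = σ (intGL κ') v
        rw [show κ' = κ * (κ⁻¹ * κ') by group, map_mul, map_mul, h2, mul_one]
      refine (Set.finite_range (Function.extend q f 0)).subset ?_
      rintro _ ⟨κ, rfl⟩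
      exact ⟨q κ.1, hfac.extend_apply 0 κ.1⟩) (by
      intro κ
      refine ⟨m, htriv _ ?_⟩
      have h1 : ∀ j, κ.1 ^ p ^ j ∈ congrSubgroup ϖ (j + 1) := by
        intro j
        induction j with
        | zero => simp
        | succ j ih =>
          rw [pow_succ, pow_mul]
          exact pow_mem_congrSubgroup hpdvd (Nat.succ_ne_zero j) ih
      exact congrSubgroup_mono ϖ (Nat.le_succ m) (h1 m))
  exact congrSubgroup_acts_trivially hirr hw fun κ hκ => hwfix ⟨κ, hκ⟩

variable {𝔽 : Type*} [Field 𝔽] [Fintype 𝔽] {L : Type*} [CommRing L] [Algebra k L] [Module L V]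
  [IsScalarTower k L V]

/-- A description of the representation `σ` of `𝒦`: its restriction to `GL₂(𝒪_F)` is inflated from
the residue field `𝔽` along `π`, and has the basis `g` of monomials over a ring `L` of scalars
generated by the action of the centre. -/
structure IsWeight (σ : Representation k (groupZK p F) V) (π : integralClosure ℤ_[p] F →+* 𝔽)
    (τ : 𝔽 →+* k) (ρ : Representation L (GL (Fin 2) 𝔽) V) (r : ℕ) (ε : L) (g : ℕ → V) : Prop where
  map_smul_of_commute : ∀ Ψ : Module.End k V,
    (∀ c x, Ψ (σ (scalarZK p c) x) = σ (scalarZK p c) (Ψ x)) → ∀ (l : L) x, Ψ (l • x) = l • Ψ x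
  exists_smul : ∀ c, ∃ l : L, ∀ x, σ (scalarZK p c) x = l • x
  torsionFree : ∀ (l : L) (x : V), l • x = 0 → l = 0 ∨ x = 0
  map_apply : ∀ κ x, ρ (Matrix.GeneralLinearGroup.map π κ) x = σ (intGL κ) x
  monomial : IsMonomialFamily ((algebraMap k L).comp τ) p ρ r ε g

/-- The subalgebra of `End V` generated by the action of the centre is a domain by Schur's lemma. -/
lemma exists_central_scalars (hirr : σ.IsIrreducible) :
    ∃ A : Subalgebra k (Module.End k V), IsMulCommutative A ∧
      (∀ Ψ : Module.End k V, (∀ c x, Ψ (σ (scalarZK p c) x) = σ (scalarZK p c) (Ψ x)) →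
        ∀ (l : A) x, Ψ (l • x) = l • Ψ x) ∧
      (∀ c, ∃ l : A, ∀ x, σ (scalarZK p c) x = l • x) ∧
      (∀ (l : A) (x : V), l • x = 0 → l = 0 ∨ x = 0) := by
  let s : Set (Module.End k V) := Set.range fun c => σ (scalarZK p c)
  have h1 : ∀ Ψ : Module.End k V, (∀ c x, Ψ (σ (scalarZK p c) x) = σ (scalarZK p c) (Ψ x)) →
        ∀ (l : Algebra.adjoin k s) x, Ψ (l • x) = l • Ψ x := by
    intro Ψ hΨ l x
    have hle : Algebra.adjoin k s ≤ Subalgebra.centralizer k {Ψ} := by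
      rw [Algebra.adjoin_le_iff]
      rintro _ ⟨c, rfl⟩
      rw [SetLike.mem_coe, Subalgebra.mem_centralizer_iff]
      rintro _ rfl
      ext x
      exact hΨ c x
    have := (Subalgebra.mem_centralizer_iff k).1 (hle l.2) Ψ rfl
    exact congrArg (fun f : Module.End k V => f x) this
  refine ⟨Algebra.adjoin k s, ?_, h1, ?_, ?_⟩
  · refine Algebra.isMulCommutative_adjoin k ?_
    rintro _ ⟨c, rfl⟩ _ ⟨d, rfl⟩
    rw [← map_mul, scalarZK_mul, map_mul]
  · exact fun c => ⟨⟨σ (scalarZK p c), Algebra.subset_adjoin ⟨c, rfl⟩⟩, fun x => rfl⟩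
  · intro l x hx
    have hcomm : ∀ h y, σ h (l • y) = l • σ h y := fun h => h1 (σ h) (fun c y => by
      rw [← Module.End.mul_apply, ← map_mul, ← scalarZK_mul, map_mul, Module.End.mul_apply]) l
    rcases eq_bot_or_eq_top_of_isIrreducible hirr (LinearMap.ker l.1) (by
      intro h y hy
      have : l • y = 0 := hy
      change l • σ h y = 0
      rw [← hcomm, this, map_zero]) with h | h
    · right
      have : x ∈ LinearMap.ker l.1 := hx
      rwa [h] at this
    · left
      exact Subtype.ext (LinearMap.ker_eq_top.1 h)

lemma surjective_map_of_isLocalRing {R : Type*} [CommRing R] [IsLocalRing R] {π : R →+* 𝔽}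
    (hπ : Function.Surjective π) :
    Function.Surjective (Matrix.GeneralLinearGroup.map (n := Fin 2) π) := by
  have hunit : ∀ a : 𝔽ˣ, ∃ b : Rˣ, Units.map π b = a := by
    intro a
    obtain ⟨b, hb⟩ := hπ a
    have : IsLocalHom π := IsLocalHom.of_surjective π hπ
    have h1 : IsUnit b := isUnit_of_map_unit π b (by rw [hb]; exact a.isUnit)
    exact ⟨h1.unit, Units.ext hb⟩
  intro y
  induction y using gl2_induction with
  | hu x =>
    obtain ⟨x, rfl⟩ := hπ x
    exact ⟨uGL x, map_uGL π x⟩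
  | hw => exact ⟨wGL R, map_wGL π⟩
  | hd a d =>
    obtain ⟨a, rfl⟩ := hunit a
    obtain ⟨d, rfl⟩ := hunit d
    exact ⟨dGL a d, map_dGL π a d⟩
  | hmul y z hy hz =>
    obtain ⟨y, rfl⟩ := hy
    obtain ⟨z, rfl⟩ := hz
    exact ⟨y * z, map_mul _ _ _⟩

lemma exists_lift_of_surjective {G₁ G₂ M : Type*} [Group G₁] [Group G₂] [Monoid M] {f : G₁ →* G₂}
    (hf : Function.Surjective f) {φ : G₁ →* M} (h : f.ker ≤ φ.ker) :
    ∃ ψ : G₂ →* M, ∀ x, ψ (f x) = φ x := by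
  have key : ∀ x y, f x = f y → φ x = φ y := by
    intro x y hxy
    have h1 : φ (x⁻¹ * y) = 1 := h (by rw [MonoidHom.mem_ker, map_mul, map_inv, hxy]; simp)
    rw [show y = x * (x⁻¹ * y) by group, map_mul, h1, mul_one]
  have h2 : ∀ x, φ (Function.surjInv hf (f x)) = φ x := fun x =>
    key _ _ (Function.surjInv_eq hf _)
  refine ⟨{ toFun := fun y => φ (Function.surjInv hf y), map_one' := ?_, map_mul' := ?_ }, h2⟩
  · rw [← map_one f, h2, map_one]
  · intro a b
    obtain ⟨a, rfl⟩ := hf a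
    obtain ⟨b, rfl⟩ := hf b
    rw [← map_mul, h2, h2, h2, map_mul]

/-- The restriction of `σ` to `GL₂(𝒪_F)` factors through the residue field. -/
lemma exists_inflation [CharP k p] (hσ : IsSmoothRep σ) (hirr : σ.IsIrreducible)
    {ϖ : integralClosure ℤ_[p] F} (hϖ : Irreducible ϖ)
    [Finite (integralClosure ℤ_[p] F ⧸ (Ideal.span {ϖ} : Ideal (integralClosure ℤ_[p] F)))]
    {π : integralClosure ℤ_[p] F →+* 𝔽} (hsurj : Function.Surjective π)
    (hπ : ∀ x, π x = 0 ↔ ϖ ∣ x)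
    (hlin : ∀ Ψ : Module.End k V, (∀ c x, Ψ (σ (scalarZK p c) x) = σ (scalarZK p c) (Ψ x)) →
      ∀ (l : L) x, Ψ (l • x) = l • Ψ x) :
    ∃ ρ : Representation L (GL (Fin 2) 𝔽) V,
      ∀ κ x, ρ (Matrix.GeneralLinearGroup.map π κ) x = σ (intGL κ) x := by
  have hσlin : ∀ h (l : L) x, σ h (l • x) = l • σ h x := fun h => hlin (σ h) fun c y => by
    rw [← Module.End.mul_apply, ← map_mul, ← scalarZK_mul, map_mul, Module.End.mul_apply]
  let σA : GL (Fin 2) (integralClosure ℤ_[p] F) →* Module.End L V :=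
    { toFun := fun κ =>
        { toFun := σ (intGL κ)
          map_add' := map_add _
          map_smul' := hσlin _ }
      map_one' := by ext x; simp
      map_mul' := fun κ κ' => by ext x; simp }
  have hsurj2 := surjective_map_of_isLocalRing hsurj
  have hker : (Matrix.GeneralLinearGroup.map (n := Fin 2) π).ker ≤ σA.ker := by
    intro κ hκ
    have h1 : κ ∈ congrSubgroup ϖ 1 := by
      rw [mem_congrSubgroup_iff]
      intro i j
      have h2 := (Matrix.GeneralLinearGroup.ext_iff _ _).1 (MonoidHom.mem_ker.1 hκ) i j
      rw [pow_one, ← hπ, map_sub, sub_eq_zero, ← Matrix.GeneralLinearGroup.map_apply, h2,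
        Matrix.GeneralLinearGroup.coe_one, Matrix.one_apply, Matrix.one_apply]
      split_ifs <;> simp
    have h3 := intGL_eq_one_of_mem_congrSubgroup hσ hirr hϖ κ h1
    rw [MonoidHom.mem_ker]
    ext x
    exact congrArg (fun f : Module.End k V => f x) h3
  obtain ⟨ρ, hρ⟩ := exists_lift_of_surjective hsurj2 hker
  exact ⟨ρ, fun κ x => congrArg (fun f : Module.End L V => f x) (hρ κ)⟩

/-- A smooth irreducible representation of `𝒦` in the residue characteristic has a basis of
monomials over the scalars generated by the action of the centre. -/
theorem exists_isWeight [CharP k p] (hσ : IsSmoothRep σ) (hirr : σ.IsIrreducible)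
    {ϖ : integralClosure ℤ_[p] F} (hϖ : Irreducible ϖ)
    [Finite (integralClosure ℤ_[p] F ⧸ (Ideal.span {ϖ} : Ideal (integralClosure ℤ_[p] F)))]
    {π : integralClosure ℤ_[p] F →+* 𝔽} (hsurj : Function.Surjective π)
    (hπ : ∀ x, π x = 0 ↔ ϖ ∣ x) (τ : 𝔽 →+* k)
    (hlin : ∀ Ψ : Module.End k V, (∀ c x, Ψ (σ (scalarZK p c) x) = σ (scalarZK p c) (Ψ x)) →
      ∀ (l : L) x, Ψ (l • x) = l • Ψ x)
    (hsm : ∀ c, ∃ l : L, ∀ x, σ (scalarZK p c) x = l • x)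
    (htf : ∀ (l : L) (x : V), l • x = 0 → l = 0 ∨ x = 0) :
    ∃ (ρ : Representation L (GL (Fin 2) 𝔽) V) (r : ℕ) (ε : L) (g : ℕ → V),
      IsWeight σ π τ ρ r ε g := by
  have := nontrivial_of_isIrreducible hirr
  obtain ⟨ρ, hρ⟩ := exists_inflation hσ hirr hϖ hsurj hπ hlin
  have : Nontrivial L := by
    by_contra h
    rw [not_nontrivial_iff_subsingleton] at h
    obtain ⟨x, hx⟩ := exists_ne (0 : V)
    exact hx (by rw [← one_smul L x, Subsingleton.elim (1 : L) 0, zero_smul])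
  have : CharP L p := charP_of_injective_algebraMap (algebraMap k L).injective p
  have : CharP 𝔽 p := (RingHom.charP_iff τ τ.injective p).2 inferInstance
  obtain ⟨r, ε, g, hg⟩ := exists_isMonomialFamily ((algebraMap k L).comp τ) p ρ htf (by
    intro W hW
    have hstab : ∀ h, ∀ x ∈ W.restrictScalars k, σ h x ∈ W.restrictScalars k := by
      intro h x hx
      obtain ⟨c, κ, rfl⟩ := exists_eq_scalarZK_mul_intGL h
      obtain ⟨l, hl⟩ := hsm c
      rw [map_mul, Module.End.mul_apply, hl, ← hρ]
      exact W.smul_mem l (hW _ x hx)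
    rcases eq_bot_or_eq_top_of_isIrreducible hirr (W.restrictScalars k) hstab with h | h
    · left
      exact (Submodule.restrictScalars_eq_bot_iff k L V).1 h
    · right
      exact (Submodule.restrictScalars_eq_top_iff k L V).1 h)
  exact ⟨ρ, r, ε, g, hlin, hsm, htf, hρ, hg⟩

end Weights

/-! ### Compact induction -/

section CompactInductionLemmas

variable {k G V : Type*} [Field k] [Group G] [TopologicalSpace G] [IsTopologicalGroup G]
  [AddCommGroup V] [Module k V] {H : Subgroup G} {σ : Representation k H V}

lemma compactInd_apply_mul (f : compactInd σ) (g : G) (h : H) : f.1 (g * h) = σ h⁻¹ (f.1 g) :=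
  f.2.1 g h

lemma compactIndRep_apply (x : G) (f : compactInd σ) (g : G) :
    (compactIndRep σ x f).1 g = f.1 (x⁻¹ * g) := rfl

lemma compactIndSingle_apply_of_mem {g x : G} (h : x⁻¹ * g ∈ H) (v : V) :
    (compactIndSingle σ g v).1 x = σ ⟨x⁻¹ * g, h⟩ v := dif_pos h

lemma compactIndSingle_apply_of_notMem {g x : G} (h : x⁻¹ * g ∉ H) (v : V) :
    (compactIndSingle σ g v).1 x = 0 := dif_neg h

lemma compactIndSingle_apply_self (g : G) (v : V) : (compactIndSingle σ g v).1 g = v := by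
  have h : g⁻¹ * g ∈ H := by rw [inv_mul_cancel]; exact H.one_mem
  rw [compactIndSingle_apply_of_mem h]
  have : (⟨g⁻¹ * g, h⟩ : H) = 1 := Subtype.ext (inv_mul_cancel g)
  rw [this, map_one, Module.End.one_apply]

lemma compactIndRep_single (x g : G) (v : V) :
    compactIndRep σ x (compactIndSingle σ g v) = compactIndSingle σ (x * g) v := by
  refine Subtype.ext (funext fun y => ?_)
  rw [compactIndRep_apply]
  have e : (x⁻¹ * y)⁻¹ * g = y⁻¹ * (x * g) := by group
  by_cases h : y⁻¹ * (x * g) ∈ H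
  · rw [compactIndSingle_apply_of_mem h, compactIndSingle_apply_of_mem (e ▸ h)]
    congr 2
    exact Subtype.ext e
  · rw [compactIndSingle_apply_of_notMem h, compactIndSingle_apply_of_notMem (e ▸ h)]

lemma compactIndSingle_mul (g : G) (h : H) (v : V) :
    compactIndSingle σ (g * h) v = compactIndSingle σ g (σ h v) := by
  refine Subtype.ext (funext fun y => ?_)
  have e : y⁻¹ * (g * h) = y⁻¹ * g * h := by group
  by_cases hy : y⁻¹ * g ∈ H
  · have hy' : y⁻¹ * (g * h) ∈ H := e ▸ H.mul_mem hy h.2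
    rw [compactIndSingle_apply_of_mem hy, compactIndSingle_apply_of_mem hy',
      ← Module.End.mul_apply, ← map_mul]
    congr 2
    exact Subtype.ext e
  · have hy' : y⁻¹ * (g * h) ∉ H := fun hm => hy ((H.mul_mem_cancel_right h.2).1 (e ▸ hm))
    rw [compactIndSingle_apply_of_notMem hy, compactIndSingle_apply_of_notMem hy']

/-- If `H` is open, then the compact induction is generated by the functions supported on one
coset. -/
lemma compactInd_induction (hH : IsOpen (H : Set G)) {P : compactInd σ → Prop} (h0 : P 0)
    (hadd : ∀ f f', P f → P f' → P (f + f')) (hs : ∀ g v, P (compactIndSingle σ g v))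
    (f : compactInd σ) : P f := by
  classical
  have key : ∀ (s : Finset G) (f : compactInd σ),
      (∀ x, f.1 x ≠ 0 → ∃ g ∈ s, x⁻¹ * g ∈ H) → P f := by
    intro s
    induction s using Finset.induction_on with
    | empty =>
      intro f hf
      have : f = 0 := Subtype.ext (funext fun x => by_contra fun hx => by simpa using hf x hx)
      exact this ▸ h0
    | insert g s _ ih =>
      intro f hf
      have e : f = (f - compactIndSingle σ g (f.1 g)) + compactIndSingle σ g (f.1 g) := by abel
      rw [e]
      refine hadd _ _ (ih _ fun x hx => ?_) (hs _ _)
      by_cases hxg : x⁻¹ * g ∈ H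
      · refine absurd ?_ hx
        change f.1 x - (compactIndSingle σ g (f.1 g)).1 x = 0
        have := compactInd_apply_mul f x ⟨x⁻¹ * g, hxg⟩
        rw [mul_inv_cancel_left] at this
        rw [compactIndSingle_apply_of_mem hxg, this, ← Module.End.mul_apply, ← map_mul,
          mul_inv_cancel, map_one, Module.End.one_apply, sub_self]
      · have hx' : f.1 x ≠ 0 := by
          change f.1 x - (compactIndSingle σ g (f.1 g)).1 x ≠ 0 at hx
          rwa [compactIndSingle_apply_of_notMem hxg, sub_zero] at hx
        obtain ⟨g', hg', h'⟩ := hf x hx'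
        rcases Finset.mem_insert.1 hg' with rfl | hg'
        · exact absurd h' hxg
        · exact ⟨g', hg', h'⟩
  obtain ⟨C, hC, hsub⟩ := f.2.2
  obtain ⟨t, ht⟩ := hC.elim_finite_subcover (fun g : G => g • (H : Set G))
    (fun g => hH.smul g) (fun c _ => Set.mem_iUnion.2 ⟨c, 1, H.one_mem, mul_one c⟩)
  refine key t f fun x hx => ?_
  obtain ⟨c, hc, h, hh, e⟩ := hsub hx
  obtain ⟨g, hg⟩ := Set.mem_iUnion.1 (ht hc)
  obtain ⟨hgt, h', hh', e'⟩ := Set.mem_iUnion.1 hg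
  refine ⟨g, hgt, ?_⟩
  simp only [smul_eq_mul] at e e'
  rw [← e, ← e']
  have : (g * h' * h)⁻¹ * g = h⁻¹ * h'⁻¹ := by group
  rw [this]
  exact H.mul_mem (H.inv_mem hh) (H.inv_mem hh')

variable (T : Representation.IntertwiningMap (compactIndRep σ) (compactIndRep σ))

lemma intertwining_apply_single (g x : G) (v : V) :
    (T (compactIndSingle σ g v)).1 x = heckeFunction T (x⁻¹ * g) v := by
  have h1 : compactIndSingle σ g v = compactIndRep σ g (compactIndSingle σ 1 v) := by
    rw [compactIndRep_single, mul_one]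
  rw [h1, Representation.IntertwiningMap.isIntertwining, compactIndRep_apply]
  change _ = (T (compactIndSingle σ 1 v)).1 (x⁻¹ * g)⁻¹
  group

lemma heckeFunction_mul_left (h : H) (g : G) (v : V) :
    heckeFunction T (h * g) v = σ h (heckeFunction T g v) := by
  change (T (compactIndSingle σ 1 v)).1 (h * g)⁻¹ = σ h ((T (compactIndSingle σ 1 v)).1 g⁻¹)
  have := compactInd_apply_mul (T (compactIndSingle σ 1 v)) g⁻¹ h⁻¹
  rw [inv_inv] at this
  rw [← this, mul_inv_rev]
  rfl

lemma heckeFunction_mul_right (g : G) (h : H) (v : V) :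
    heckeFunction T (g * h) v = heckeFunction T g (σ h v) := by
  have h1 := intertwining_apply_single T (h : G) g⁻¹ v
  rw [inv_inv] at h1
  rw [← h1]
  have h2 := compactIndSingle_mul (σ := σ) 1 h v
  rw [one_mul] at h2
  rw [h2, intertwining_apply_single, inv_inv, mul_one]

end CompactInductionLemmas

/-! ### The Hecke operator of the double coset of `α` -/

section Hecke

variable {p : ℕ} [Fact p.Prime] {F : Type*} [NormedField F] [NormedAlgebra ℚ_[p] F]
  [Algebra ℤ_[p] F] {k V : Type*} [Field k] [AddCommGroup V] [Module k V]
  (σ : Representation k (groupZK p F) V)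
  (ϖ : integralClosure ℤ_[p] F) (hϖ : Irreducible ϖ) {𝔽 : Type*} [Field 𝔽] [Fintype 𝔽]

/-- The representative `u_x α` of a coset of `𝒦` in `𝒦 α 𝒦`. -/
noncomputable def uAlpha (x : integralClosure ℤ_[p] F) : GL (Fin 2) F :=
  intGL (uGL x) * alphaGL ϖ hϖ

/-- The representative `w α` of a coset of `𝒦` in `𝒦 α 𝒦`. -/
noncomputable def wAlpha : GL (Fin 2) F :=
  intGL (wGL (integralClosure ℤ_[p] F)) * alphaGL ϖ hϖ

lemma uGL_mul_uAlpha (a x : integralClosure ℤ_[p] F) :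
    (intGL (uGL a) : GL (Fin 2) F) * uAlpha ϖ hϖ x = uAlpha ϖ hϖ (a + x) := by
  rw [uAlpha, uAlpha, uGL_add, map_mul, Subgroup.coe_mul, mul_assoc]

lemma uAlpha_add_mul (x c : integralClosure ℤ_[p] F) :
    uAlpha ϖ hϖ (x + ϖ * c) = uAlpha ϖ hϖ x * intGL (uGL c) := by
  have := alphaGL_pow_mul_uGL ϖ hϖ 1 (c : F)
  rw [pow_one, pow_one] at this
  rw [uAlpha, uAlpha, uGL_add, map_mul, Subgroup.coe_mul, mul_assoc, mul_assoc, coe_intGL_uGL c,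
    this, coe_intGL_uGL (ϖ * c)]
  rfl

/-- The convolution of `f` with the function on `𝒦 α 𝒦` whose value at `α` is `Ψ`: a sum over
the cosets in `𝒦 α 𝒦`. -/
noncomputable def heckeSum (rep : 𝔽 → integralClosure ℤ_[p] F) (Ψ : Module.End k V)
    (f : GL (Fin 2) F → V) (x : GL (Fin 2) F) : V :=
  ∑ a, σ (intGL (uGL (rep a))) (Ψ (f (x * uAlpha ϖ hϖ (rep a)))) +
    σ (intGL (wGL _)) (Ψ (f (x * wAlpha ϖ hϖ)))

variable [IsScalarTower ℤ_[p] ℚ_[p] F] [FiniteDimensional ℚ_[p] F]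
  {π : integralClosure ℤ_[p] F →+* 𝔽} {rep : 𝔽 → integralClosure ℤ_[p] F}

variable {ϖ}

lemma dvd_of_uAlpha_mem {x y : integralClosure ℤ_[p] F}
    (h : (uAlpha ϖ hϖ x)⁻¹ * uAlpha ϖ hϖ y ∈ groupZK p F) : ϖ ∣ y - x := by
  have := (eq_of_alphaGL_pow_mem ϖ hϖ (x := (x : F)) (y := (y : F)) (m := 1) (n := 1) (by
    rw [pow_one, ← coe_intGL_uGL, ← coe_intGL_uGL]; exact h)).2
  rw [← pow_one ϖ, pow_dvd_iff_norm_le hϖ]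
  exact this

lemma uAlpha_wAlpha_notMem (x : integralClosure ℤ_[p] F) :
    (uAlpha ϖ hϖ x)⁻¹ * wAlpha ϖ hϖ ∉ groupZK p F := wGL_coset_notMem ϖ hϖ x

lemma wAlpha_uAlpha_notMem (x : integralClosure ℤ_[p] F) :
    (wAlpha ϖ hϖ)⁻¹ * uAlpha ϖ hϖ x ∉ groupZK p F := fun h =>
  uAlpha_wAlpha_notMem hϖ x (by
    have := (groupZK p F).inv_mem h
    rwa [mul_inv_rev, inv_inv] at this)

lemma eq_of_uAlpha_rep_mem (hπ : ∀ x, π x = 0 ↔ ϖ ∣ x) (hrep : ∀ x, π (rep x) = x) {a b : 𝔽}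
    (h : (uAlpha ϖ hϖ (rep a))⁻¹ * uAlpha ϖ hϖ (rep b) ∈ groupZK p F) : b = a := by
  have := (hπ _).2 (dvd_of_uAlpha_mem hϖ h)
  rwa [map_sub, hrep, hrep, sub_eq_zero] at this

/-- The Hecke operator defined by a function on `𝒦 α 𝒦` is given by `heckeSum`. -/
lemma apply_eq_heckeSum (hπ : ∀ x, π x = 0 ↔ ϖ ∣ x) (hrep : ∀ x, π (rep x) = x)
    (T : Representation.IntertwiningMap (compactIndRep σ) (compactIndRep σ))
    (hT : Function.support (heckeFunction T) ⊆ DoubleCoset.doubleCoset (alphaGL ϖ hϖ)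
      (groupZK p F : Set (GL (Fin 2) F)) (groupZK p F : Set (GL (Fin 2) F)))
    (f : compactInd σ) (x : GL (Fin 2) F) :
    (T f).1 x = heckeSum σ ϖ hϖ rep (heckeFunction T (alphaGL ϖ hϖ)) f.1 x := by
  classical
  induction f using compactInd_induction (isOpen_groupZK hϖ) with
  | h0 =>
    rw [map_zero]
    simp [heckeSum]
  | hadd f f' hf hf' =>
    rw [map_add]
    change (T f).1 x + (T f').1 x = _
    rw [hf, hf', heckeSum, heckeSum, heckeSum]
    simp only [Submodule.coe_add, Pi.add_apply, map_add, Finset.sum_add_distrib]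
    abel
  | hs g v =>
    rw [intertwining_apply_single]
    set y := x⁻¹ * g with hy
    have hg : g = x * y := by rw [hy]; group
    have hx : ∀ z, (compactIndSingle σ g v).1 (x * z) = (compactIndSingle σ y v).1 z := by
      intro z
      rw [hg, ← compactIndRep_single, compactIndRep_apply]
      group
    simp only [heckeSum, hx]
    by_cases hmem : y ∈ DoubleCoset.doubleCoset (alphaGL ϖ hϖ)
      (groupZK p F : Set (GL (Fin 2) F)) (groupZK p F : Set (GL (Fin 2) F))
    · obtain ⟨h₁, hh₁, h₂, hh₂, e⟩ := DoubleCoset.mem_doubleCoset.1 hmem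
      obtain ⟨c, κ, e₁⟩ := exists_eq_scalarZK_mul_intGL ⟨h₁, hh₁⟩
      have e₁' : h₁ = (scalarZK p c : GL (Fin 2) F) * (intGL κ : GL (Fin 2) F) :=
        congrArg Subtype.val e₁
      have hcen : ∀ z : GL (Fin 2) F, (scalarZK p c : GL (Fin 2) F) * z =
          z * (scalarZK p c : GL (Fin 2) F) :=
        fun z => Matrix.GeneralLinearGroup.scalar_commute (n := Fin 2) c z
      rcases exists_mul_alphaGL_eq_or ϖ hϖ hπ hrep κ with ⟨a, κ', h⟩ | ⟨κ', h⟩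
      · have e' : y = uAlpha ϖ hϖ (rep a) *
            (intGL κ' * scalarZK p c * ⟨h₂, hh₂⟩ : groupZK p F) := by
          rw [e, e₁', mul_assoc _ _ (alphaGL ϖ hϖ), h, hcen]
          simp only [Subgroup.coe_mul, uAlpha, mul_assoc]
        generalize (intGL κ' * scalarZK p c * ⟨h₂, hh₂⟩ : groupZK p F) = h' at e'
        rw [e', compactIndSingle_mul, heckeFunction_mul_right, uAlpha, heckeFunction_mul_left,
          ← uAlpha, Finset.sum_eq_single a, compactIndSingle_apply_self,
          compactIndSingle_apply_of_notMem (wAlpha_uAlpha_notMem hϖ _), map_zero, map_zero,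
          add_zero]
        · intro b _ hb
          rw [compactIndSingle_apply_of_notMem, map_zero, map_zero]
          exact fun hm => hb (eq_of_uAlpha_rep_mem hϖ hπ hrep hm).symm
        · exact fun h => absurd (Finset.mem_univ a) h
      · have e' : y = wAlpha ϖ hϖ *
            (intGL κ' * scalarZK p c * ⟨h₂, hh₂⟩ : groupZK p F) := by
          rw [e, e₁', mul_assoc _ _ (alphaGL ϖ hϖ), h, hcen]
          simp only [Subgroup.coe_mul, wAlpha, mul_assoc]
        generalize (intGL κ' * scalarZK p c * ⟨h₂, hh₂⟩ : groupZK p F) = h' at e'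
        rw [e', compactIndSingle_mul, heckeFunction_mul_right, wAlpha, heckeFunction_mul_left,
          ← wAlpha, Finset.sum_eq_zero, zero_add, compactIndSingle_apply_self]
        intro b _
        rw [compactIndSingle_apply_of_notMem, map_zero, map_zero]
        exact uAlpha_wAlpha_notMem hϖ _
    · have h0 : heckeFunction T y = 0 := by
        by_contra hne
        exact hmem (hT hne)
      have hz : ∀ (h : groupZK p F), (compactIndSingle σ y v).1 (h * alphaGL ϖ hϖ) = 0 := by
        intro h
        apply compactIndSingle_apply_of_notMem
        intro hm
        apply hmem
        rw [DoubleCoset.mem_doubleCoset]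
        exact ⟨h, h.2, _, hm, by group⟩
      rw [h0, wAlpha, hz]
      simp only [uAlpha, hz]
      simp

end Hecke

section HeckeExistence

variable {p : ℕ} [Fact p.Prime] {F : Type*} [NormedField F] [NormedAlgebra ℚ_[p] F]
  [Algebra ℤ_[p] F] {k V : Type*} [Field k] [AddCommGroup V] [Module k V]
  {σ : Representation k (groupZK p F) V}
  {ϖ : integralClosure ℤ_[p] F} (hϖ : Irreducible ϖ) {𝔽 : Type*} [Field 𝔽] [Fintype 𝔽]

lemma lower_mul_alphaGL (y : integralClosure ℤ_[p] F) :
    (intGL (wGL _ * uGL y * wGL _) : GL (Fin 2) F) * alphaGL ϖ hϖ =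
      alphaGL ϖ hϖ * (intGL (wGL (integralClosure ℤ_[p] F) * uGL (ϖ * y) * wGL _) :
        GL (Fin 2) F) := by
  simp only [map_mul, Subgroup.coe_mul, coe_intGL_uGL, coe_intGL_wGL]
  ext i j
  simp only [Matrix.GeneralLinearGroup.coe_mul, coe_alphaGL, coe_uGL, coe_wGL]
  fin_cases i <;> fin_cases j <;> simp [mul_comm]

lemma dGL_mul_alphaGL (a d : (integralClosure ℤ_[p] F)ˣ) :
    (intGL (dGL a d) : GL (Fin 2) F) * alphaGL ϖ hϖ = alphaGL ϖ hϖ * intGL (dGL a d) := by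
  have : (intGL (dGL a d) : GL (Fin 2) F) =
      dGL (Units.map (algebraMap (integralClosure ℤ_[p] F) F : _ →* F) a)
        (Units.map (algebraMap (integralClosure ℤ_[p] F) F : _ →* F) d) := map_dGL _ a d
  rw [this]
  ext i j
  simp only [Matrix.GeneralLinearGroup.coe_mul, coe_alphaGL, coe_dGL]
  fin_cases i <;> fin_cases j <;> simp [mul_comm]

lemma uGL_mul_alphaGL (c : integralClosure ℤ_[p] F) :
    (intGL (uGL (ϖ * c)) : GL (Fin 2) F) * alphaGL ϖ hϖ = alphaGL ϖ hϖ * intGL (uGL c) := by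
  have := uAlpha_add_mul ϖ hϖ 0 c
  rw [zero_add] at this
  rw [← uAlpha, this, uAlpha, uGL_zero, map_one, OneMemClass.coe_one, one_mul]

/-- The term of the Hecke operator at the coset of `κ α`. -/
noncomputable def heckeTerm (σ : Representation k (groupZK p F) V) {ϖ : integralClosure ℤ_[p] F}
    (hϖ : Irreducible ϖ) (Ψ : Module.End k V) (f : GL (Fin 2) F → V)
    (x : GL (Fin 2) F) (κ : GL (Fin 2) (integralClosure ℤ_[p] F)) : V :=
  σ (intGL κ) (Ψ (f (x * (intGL κ * alphaGL ϖ hϖ))))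

lemma heckeSum_eq_heckeTerm (rep : 𝔽 → integralClosure ℤ_[p] F) (Ψ : Module.End k V)
    (f : GL (Fin 2) F → V) (x : GL (Fin 2) F) :
    heckeSum σ ϖ hϖ rep Ψ f x =
      ∑ a, heckeTerm σ hϖ Ψ f x (uGL (rep a)) + heckeTerm σ hϖ Ψ f x (wGL _) := rfl

lemma heckeTerm_mul_right {Ψ : Module.End k V} (f : compactInd σ) (x : GL (Fin 2) F)
    (κ : GL (Fin 2) (integralClosure ℤ_[p] F)) {h h' : GL (Fin 2) (integralClosure ℤ_[p] F)}
    (hh : (intGL h : GL (Fin 2) F) * alphaGL ϖ hϖ = alphaGL ϖ hϖ * intGL h')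
    (hΨ : ∀ v, σ (intGL h) (Ψ v) = Ψ (σ (intGL h') v)) :
    heckeTerm σ hϖ Ψ f.1 x (κ * h) = heckeTerm σ hϖ Ψ f.1 x κ := by
  have e : x * ((intGL (κ * h) : GL (Fin 2) F) * alphaGL ϖ hϖ) =
      x * (intGL κ * alphaGL ϖ hϖ) * intGL h' := by
    rw [map_mul, Subgroup.coe_mul, mul_assoc (intGL κ : GL (Fin 2) F), hh]
    simp only [mul_assoc]
  rw [heckeTerm, e, compactInd_apply_mul, map_mul, map_mul, Module.End.mul_apply, hΨ,
    Representation.self_inv_apply, heckeTerm]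

lemma heckeTerm_mul_left {Ψ : Module.End k V} (f : GL (Fin 2) F → V) (x : GL (Fin 2) F)
    (κ₀ κ : GL (Fin 2) (integralClosure ℤ_[p] F)) :
    heckeTerm σ hϖ Ψ f (x * intGL κ₀) κ =
      σ (intGL κ₀)⁻¹ (heckeTerm σ hϖ Ψ f x (κ₀ * κ)) := by
  rw [heckeTerm, heckeTerm, map_mul, map_mul, Module.End.mul_apply, Representation.inv_self_apply,
    Subgroup.coe_mul]
  simp only [mul_assoc]

variable [IsScalarTower ℤ_[p] ℚ_[p] F] [FiniteDimensional ℚ_[p] F]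
  {π : integralClosure ℤ_[p] F →+* 𝔽} {rep : 𝔽 → integralClosure ℤ_[p] F}

lemma isUnit_of_residue_ne_zero {ϖ : integralClosure ℤ_[p] F} (hϖ : Irreducible ϖ)
    (hπ : ∀ x, π x = 0 ↔ ϖ ∣ x) {x : integralClosure ℤ_[p] F} (hx : π x ≠ 0) : IsUnit x := by
  by_contra h
  have := (IsLocalRing.mem_maximalIdeal x).2 h
  rw [maximalIdeal_eq_span hϖ, Ideal.mem_span_singleton, ← hπ] at this
  exact hx this

/-- An endomorphism of `V` commuting with the torus and the centre, invariant under the upper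
unipotent matrices on the right and under the lower ones on the left. These are the conditions for
it to be the value at `α` of a function on `𝒦 α 𝒦` that is equivariant under `𝒦` on both sides. -/
structure IsHeckeValue (σ : Representation k (groupZK p F) V) (Ψ : Module.End k V) : Prop where
  map_u : ∀ c v, Ψ (σ (intGL (uGL c)) v) = Ψ v
  u_w_map : ∀ c v, σ (intGL (uGL c)) (σ (intGL (wGL _)) (Ψ v)) = σ (intGL (wGL _)) (Ψ v)
  map_d : ∀ a d v, Ψ (σ (intGL (dGL a d)) v) = σ (intGL (dGL a d)) (Ψ v)
  map_scalar : ∀ c v, Ψ (σ (scalarZK p c) v) = σ (scalarZK p c) (Ψ v)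

/-- `heckeSum` has values in the compact induction. By the equivariance of `Ψ` the terms depend only
on the cosets of `𝒦`, which are permuted by the generators of `𝒦`. -/
lemma heckeSum_mul {Ψ : Module.End k V} (hΨ : IsHeckeValue σ Ψ)
    (htriv : ∀ κ ∈ congrSubgroup ϖ 1, σ (intGL κ) = 1)
    (hπ : ∀ x, π x = 0 ↔ ϖ ∣ x) (hrep : ∀ x, π (rep x) = x)
    (f : compactInd σ) (x : GL (Fin 2) F) (h : groupZK p F) :
    heckeSum σ ϖ hϖ rep Ψ f.1 (x * h) = σ h⁻¹ (heckeSum σ ϖ hϖ rep Ψ f.1 x) := by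
  classical
  have hww : σ (intGL (wGL (integralClosure ℤ_[p] F))) * σ (intGL (wGL _)) = 1 := by
    rw [← map_mul, ← map_mul, wGL_mul_self, map_one, map_one]
  have tu : ∀ x κ c, heckeTerm σ hϖ Ψ f.1 x (κ * uGL (ϖ * c)) = heckeTerm σ hϖ Ψ f.1 x κ := by
    intro x κ c
    refine heckeTerm_mul_right hϖ f x κ (uGL_mul_alphaGL hϖ c) fun v => ?_
    rw [hΨ.map_u, htriv _ (by
      rw [mem_congrSubgroup_iff]
      intro i j
      fin_cases i <;> fin_cases j <;> simp), Module.End.one_apply]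
  have tl : ∀ x κ y, heckeTerm σ hϖ Ψ f.1 x (κ * (wGL _ * uGL y * wGL _)) =
      heckeTerm σ hϖ Ψ f.1 x κ := by
    intro x κ y
    refine heckeTerm_mul_right hϖ f x κ (lower_mul_alphaGL hϖ y) fun v => ?_
    rw [htriv (wGL _ * uGL (ϖ * y) * wGL _) (by
      rw [mem_congrSubgroup_iff]
      intro i j
      fin_cases i <;> fin_cases j <;> simp), Module.End.one_apply, map_mul, map_mul, map_mul,
      map_mul, Module.End.mul_apply, Module.End.mul_apply, hΨ.u_w_map, ← Module.End.mul_apply,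
      hww, Module.End.one_apply]
  have td : ∀ x κ a d, heckeTerm σ hϖ Ψ f.1 x (κ * dGL a d) = heckeTerm σ hϖ Ψ f.1 x κ := by
    intro x κ a d
    exact heckeTerm_mul_right hϖ f x κ (dGL_mul_alphaGL hϖ a d) fun v => (hΨ.map_d a d v).symm
  have trep : ∀ x (y : integralClosure ℤ_[p] F), heckeTerm σ hϖ Ψ f.1 x (uGL y) =
      heckeTerm σ hϖ Ψ f.1 x (uGL (rep (π y))) := by
    intro x y
    obtain ⟨c, hc⟩ := (hπ (y - rep (π y))).1 (by rw [map_sub, hrep, sub_self])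
    rw [show y = rep (π y) + ϖ * c by rw [← hc]; ring, uGL_add, tu]
    congr 3
    rw [map_add, map_mul, (hπ ϖ).2 dvd_rfl, hrep, zero_mul, add_zero]
  have key : ∀ (κ : GL (Fin 2) (integralClosure ℤ_[p] F)), ∀ x,
      heckeSum σ ϖ hϖ rep Ψ f.1 (x * intGL κ) =
        σ (intGL κ)⁻¹ (heckeSum σ ϖ hϖ rep Ψ f.1 x) := by
    intro κ
    induction κ using gl2_induction with
    | hu a =>
      intro x
      simp only [heckeSum_eq_heckeTerm, heckeTerm_mul_left]
      rw [← map_sum, ← map_add]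
      congr 2
      · refine Fintype.sum_equiv (Equiv.addLeft (π a)) _ _ fun b => ?_
        rw [← uGL_add, trep, map_add, hrep, Equiv.coe_addLeft]
      · rw [← tl x (wGL _) a]
        congr 1
        rw [← mul_assoc, ← mul_assoc, wGL_mul_self, one_mul]
    | hw =>
      intro x
      simp only [heckeSum_eq_heckeTerm, heckeTerm_mul_left]
      rw [← map_sum, ← map_add]
      congr 1
      -- `w` exchanges the cosets of `α` and of `w α`, and maps the coset of `u_y α` to that of
      -- `u_{1/y} α`
      have h0 : ∀ y : 𝔽, y = 0 → heckeTerm σ hϖ Ψ f.1 x (uGL (rep y)) =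
          heckeTerm σ hϖ Ψ f.1 x 1 := by
        rintro y rfl
        rw [← uGL_zero, trep x 0, map_zero]
      have h1 : heckeTerm σ hϖ Ψ f.1 x (wGL _ * uGL (rep 0)) =
          heckeTerm σ hϖ Ψ f.1 x (wGL _) := by
        obtain ⟨c, hc⟩ := (hπ (rep 0)).1 (hrep 0)
        rw [hc, tu]
      have h2 : ∀ a : 𝔽ˣ, heckeTerm σ hϖ Ψ f.1 x (wGL _ * uGL (rep a)) =
          heckeTerm σ hϖ Ψ f.1 x (uGL (rep (a⁻¹ : 𝔽ˣ))) := by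
        intro a
        obtain ⟨y, hy⟩ := isUnit_of_residue_ne_zero (x := rep a) hϖ hπ (by
          rw [hrep]; exact a.ne_zero)
        have e : wGL _ * uGL (rep (a : 𝔽)) =
            uGL ((y⁻¹ : (integralClosure ℤ_[p] F)ˣ) : integralClosure ℤ_[p] F) *
              dGL (-y⁻¹) y * (wGL _ *
              uGL ((y⁻¹ : (integralClosure ℤ_[p] F)ˣ) : integralClosure ℤ_[p] F) * wGL _) := by
          have e1 := wGL_uGL_wGL y
          rw [← hy]
          calc wGL _ * uGL (y : integralClosure ℤ_[p] F)
              = wGL _ * uGL (y : integralClosure ℤ_[p] F) * wGL _ * wGL _ := by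
                rw [mul_assoc _ (wGL _) (wGL _), wGL_mul_self, mul_one]
            _ = _ := by
                rw [e1, mul_assoc _ (wGL _) (dGL _ _), wGL_mul_dGL]
                simp only [mul_assoc]
        have e2 : π ((y⁻¹ : (integralClosure ℤ_[p] F)ˣ) : integralClosure ℤ_[p] F) =
            ((a⁻¹ : 𝔽ˣ) : 𝔽) := by
          rw [Units.val_inv_eq_inv_val]
          refine eq_inv_of_mul_eq_one_left ?_
          rw [← hrep a, ← hy, ← map_mul, Units.inv_mul, map_one]
        rw [e, tl, td, trep, e2]
      rw [sum_eq_zero_add_sum_units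
          (fun a : 𝔽 => heckeTerm σ hϖ Ψ f.1 x (wGL _ * uGL (rep a))),
        sum_eq_zero_add_sum_units (fun a : 𝔽 => heckeTerm σ hϖ Ψ f.1 x (uGL (rep a))),
        h1, h0 0 rfl, wGL_mul_self, Fintype.sum_equiv (Equiv.inv 𝔽ˣ) _ (fun a : 𝔽ˣ =>
          heckeTerm σ hϖ Ψ f.1 x (uGL (rep (a : 𝔽)))) h2]
      abel
    | hd a d =>
      intro x
      simp only [heckeSum_eq_heckeTerm, heckeTerm_mul_left]
      rw [← map_sum, ← map_add]
      congr 2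
      · have hne : π (a * (d⁻¹ : (integralClosure ℤ_[p] F)ˣ)) ≠ 0 :=
          ((a * d⁻¹).isUnit.map π).ne_zero
        refine Fintype.sum_equiv (Equiv.mulLeft₀ _ hne) _ _ fun b => ?_
        rw [dGL_mul_uGL, td, trep, mul_right_comm, map_mul π _ (rep b), hrep]
        rfl
      · rw [← td x (wGL _) d a, wGL_mul_dGL]
    | hmul κ κ' h h' =>
      intro x
      rw [map_mul, Subgroup.coe_mul, ← mul_assoc, h', h, mul_inv_rev, map_mul,
        Module.End.mul_apply]
  obtain ⟨c, κ, rfl⟩ := exists_eq_scalarZK_mul_intGL h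
  have hcen : ∀ z : GL (Fin 2) F, (scalarZK p c : GL (Fin 2) F) * z =
      z * (scalarZK p c : GL (Fin 2) F) :=
    fun z => Matrix.GeneralLinearGroup.scalar_commute (n := Fin 2) c z
  have hcinv : ∀ v, Ψ (σ (scalarZK p c)⁻¹ v) = σ (scalarZK p c)⁻¹ (Ψ v) := by
    rw [← map_inv]
    exact hΨ.map_scalar c⁻¹
  rw [Subgroup.coe_mul, ← mul_assoc, key, mul_inv_rev, map_mul, Module.End.mul_apply]
  congr 1
  have hterm : ∀ κ, heckeTerm σ hϖ Ψ f.1 (x * scalarZK p c) κ =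
      σ (scalarZK p c)⁻¹ (heckeTerm σ hϖ Ψ f.1 x κ) := by
    intro κ
    rw [heckeTerm, mul_assoc, hcen, ← mul_assoc, compactInd_apply_mul, hcinv,
      ← Module.End.mul_apply, ← map_mul, ← map_inv, ← scalarZK_mul, map_mul, Module.End.mul_apply,
      heckeTerm]
  simp only [heckeSum_eq_heckeTerm, hterm]
  rw [← map_sum, ← map_add]

end HeckeExistence

section HeckeOperator

variable {p : ℕ} [Fact p.Prime] {F : Type*} [NormedField F] [NormedAlgebra ℚ_[p] F]
  [Algebra ℤ_[p] F] {k V : Type*} [Field k] [AddCommGroup V] [Module k V]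
  {σ : Representation k (groupZK p F) V}
  {ϖ : integralClosure ℤ_[p] F} (hϖ : Irreducible ϖ) {𝔽 : Type*} [Field 𝔽] [Fintype 𝔽]

/-- The inverse of `α` is `w α w` up to a scalar. -/
lemma alphaGL_inv : (alphaGL ϖ hϖ)⁻¹ = (intGL (wGL (integralClosure ℤ_[p] F)) : GL (Fin 2) F) *
    alphaGL ϖ hϖ * (intGL (wGL _) * scalarZK p (uniformizerUnit ϖ hϖ)⁻¹ : groupZK p F) := by
  rw [inv_eq_iff_mul_eq_one]
  have h1 := alphaGL_mul_wGL_mul_alphaGL ϖ hϖ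
  rw [← coe_intGL_wGL p F, ← coe_scalarZK (p := p)] at h1
  have hww : (intGL (wGL (integralClosure ℤ_[p] F)) : GL (Fin 2) F) *
      (intGL (wGL (integralClosure ℤ_[p] F)) : GL (Fin 2) F) = 1 := by
    rw [← Subgroup.coe_mul, ← map_mul, wGL_mul_self, map_one, OneMemClass.coe_one]
  have hss : (scalarZK p (uniformizerUnit ϖ hϖ) : GL (Fin 2) F) *
      (scalarZK p (uniformizerUnit ϖ hϖ)⁻¹ : GL (Fin 2) F) = 1 := by
    rw [← Subgroup.coe_mul, ← map_mul, mul_inv_cancel, map_one, OneMemClass.coe_one]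
  have hcen := Matrix.GeneralLinearGroup.scalar_commute (n := Fin 2) (uniformizerUnit ϖ hϖ)
    (intGL (wGL (integralClosure ℤ_[p] F)) : GL (Fin 2) F)
  rw [← coe_scalarZK (p := p)] at hcen
  rw [Subgroup.coe_mul, ← mul_assoc, ← mul_assoc, ← mul_assoc, h1, mul_assoc, mul_assoc,
    ← mul_assoc _ (intGL (wGL (integralClosure ℤ_[p] F)) : GL (Fin 2) F), hcen, mul_assoc, hss,
    mul_one, hww]

variable [IsScalarTower ℤ_[p] ℚ_[p] F] [FiniteDimensional ℚ_[p] F]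
  {π : integralClosure ℤ_[p] F →+* 𝔽} {rep : 𝔽 → integralClosure ℤ_[p] F}

/-- The double coset `𝒦 α 𝒦` is the union of the cosets of `u_x α` and of `w α`. -/
lemma groupZK_mul_alphaGL (hπ : ∀ x, π x = 0 ↔ ϖ ∣ x) (hrep : ∀ x, π (rep x) = x)
    (h : groupZK p F) : ∃ h' : groupZK p F,
      (∃ a, (h : GL (Fin 2) F) * alphaGL ϖ hϖ = uAlpha ϖ hϖ (rep a) * h') ∨
        (h : GL (Fin 2) F) * alphaGL ϖ hϖ = wAlpha ϖ hϖ * h' := by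
  obtain ⟨c, κ, rfl⟩ := exists_eq_scalarZK_mul_intGL h
  have hcen : ∀ z : GL (Fin 2) F, (scalarZK p c : GL (Fin 2) F) * z =
      z * (scalarZK p c : GL (Fin 2) F) :=
    fun z => Matrix.GeneralLinearGroup.scalar_commute (n := Fin 2) c z
  rcases exists_mul_alphaGL_eq_or ϖ hϖ hπ hrep κ with ⟨a, κ', h⟩ | ⟨κ', h⟩
  · refine ⟨intGL κ' * scalarZK p c, Or.inl ⟨a, ?_⟩⟩
    rw [Subgroup.coe_mul, mul_assoc, h, hcen, Subgroup.coe_mul, uAlpha, ← mul_assoc]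
  · refine ⟨intGL κ' * scalarZK p c, Or.inr ?_⟩
    rw [Subgroup.coe_mul, mul_assoc, h, hcen, Subgroup.coe_mul, wAlpha, ← mul_assoc]

lemma groupZK_mul_alphaGL_inv (hπ : ∀ x, π x = 0 ↔ ϖ ∣ x) (hrep : ∀ x, π (rep x) = x)
    (h h₀ : groupZK p F) : ∃ h' : groupZK p F,
      (∃ a, (h : GL (Fin 2) F) * (h₀ * alphaGL ϖ hϖ)⁻¹ = uAlpha ϖ hϖ (rep a) * h') ∨
        (h : GL (Fin 2) F) * (h₀ * alphaGL ϖ hϖ)⁻¹ = wAlpha ϖ hϖ * h' := by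
  set h₁ : groupZK p F := intGL (wGL _) * scalarZK p (uniformizerUnit ϖ hϖ)⁻¹ with hh₁
  have e : (h : GL (Fin 2) F) * (h₀ * alphaGL ϖ hϖ)⁻¹ =
      (h * intGL (wGL _) : groupZK p F) * alphaGL ϖ hϖ * (h₁ * h₀⁻¹ : groupZK p F) := by
    rw [mul_inv_rev, alphaGL_inv, ← hh₁]
    simp only [Subgroup.coe_mul, mul_assoc, Subgroup.coe_inv]
  obtain ⟨h', ⟨a, h2⟩ | h2⟩ := groupZK_mul_alphaGL hϖ hπ hrep (h * intGL (wGL _))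
  · exact ⟨h' * (h₁ * h₀⁻¹), Or.inl ⟨a, by rw [e, h2, mul_assoc, ← Subgroup.coe_mul]⟩⟩
  · exact ⟨h' * (h₁ * h₀⁻¹), Or.inr (by rw [e, h2, mul_assoc, ← Subgroup.coe_mul])⟩

lemma exists_isCompact_support_heckeSum (hπ : ∀ x, π x = 0 ↔ ϖ ∣ x) (hrep : ∀ x, π (rep x) = x)
    (Ψ : Module.End k V) (f : compactInd σ) :
    ∃ C : Set (GL (Fin 2) F), IsCompact C ∧
      Function.support (heckeSum σ ϖ hϖ rep Ψ f.1) ⊆ C * (groupZK p F : Set (GL (Fin 2) F)) := by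
  obtain ⟨C, hC, hsub⟩ := f.2.2
  let E : Set (GL (Fin 2) F) := Set.range (fun a => uAlpha ϖ hϖ (rep a)) ∪ {wAlpha ϖ hϖ}
  have hE : E.Finite := (Set.finite_range _).union (Set.finite_singleton _)
  refine ⟨C * E, hC.mul hE.isCompact, fun x hx => ?_⟩
  have key : ∀ h₀ : groupZK p F, f.1 (x * (h₀ * alphaGL ϖ hϖ)) ≠ 0 →
      x ∈ C * E * (groupZK p F : Set (GL (Fin 2) F)) := by
    intro h₀ hne
    obtain ⟨c, hc, h, hh, e⟩ := hsub hne
    have e' : x = c * (h * (h₀ * alphaGL ϖ hϖ)⁻¹) := by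
      simp only at e
      rw [← mul_assoc, e]
      group
    obtain ⟨h', ⟨a, h2⟩ | h2⟩ := groupZK_mul_alphaGL_inv hϖ hπ hrep ⟨h, hh⟩ h₀
    · rw [e', h2, ← mul_assoc]
      exact Set.mul_mem_mul (Set.mul_mem_mul hc (Or.inl ⟨a, rfl⟩)) h'.2
    · rw [e', h2, ← mul_assoc]
      exact Set.mul_mem_mul (Set.mul_mem_mul hc (Or.inr rfl)) h'.2
  by_contra hcon
  refine hx ?_
  rw [heckeSum, wAlpha, not_not.1 (mt (key (intGL (wGL _))) hcon), map_zero, map_zero, add_zero]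
  refine Finset.sum_eq_zero fun a _ => ?_
  rw [uAlpha, not_not.1 (mt (key (intGL (uGL (rep a)))) hcon), map_zero, map_zero]

/-- A nonzero endomorphism of `V` with the equivariance properties of `IsHeckeValue` is the value
at `α` of a Hecke operator. -/
theorem exists_isHeckeOperatorT {Ψ : Module.End k V} (hΨ : IsHeckeValue σ Ψ) (hne : Ψ ≠ 0)
    (htriv : ∀ κ ∈ congrSubgroup ϖ 1, σ (intGL κ) = 1)
    (hsurj : Function.Surjective π) (hπ : ∀ x, π x = 0 ↔ ϖ ∣ x) :
    ∃ T : Representation.IntertwiningMap (compactIndRep σ) (compactIndRep σ),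
      IsHeckeOperatorT ϖ hϖ T := by
  let rep := Function.surjInv hsurj
  have hrep : ∀ x, π (rep x) = x := Function.surjInv_eq hsurj
  let T : Representation.IntertwiningMap (compactIndRep σ) (compactIndRep σ) :=
    { toFun := fun f => ⟨heckeSum σ ϖ hϖ rep Ψ f.1,
        fun x h => heckeSum_mul hϖ hΨ htriv hπ hrep f x h,
        exists_isCompact_support_heckeSum hϖ hπ hrep Ψ f⟩
      map_add' := fun f f' => Subtype.ext <| funext fun x => by
        change heckeSum σ ϖ hϖ rep Ψ (f.1 + f'.1) x =
          heckeSum σ ϖ hϖ rep Ψ f.1 x + heckeSum σ ϖ hϖ rep Ψ f'.1 x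
        simp only [heckeSum, Pi.add_apply, map_add, Finset.sum_add_distrib]
        abel
      map_smul' := fun c f => Subtype.ext <| funext fun x => by
        change heckeSum σ ϖ hϖ rep Ψ (c • f.1) x = c • heckeSum σ ϖ hϖ rep Ψ f.1 x
        simp only [heckeSum, Pi.smul_apply, map_smul, Finset.smul_sum, smul_add]
      isIntertwining' := fun y => LinearMap.ext fun f => Subtype.ext <| funext fun x => by
        change heckeSum σ ϖ hϖ rep Ψ (fun z => f.1 (y⁻¹ * z)) x =
          heckeSum σ ϖ hϖ rep Ψ f.1 (y⁻¹ * x)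
        simp only [heckeSum, mul_assoc] }
  have hT : ∀ f x, (T f).1 x = heckeSum σ ϖ hϖ rep Ψ f.1 x := fun f x => rfl
  refine ⟨T, fun h0 => hne (LinearMap.ext fun v => ?_), fun x hx => ?_⟩
  · have h1 := hT (compactIndSingle σ (uAlpha ϖ hϖ (rep 0)) v) 1
    rw [h0, heckeSum, Finset.sum_eq_single 0, one_mul, compactIndSingle_apply_self, one_mul,
      compactIndSingle_apply_of_notMem (wAlpha_uAlpha_notMem hϖ _), map_zero, map_zero,
      add_zero] at h1
    · have h2 := congrArg (σ (intGL (uGL (rep 0)))⁻¹) h1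
      rw [Representation.inv_self_apply] at h2
      rw [← h2]
      exact map_zero _
    · intro a _ ha
      rw [one_mul, compactIndSingle_apply_of_notMem, map_zero, map_zero]
      exact fun hm => ha (eq_of_uAlpha_rep_mem hϖ hπ hrep hm).symm
    · exact fun h => absurd (Finset.mem_univ _) h
  · by_contra hcon
    refine hx (LinearMap.ext fun v => ?_)
    have key : ∀ h₀ : groupZK p F,
        (compactIndSingle σ 1 v).1 (x⁻¹ * (h₀ * alphaGL ϖ hϖ)) = 0 := by
      intro h₀
      apply compactIndSingle_apply_of_notMem
      intro hm
      refine hcon (DoubleCoset.mem_doubleCoset.2 ⟨h₀, h₀.2, _, hm, ?_⟩)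
      group
    change heckeSum σ ϖ hϖ rep Ψ (compactIndSingle σ 1 v).1 x⁻¹ = 0
    rw [heckeSum, wAlpha, key, map_zero, map_zero, add_zero]
    refine Finset.sum_eq_zero fun a _ => ?_
    rw [uAlpha, key, map_zero, map_zero]

end HeckeOperator

section HeckeValues

variable {p : ℕ} [Fact p.Prime] {F : Type*} [NormedField F] [NormedAlgebra ℚ_[p] F]
  [Algebra ℤ_[p] F] {k V : Type*} [Field k] [AddCommGroup V] [Module k V]
  {σ : Representation k (groupZK p F) V}
  {ϖ : integralClosure ℤ_[p] F} {hϖ : Irreducible ϖ} {𝔽 : Type*} [Field 𝔽] [Fintype 𝔽]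
  {π : integralClosure ℤ_[p] F →+* 𝔽} {τ : 𝔽 →+* k}
  {L : Type*} [CommRing L] [Algebra k L] [Module L V] [IsScalarTower k L V]
  {ρ : Representation L (GL (Fin 2) 𝔽) V} {r : ℕ} {ε : L} {g : ℕ → V}

lemma intGL_wGL_inv :
    (intGL (wGL (integralClosure ℤ_[p] F)) : groupZK p F)⁻¹ = intGL (wGL _) := by
  rw [← map_inv, inv_eq_of_mul_eq_one_left (wGL_mul_self (R := integralClosure ℤ_[p] F))]

lemma intGL_wGL_apply_apply (x : V) :
    σ (intGL (wGL (integralClosure ℤ_[p] F))) (σ (intGL (wGL _)) x) = x := by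
  rw [← Module.End.mul_apply, ← map_mul, ← map_mul, wGL_mul_self, map_one, map_one,
    Module.End.one_apply]

namespace IsWeight

lemma u_apply (hW : IsWeight σ π τ ρ r ε g) (c : integralClosure ℤ_[p] F) (x : V) :
    σ (intGL (uGL c)) x = ρ (uGL (π c)) x := by
  rw [← hW.map_apply, map_uGL]

lemma w_apply (hW : IsWeight σ π τ ρ r ε g) (x : V) :
    σ (intGL (wGL _)) x = ρ (wGL 𝔽) x := by
  rw [← hW.map_apply, map_wGL]

lemma map_smul (hW : IsWeight σ π τ ρ r ε g) (h : groupZK p F) (l : L) (x : V) :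
    σ h (l • x) = l • σ h x :=
  hW.map_smul_of_commute (σ h) (fun c y => by
    rw [← Module.End.mul_apply, ← map_mul, ← scalarZK_mul, map_mul, Module.End.mul_apply]) l x

lemma eq_one_of_mem_congrSubgroup (hW : IsWeight σ π τ ρ r ε g)
    (hπ : ∀ x, π x = 0 ↔ ϖ ∣ x) : ∀ κ ∈ congrSubgroup ϖ 1, σ (intGL κ) = 1 := by
  intro κ hκ
  ext x
  rw [← hW.map_apply]
  have : Matrix.GeneralLinearGroup.map π κ = 1 := by
    rw [mem_congrSubgroup_iff] at hκ
    ext i j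
    have h1 := hκ i j
    rw [pow_one, ← hπ, map_sub, sub_eq_zero] at h1
    rw [Matrix.GeneralLinearGroup.map_apply, h1, Matrix.GeneralLinearGroup.coe_one,
      Matrix.one_apply, Matrix.one_apply]
    split_ifs <;> simp
  rw [this, map_one]
  rfl

lemma uGL_dvd_apply (hW : IsWeight σ π τ ρ r ε g) (hπ : ∀ x, π x = 0 ↔ ϖ ∣ x)
    (c : integralClosure ℤ_[p] F) (x : V) : σ (intGL (uGL (ϖ * c))) x = x := by
  rw [hW.u_apply, map_mul, (hπ ϖ).2 dvd_rfl, zero_mul, uGL_zero, map_one, Module.End.one_apply]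

/-- The projection to the line of `g 0` is equivariant. -/
lemma exists_isHeckeValue [CharP L p] (hW : IsWeight σ π τ ρ r ε g) :
    ∃ Ψ : Module.End k V, IsHeckeValue σ Ψ ∧ Ψ ≠ 0 := by
  obtain ⟨Ψ, hΨ⟩ := hW.monomial.exists_projection
  refine ⟨Ψ.restrictScalars k, ⟨fun c v => ?_, fun c v => ?_, fun a d v => ?_, fun c v => ?_⟩,
    fun h0 => ?_⟩
  · have := hW.monomial.projection_u hΨ (π c)
    rw [hW.u_apply]
    exact congrArg (fun f : Module.End L V => f v) this
  · have := hW.monomial.u_w_projection hΨ (π c)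
    rw [hW.u_apply, hW.w_apply]
    exact congrArg (fun f : Module.End L V => f v) this
  · have := hW.monomial.projection_d hΨ (Units.map π a) (Units.map π d)
    rw [← hW.map_apply, ← hW.map_apply, map_dGL]
    exact congrArg (fun f : Module.End L V => f v) this
  · obtain ⟨l, hl⟩ := hW.exists_smul c
    rw [hl, hl]
    exact Ψ.map_smul l v
  · have h1 : Ψ (g 0) = g 0 := by rw [hΨ, if_pos rfl]
    have h2 : Ψ (g 0) = 0 := congrArg (fun f : Module.End k V => f (g 0)) h0
    exact (hW.monomial.ne_zero_iff 0).2 (chooseLE_zero Fact.out r) (h1.symm.trans h2)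

variable [IsScalarTower ℤ_[p] ℚ_[p] F] [FiniteDimensional ℚ_[p] F]
  {T : Representation.IntertwiningMap (compactIndRep σ) (compactIndRep σ)}

lemma heckeFunction_alphaGL_inv (v : V) :
    heckeFunction T (alphaGL ϖ hϖ)⁻¹ v = σ (intGL (wGL _)) (heckeFunction T (alphaGL ϖ hϖ)
      (σ (intGL (wGL _)) (σ (scalarZK p (uniformizerUnit ϖ hϖ)⁻¹) v))) := by
  rw [alphaGL_inv, heckeFunction_mul_right, heckeFunction_mul_left, map_mul, Module.End.mul_apply]

/-- The value at `α⁻¹` of the function of a Hecke operator kills all the monomials except for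
`g r`. -/
lemma heckeFunction_apply [CharP L p] (hW : IsWeight σ π τ ρ r ε g) (hπ : ∀ x, π x = 0 ↔ ϖ ∣ x)
    (hsurj : Function.Surjective π) (hT : IsHeckeOperatorT ϖ hϖ T) :
    (∀ (l : L) x, heckeFunction T (alphaGL ϖ hϖ)⁻¹ (l • x) =
      l • heckeFunction T (alphaGL ϖ hϖ)⁻¹ x) ∧
    (∀ i, i ≠ r → heckeFunction T (alphaGL ϖ hϖ)⁻¹ (g i) = 0) ∧
    (∃ c : L, heckeFunction T (alphaGL ϖ hϖ)⁻¹ (g r) = c • g r) ∧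
    heckeFunction T (alphaGL ϖ hϖ)⁻¹ (g r) ≠ 0 := by
  set Ψ := heckeFunction T (alphaGL ϖ hϖ) with hΨ
  have hscal : ∀ c x, Ψ (σ (scalarZK p c) x) = σ (scalarZK p c) (Ψ x) := by
    intro c x
    have e : alphaGL ϖ hϖ * (scalarZK p c : GL (Fin 2) F) = scalarZK p c * alphaGL ϖ hϖ :=
      (Matrix.GeneralLinearGroup.scalar_commute (n := Fin 2) c _).symm
    rw [hΨ, ← heckeFunction_mul_right, e, heckeFunction_mul_left]
  have hlin := hW.map_smul_of_commute Ψ hscal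
  let ΨL : V →ₗ[L] V := { toFun := Ψ, map_add' := map_add Ψ, map_smul' := hlin }
  have hu : ∀ b x, ΨL (ρ (uGL b) x) = ΨL x := by
    intro b x
    obtain ⟨c, rfl⟩ := hsurj b
    rw [← hW.u_apply]
    change Ψ (σ (intGL (uGL c)) x) = Ψ x
    rw [hΨ, ← heckeFunction_mul_right, ← uGL_mul_alphaGL hϖ, heckeFunction_mul_left,
      hW.uGL_dvd_apply hπ]
  have hw : ∀ b x, ρ (uGL b) (ρ (wGL 𝔽) (ΨL x)) = ρ (wGL 𝔽) (ΨL x) := by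
    intro b x
    obtain ⟨c, rfl⟩ := hsurj b
    rw [← hW.u_apply, ← hW.w_apply]
    change σ (intGL (uGL c)) (σ (intGL (wGL _)) (Ψ x)) = σ (intGL (wGL _)) (Ψ x)
    have h1 : Ψ x = σ (intGL (wGL _ * uGL c * wGL _)) (Ψ x) := by
      rw [hΨ, ← heckeFunction_mul_left, lower_mul_alphaGL, heckeFunction_mul_right, map_mul,
        map_mul, map_mul, map_mul, Module.End.mul_apply, Module.End.mul_apply,
        hW.uGL_dvd_apply hπ, intGL_wGL_apply_apply]
    conv_rhs => rw [h1]
    rw [map_mul, map_mul, map_mul, map_mul, Module.End.mul_apply, Module.End.mul_apply,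
      intGL_wGL_apply_apply]
  have hpos : ∀ j, j ≠ 0 → Ψ (g j) = 0 := fun j hj => hW.monomial.map_eq_zero_of_pos ΨL hu hj
  obtain ⟨c, hc⟩ := hW.monomial.map_zero_eq_smul hW.torsionFree ΨL hw
  change Ψ (g 0) = c • g 0 at hc
  have hne : Ψ (g 0) ≠ 0 := by
    intro h0
    have hz : ΨL = 0 := by
      refine LinearMap.ext_on_range hW.monomial.span_eq_top fun i => ?_
      by_cases hi : i = 0
      · subst hi
        exact h0
      · exact hpos i hi
    have hz' : Ψ = 0 := LinearMap.ext fun x => congrArg (fun f : V →ₗ[L] V => f x) hz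
    have hrep : ∀ x, π (Function.surjInv hsurj x) = x := Function.surjInv_eq hsurj
    refine hT.1 (Representation.IntertwiningMap.ext (LinearMap.ext fun f =>
      Subtype.ext (funext fun x => ?_)))
    change (T f).1 x = 0
    rw [apply_eq_heckeSum σ hϖ hπ hrep T hT.2, ← hΨ, hz', heckeSum]
    simp
  have hinv := fun v => heckeFunction_alphaGL_inv (hϖ := hϖ) (T := T) v
  rw [← hΨ] at hinv
  obtain ⟨lz, hlz⟩ := hW.exists_smul (uniformizerUnit ϖ hϖ)⁻¹
  have hform : ∀ i, ChooseLE p i r → heckeFunction T (alphaGL ϖ hϖ)⁻¹ (g i) =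
      (lz * ε) • ρ (wGL 𝔽) (Ψ (g (r - i))) := by
    intro i hi
    rw [hinv, hlz, hW.map_smul, hW.w_apply (g i), hW.monomial.w_apply i hi, hlin, hlin,
      hW.map_smul, hW.map_smul, hW.w_apply, mul_smul]
  refine ⟨fun l x => ?_, fun i hi => ?_, ?_, ?_⟩
  · rw [hinv, hinv, hW.map_smul, hW.map_smul, hlin, hW.map_smul]
  · by_cases h : ChooseLE p i r
    · have := h.le
      rw [hform i h, hpos _ (by omega), map_zero, smul_zero]
    · rw [show g i = 0 from by_contra fun hne => h ((hW.monomial.ne_zero_iff i).1 hne), map_zero]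
  · rw [hform r (chooseLE_refl Fact.out r), Nat.sub_self, hc]
    refine ⟨lz * ε * (c * ε), ?_⟩
    rw [_root_.map_smul, hW.monomial.w_apply_zero, smul_smul, smul_smul]
    congr 1
    ring
  · rw [hinv]
    intro h0
    have hinj : ∀ h, Function.Injective (σ h) := fun h x y hxy => by
      rw [← Representation.inv_self_apply σ h x, hxy, Representation.inv_self_apply]
    have h1 := hinj _ (h0.trans (map_zero _).symm)
    rw [hlz, hW.map_smul, hlin, ← hlz] at h1
    have h2 := hinj _ (h1.trans (map_zero _).symm)
    rw [hW.w_apply (g r), hW.monomial.w_apply_top, hlin] at h2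
    have h3 := congrArg (fun x => ε • x) h2
    simp only [smul_smul, hW.monomial.eps, one_smul, smul_zero] at h3
    exact hne h3

end IsWeight

end HeckeValues

/-! ### Linear independence in the cokernel -/

section Vertices

variable {p : ℕ} [Fact p.Prime] {F : Type*} [NormedField F] [NormedAlgebra ℚ_[p] F]
  [Algebra ℤ_[p] F] {k V : Type*} [Field k] [AddCommGroup V] [Module k V]
  {σ : Representation k (groupZK p F) V}
  {ϖ : integralClosure ℤ_[p] F} (hϖ : Irreducible ϖ) {𝔽 : Type*} [Field 𝔽] [Fintype 𝔽]

/-- The representative `u_x α^m` of a vertex of the tree of `GL₂(F)`. -/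
noncomputable def vertex (x : F) (m : ℕ) : GL (Fin 2) F := uGL x * alphaGL ϖ hϖ ^ m

lemma uAlpha_eq_vertex (x : integralClosure ℤ_[p] F) :
    uAlpha ϖ hϖ x = vertex hϖ (x : F) 1 := by
  rw [uAlpha, vertex, pow_one, coe_intGL_uGL]

lemma coe_uniformizer_ne_zero (hϖ : Irreducible ϖ) : (ϖ : F) ≠ 0 := fun h =>
  hϖ.ne_zero (Subtype.ext h)

lemma vertex_add_mul (x : F) (m : ℕ) (c : integralClosure ℤ_[p] F) :
    vertex hϖ (x + ϖ ^ m * c) m = vertex hϖ x m * intGL (uGL c) := by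
  rw [vertex, vertex, mul_assoc, coe_intGL_uGL, alphaGL_pow_mul_uGL, uGL_add, mul_assoc]

lemma apply_vertex_add_mul (f : compactInd σ) (x : F) (m : ℕ) (c : integralClosure ℤ_[p] F) :
    f.1 (vertex hϖ (x + ϖ ^ m * c) m) = σ (intGL (uGL c))⁻¹ (f.1 (vertex hϖ x m)) := by
  rw [vertex_add_mul, compactInd_apply_mul]

lemma vertex_mul_uAlpha (x : F) (m : ℕ) (y : integralClosure ℤ_[p] F) :
    vertex hϖ x m * uAlpha ϖ hϖ y = vertex hϖ (x + ϖ ^ m * y) (m + 1) := by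
  rw [uAlpha, ← mul_assoc, ← vertex_add_mul, vertex, vertex, mul_assoc, pow_succ]

lemma uAlpha_inv_mul_vertex (x : F) (m : ℕ) (y : integralClosure ℤ_[p] F) :
    (uAlpha ϖ hϖ y)⁻¹ * vertex hϖ x (m + 1) = vertex hϖ ((x - y) / ϖ) m := by
  rw [inv_mul_eq_iff_eq_mul, uAlpha, coe_intGL_uGL, vertex, vertex, pow_succ', ← mul_assoc,
    ← mul_assoc, mul_assoc (uGL (y : F)) (alphaGL ϖ hϖ)]
  have h := alphaGL_pow_mul_uGL ϖ hϖ 1 ((x - y) / ϖ)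
  rw [pow_one, pow_one, mul_div_cancel₀ _ (coe_uniformizer_ne_zero hϖ)] at h
  rw [h, ← mul_assoc, ← uGL_add, add_sub_cancel]

lemma vertex_mul_wAlpha (x : F) (m : ℕ) :
    vertex hϖ x (m + 1) * wAlpha ϖ hϖ = vertex hϖ x m *
      (intGL (wGL _) * scalarZK p (uniformizerUnit ϖ hϖ) : groupZK p F) := by
  have h := alphaGL_mul_wGL_mul_alphaGL ϖ hϖ
  rw [Subgroup.coe_mul, coe_intGL_wGL, coe_scalarZK, ← h, wAlpha, coe_intGL_wGL, vertex, vertex,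
    pow_succ]
  simp only [mul_assoc]

variable [IsScalarTower ℤ_[p] ℚ_[p] F] [FiniteDimensional ℚ_[p] F]
  {π : integralClosure ℤ_[p] F →+* 𝔽} {rep : 𝔽 → integralClosure ℤ_[p] F}
  {T : Representation.IntertwiningMap (compactIndRep σ) (compactIndRep σ)}

/-- An element of the compact induction vanishes far from the origin. -/
lemma exists_forall_vertex_eq_zero (f : compactInd σ) :
    ∃ M, ∀ m, M ≤ m → ∀ x : F, f.1 (vertex hϖ x m) = 0 := by
  induction f using compactInd_induction (isOpen_groupZK hϖ) with
  | h0 => exact ⟨0, fun _ _ _ => rfl⟩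
  | hadd f f' h h' =>
    obtain ⟨M, hM⟩ := h
    obtain ⟨M', hM'⟩ := h'
    refine ⟨max M M', fun m hm x => ?_⟩
    change f.1 _ + f'.1 _ = 0
    rw [hM m ((le_max_left _ _).trans hm), hM' m ((le_max_right _ _).trans hm), add_zero]
  | hs g v =>
    by_cases hex : ∃ (x₀ : F) (m₀ : ℕ), (vertex hϖ x₀ m₀)⁻¹ * g ∈ groupZK p F
    · obtain ⟨x₀, m₀, h₀⟩ := hex
      refine ⟨m₀ + 1, fun m hm x => compactIndSingle_apply_of_notMem (fun h => ?_) v⟩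
      have h1 := (groupZK p F).mul_mem h ((groupZK p F).inv_mem h₀)
      have e : (vertex hϖ x m)⁻¹ * g * ((vertex hϖ x₀ m₀)⁻¹ * g)⁻¹ =
          (vertex hϖ x m)⁻¹ * vertex hϖ x₀ m₀ := by group
      rw [e] at h1
      have := (eq_of_alphaGL_pow_mem ϖ hϖ h1).1
      omega
    · exact ⟨0, fun m _ x => compactIndSingle_apply_of_notMem (fun h => hex ⟨x, m, h⟩) v⟩

/-- The value of `T f` at a vertex in terms of the values of `f` at the neighbouring vertices. -/
lemma apply_vertex_succ (hπ : ∀ x, π x = 0 ↔ ϖ ∣ x) (hrep : ∀ x, π (rep x) = x)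
    (hT : IsHeckeOperatorT ϖ hϖ T) (f : compactInd σ) (x : F) (m : ℕ) :
    (T f).1 (vertex hϖ x (m + 1)) = ∑ a, σ (intGL (uGL (rep a)))
      (heckeFunction T (alphaGL ϖ hϖ) (f.1 (vertex hϖ (x + ϖ ^ (m + 1) * rep a) (m + 2)))) +
      heckeFunction T (alphaGL ϖ hϖ)⁻¹ (f.1 (vertex hϖ x m)) := by
  rw [apply_eq_heckeSum σ hϖ hπ hrep T hT.2, heckeSum]
  congr 1
  · refine Finset.sum_congr rfl fun a _ => ?_
    rw [vertex_mul_uAlpha]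
  · rw [vertex_mul_wAlpha, compactInd_apply_mul, ← scalarZK_mul, mul_inv_rev, intGL_wGL_inv, ← map_inv,
      map_mul, Module.End.mul_apply, IsWeight.heckeFunction_alphaGL_inv]

/-- A function on the vertices `u_x α` which is not of the form `c ↦ Φ (u_c⁻¹ v)` cannot come from
the outermost values of a function in the image of `T`. -/
def IsDetected (Φ : Module.End k V) (y : compactInd σ) : Prop :=
  (∀ m, 2 ≤ m → ∀ x : F, y.1 (vertex hϖ x m) = 0) ∧
  (∀ x : F, x ∉ integralClosure ℤ_[p] F → y.1 (vertex hϖ x 1) = 0) ∧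
  ¬ ∃ v, ∀ c : integralClosure ℤ_[p] F,
    y.1 (vertex hϖ (c : F) 1) = Φ (σ (intGL (uGL c))⁻¹ v)

/-- The operator `∑ u_x α` on the compact induction. -/
noncomputable def sumUAlpha (σ : Representation k (groupZK p F) V)
    (rep : 𝔽 → integralClosure ℤ_[p] F) : Module.End k (compactInd σ) :=
  ∑ a, compactIndRep σ (uAlpha ϖ hϖ (rep a))

lemma sumUAlpha_apply_vertex (y : compactInd σ) (x : F) (m : ℕ) :
    (sumUAlpha hϖ σ rep y).1 (vertex hϖ x (m + 1)) =
      ∑ a, y.1 (vertex hϖ ((x - rep a) / ϖ) m) := by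
  rw [sumUAlpha, LinearMap.sum_apply, Submodule.coe_sum, Finset.sum_apply]
  refine Finset.sum_congr rfl fun a _ => ?_
  rw [compactIndRep_apply, uAlpha_inv_mul_vertex]

lemma div_uniformizer_notMem (hϖ : Irreducible ϖ) {x : F} {y : integralClosure ℤ_[p] F}
    (h : ¬ ∃ c : integralClosure ℤ_[p] F, x = y + ϖ * c) :
    (x - y) / ϖ ∉ integralClosure ℤ_[p] F := fun hm => h ⟨⟨_, hm⟩, by
  change x = y + ϖ * ((x - y) / ϖ)
  rw [mul_div_cancel₀ _ (coe_uniformizer_ne_zero hϖ)]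
  ring⟩

/-- `(∑ u_x α) ^ n` moves the values of `y` at the vertices of level `1` to vertices of level
`n + 1`, without overlap. -/
lemma iterate_sumUAlpha_apply_vertex (hπ : ∀ x, π x = 0 ↔ ϖ ∣ x) (hrep : ∀ x, π (rep x) = x)
    {Φ : Module.End k V} {y : compactInd σ} (hy : IsDetected hϖ Φ y) (n : ℕ) :
    (∀ m, n + 2 ≤ m → ∀ x : F, (((sumUAlpha hϖ σ rep) ^ n) y).1 (vertex hϖ x m) = 0) ∧
    (∀ x : F, x ∉ integralClosure ℤ_[p] F →
      (((sumUAlpha hϖ σ rep) ^ n) y).1 (vertex hϖ x (n + 1)) = 0) ∧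
    ∃ A : integralClosure ℤ_[p] F, ∀ c : integralClosure ℤ_[p] F,
      (((sumUAlpha hϖ σ rep) ^ n) y).1 (vertex hϖ (A + ϖ ^ n * c) (n + 1)) =
        y.1 (vertex hϖ (c : F) 1) := by
  induction n with
  | zero => exact ⟨hy.1, hy.2.1, 0, fun c => by simp⟩
  | succ n ih =>
    obtain ⟨h1, h2, A, h3⟩ := ih
    have e : ∀ z, ((sumUAlpha hϖ σ rep) ^ (n + 1)) y = z →
        z = sumUAlpha hϖ σ rep (((sumUAlpha hϖ σ rep) ^ n) y) := by
      rintro _ rfl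
      rw [pow_succ', Module.End.mul_apply]
    rw [e _ rfl]
    refine ⟨fun m hm x => ?_, fun x hx => ?_, rep 0 + ϖ * A, fun c => ?_⟩
    · obtain ⟨m, rfl⟩ : ∃ m', m = m' + 1 := ⟨m - 1, by omega⟩
      rw [sumUAlpha_apply_vertex]
      exact Finset.sum_eq_zero fun a _ => h1 m (by omega) _
    · rw [sumUAlpha_apply_vertex]
      refine Finset.sum_eq_zero fun a _ => h2 _ (div_uniformizer_notMem hϖ ?_)
      rintro ⟨c, rfl⟩
      exact hx (rep a + ϖ * c).2
    · rw [sumUAlpha_apply_vertex, Finset.sum_eq_single 0]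
      · have e3 : (((rep 0 + ϖ * A : integralClosure ℤ_[p] F) : F) + ϖ ^ (n + 1) * c - rep 0) / ϖ =
            A + ϖ ^ n * c := by
          rw [div_eq_iff (coe_uniformizer_ne_zero hϖ)]
          push_cast
          ring
        rw [e3]
        exact h3 c
      · intro a _ ha
        refine h2 _ (div_uniformizer_notMem hϖ ?_)
        rintro ⟨c', hc'⟩
        apply ha
        have h4 : rep 0 + ϖ * A + ϖ ^ (n + 1) * c = rep a + ϖ * c' := Subtype.ext hc'
        have h5 := congrArg π h4
        simpa [hrep, (hπ ϖ).2 dvd_rfl] using h5.symm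
      · exact fun h => absurd (Finset.mem_univ _) h

/-- If `Φ (u v) = 0` for all upper unipotent `u` only for `v = 0`, then the `(∑ u_x α) ^ n y` are
linearly independent modulo the image of `T`. -/
theorem linearIndependent_iterate (hπ : ∀ x, π x = 0 ↔ ϖ ∣ x) (hrep : ∀ x, π (rep x) = x)
    (hT : IsHeckeOperatorT ϖ hϖ T)
    (hΦ : ∀ v, (∀ c, heckeFunction T (alphaGL ϖ hϖ)⁻¹ (σ (intGL (uGL c))⁻¹ v) = 0) → v = 0)
    {y : compactInd σ} (hy : IsDetected hϖ (heckeFunction T (alphaGL ϖ hϖ)⁻¹) y) :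
    LinearIndependent k fun n : ℕ => (LinearMap.range T.toLinearMap).mkQ
      (((sumUAlpha hϖ σ rep) ^ n) y) := by
  rw [linearIndependent_iff]
  intro l hl
  by_contra hne
  -- the level of the outermost vertices in the support of a vanishing linear combination
  set N := l.support.max' (Finsupp.support_nonempty_iff.2 hne) with hN
  have hlN : l N ≠ 0 := Finsupp.mem_support_iff.1 (Finset.max'_mem _ _)
  have hle : ∀ n ∈ l.support, n ≤ N := fun n hn => Finset.le_max' _ n hn
  rw [Finsupp.linearCombination_apply, Finsupp.sum] at hl
  simp only [← (LinearMap.range T.toLinearMap).mkQ.map_smul, ← map_sum] at hl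
  rw [Submodule.mkQ_apply, Submodule.Quotient.mk_eq_zero] at hl
  obtain ⟨f, hf⟩ := hl
  change T f = _ at hf
  have hiter := fun n => iterate_sumUAlpha_apply_vertex hϖ hπ hrep hy n
  have heval : ∀ z, (T f).1 z = ∑ n ∈ l.support, l n • (((sumUAlpha hϖ σ rep) ^ n) y).1 z := by
    intro z
    rw [hf, Submodule.coe_sum, Finset.sum_apply]
    rfl
  have hTf : ∀ m, N + 2 ≤ m → ∀ x : F, (T f).1 (vertex hϖ x m) = 0 := by
    intro m hm x
    rw [heval]
    refine Finset.sum_eq_zero fun n hn => ?_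
    rw [(hiter n).1 m (by have := hle n hn; omega), smul_zero]
  obtain ⟨M, hM⟩ := exists_forall_vertex_eq_zero hϖ f
  -- `f` vanishes on all vertices of level more than `N`, by descending induction on the level
  have hf0 : ∀ j m, M ≤ m + j → N + 1 ≤ m → ∀ x : F, f.1 (vertex hϖ x m) = 0 := by
    intro j
    induction j with
    | zero => exact fun m hm _ x => hM m hm x
    | succ j ih =>
      intro m hm hNm x
      refine hΦ _ fun c => ?_
      rw [← apply_vertex_add_mul]
      have h1 := apply_vertex_succ hϖ hπ hrep hT f (x + ϖ ^ m * c) m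
      rw [hTf _ (by omega), Finset.sum_eq_zero, zero_add] at h1
      · exact h1.symm
      · intro a _
        rw [ih (m + 2) (by omega) (by omega), map_zero, map_zero]
  have htop : ∀ x : F, l N • (((sumUAlpha hϖ σ rep) ^ N) y).1 (vertex hϖ x (N + 1)) =
      heckeFunction T (alphaGL ϖ hϖ)⁻¹ (f.1 (vertex hϖ x N)) := by
    intro x
    have h1 := apply_vertex_succ hϖ hπ hrep hT f x N
    rw [Finset.sum_eq_zero, zero_add, heval, Finset.sum_eq_single N] at h1
    · exact h1
    · intro n hn hnN
      have := hle n hn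
      rw [(hiter n).1 (N + 1) (by omega), smul_zero]
    · exact fun h => absurd (Finset.max'_mem _ _) h
    · intro a _
      rw [hf0 M (N + 2) (by omega) (by omega), map_zero, map_zero]
  obtain ⟨A, hA⟩ := (hiter N).2.2
  refine hy.2.2 ⟨(l N)⁻¹ • f.1 (vertex hϖ (A : F) N), fun c => ?_⟩
  rw [map_smul, map_smul, ← apply_vertex_add_mul, ← htop, hA, inv_smul_smul₀ hlN]

end Vertices

/-! ### Relations in the cokernel -/

namespace IsMonomialFamily

variable {𝔽 : Type*} [Field 𝔽] [Fintype 𝔽] {L V : Type*} [CommRing L] [AddCommGroup V] [Module L V]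
  {τ : 𝔽 →+* L} {p : ℕ} {ρ : Representation L (GL (Fin 2) 𝔽) V} {r : ℕ} {ε : L} {g : ℕ → V}

/-- A linear map which kills all the monomials except for `g r` reads off the coefficients of a
vector from its translates by the upper unipotent matrices. -/
lemma map_u_sum (h : IsMonomialFamily τ p ρ r ε g) (Φ : V →ₗ[L] V) (hΦ : ∀ i, i ≠ r → Φ (g i) = 0)
    (l : ℕ → L) (b : 𝔽) : Φ (ρ (uGL b) (∑ i ∈ Finset.range (r + 1), l i • g i)) =
      ∑ t ∈ Finset.range (Fintype.card 𝔽), τ b ^ t •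
        (if t ≤ r then ((r.choose t : L) * l (r - t)) • Φ (g r) else 0) := by
  simp only [map_sum, map_smul, h.u_apply, Finset.smul_sum]
  rw [Finset.sum_comm]
  refine Finset.sum_congr rfl fun t _ => ?_
  split_ifs with ht
  · rw [Finset.sum_eq_single (r - t)]
    · rw [Nat.sub_add_cancel ht, Nat.choose_symm ht]
      simp only [smul_smul]
      congr 1
      ring
    · intro i _ hi
      rw [hΦ _ (by omega)]
      simp
    · intro hn
      simp at hn
  · rw [smul_zero]
    refine Finset.sum_eq_zero fun i _ => ?_
    rw [hΦ _ (by omega)]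
    simp

lemma map_u_apply (h : IsMonomialFamily τ p ρ r ε g) (Φ : V →ₗ[L] V)
    (hΦ : ∀ i, i ≠ r → Φ (g i) = 0) {t : ℕ} (ht : t ≤ r) (b : 𝔽) :
    Φ (ρ (uGL b) (g (r - t))) = (τ b ^ t * (r.choose t : L)) • Φ (g r) := by
  have := h.r_lt
  rw [h.u_apply, map_sum, Finset.sum_eq_single t]
  · rw [map_smul, map_smul, Nat.sub_add_cancel ht, Nat.choose_symm ht, mul_smul]
  · intro i _ hi
    rw [map_smul, map_smul, hΦ _ (by omega), smul_zero, smul_zero]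
  · intro hn
    simp at hn
    omega

lemma eq_zero_of_map_u_eq_zero [Fact p.Prime] [CharP L p] (h : IsMonomialFamily τ p ρ r ε g)
    (htf : ∀ (l : L) (x : V), l • x = 0 → l = 0 ∨ x = 0) (Φ : V →ₗ[L] V)
    (hΦ : ∀ i, i ≠ r → Φ (g i) = 0) (hne : Φ (g r) ≠ 0) {x : V}
    (hx : ∀ b, Φ (ρ (uGL b) x) = 0) : x = 0 := by
  obtain ⟨l, rfl⟩ := h.exists_eq_sum x
  have hr := h.r_lt
  refine Finset.sum_eq_zero fun i hi => ?_
  rw [Finset.mem_range] at hi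
  by_cases hc : ChooseLE p i r
  · have h1 := coeff_eq_zero_of_polyFun_eq_zero τ
      (fun b => (h.map_u_sum Φ hΦ l b).symm.trans (hx b)) (j := r - i) (by omega)
    rw [if_pos (by omega)] at h1
    have h2 := (htf _ _ h1).resolve_right hne
    rw [Nat.sub_sub_self (by omega)] at h2
    have h3 : ((r.choose (r - i) : ℕ) : L) • (l i • g i) = 0 := by
      rw [smul_smul, h2, zero_smul]
    exact (htf _ _ h3).resolve_left (hc.sub.cast_ne_zero L)
  · rw [show g i = 0 from by_contra fun hne => hc ((h.ne_zero_iff i).1 hne), smul_zero]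

/-- The function `b ↦ b ^ s • Φ (g r)` has a coefficient in degree `s`, unlike the functions
`b ↦ Φ (u_{-b} x)`, if `s` is not below `r`. -/
lemma not_exists_pow_smul_eq [Fact p.Prime] [CharP L p] (h : IsMonomialFamily τ p ρ r ε g)
    (Φ : V →ₗ[L] V)
    (hΦ : ∀ i, i ≠ r → Φ (g i) = 0) (hne : Φ (g r) ≠ 0) {s : ℕ} (hs : s < Fintype.card 𝔽)
    (hsr : ¬ ChooseLE p s r) : ¬ ∃ x, ∀ b, τ b ^ s • Φ (g r) = Φ (ρ (uGL (-b)) x) := by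
  rintro ⟨x, hx⟩
  obtain ⟨l, rfl⟩ := h.exists_eq_sum x
  have h1 := coeff_eq_of_polyFun_eq τ (a := fun t => if t = s then Φ (g r) else 0)
    (b := fun t => (-1) ^ t • (if t ≤ r then ((r.choose t : L) * l (r - t)) • Φ (g r) else 0))
    (fun b => ?_) hs
  · simp only [if_true] at h1
    rw [cast_choose_eq_zero L hsr, zero_mul, zero_smul, ite_self, smul_zero] at h1
    exact hne h1
  · rw [Finset.sum_eq_single s]
    · rw [if_pos rfl, hx, h.map_u_sum Φ hΦ]
      refine Finset.sum_congr rfl fun t _ => ?_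
      rw [map_neg, neg_pow, mul_comm, mul_smul, ← Int.cast_smul_eq_zsmul L]
      simp
    · intro t _ ht
      rw [if_neg ht, smul_zero]
    · exact fun hn => absurd (Finset.mem_range.2 hs) hn

/-- The sum of the translates of `g 0` vanishes unless `r` is maximal. -/
lemma sum_u_apply_zero (h : IsMonomialFamily τ p ρ r ε g) (hr : r ≠ Fintype.card 𝔽 - 1) :
    ∑ b, ρ (uGL b) (g 0) = 0 := by
  have h1 : 1 < Fintype.card 𝔽 := Fintype.one_lt_card
  have := h.r_lt
  simp only [h.u_apply]
  rw [Finset.sum_comm]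
  refine Finset.sum_eq_zero fun t ht => ?_
  rw [Finset.mem_range] at ht
  rw [← Finset.sum_smul, sum_map_pow_eq_ite τ (by omega)]
  split_ifs with hq
  · rw [h.eq_zero_of_lt (by omega), smul_zero, smul_zero]
  · rw [zero_smul]

end IsMonomialFamily

section Relations

variable {p : ℕ} [Fact p.Prime] {F : Type*} [NormedField F] [NormedAlgebra ℚ_[p] F]
  [Algebra ℤ_[p] F] [IsScalarTower ℤ_[p] ℚ_[p] F] [FiniteDimensional ℚ_[p] F]
  {k V : Type*} [Field k] [AddCommGroup V] [Module k V]
  {σ : Representation k (groupZK p F) V}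
  {ϖ : integralClosure ℤ_[p] F} (hϖ : Irreducible ϖ) {𝔽 : Type*} [Field 𝔽] [Fintype 𝔽]
  {π : integralClosure ℤ_[p] F →+* 𝔽} {rep : 𝔽 → integralClosure ℤ_[p] F}
  {T : Representation.IntertwiningMap (compactIndRep σ) (compactIndRep σ)}

/-- The support of a Hecke operator consists of the inverses of the cosets of the `u_x α` and of
`w α`. -/
lemma heckeFunction_eq_zero_of_notMem (hπ : ∀ x, π x = 0 ↔ ϖ ∣ x) (hrep : ∀ x, π (rep x) = x)
    (hT : IsHeckeOperatorT ϖ hϖ T) {x : GL (Fin 2) F}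
    (hx : ∀ a, x⁻¹ * uAlpha ϖ hϖ (rep a) ∉ groupZK p F) (hx' : x⁻¹ * wAlpha ϖ hϖ ∉ groupZK p F) :
    heckeFunction T x⁻¹ = 0 := by
  by_contra hne
  obtain ⟨h₁, hh₁, h₂, hh₂, e⟩ := DoubleCoset.mem_doubleCoset.1 (hT.2 hne)
  obtain ⟨h', h⟩ := groupZK_mul_alphaGL_inv hϖ hπ hrep ⟨h₂, hh₂⟩⁻¹ ⟨h₁, hh₁⟩
  have e' : x = ((⟨h₂, hh₂⟩⁻¹ : groupZK p F) : GL (Fin 2) F) *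
      (((⟨h₁, hh₁⟩ : groupZK p F) : GL (Fin 2) F) * alphaGL ϖ hϖ)⁻¹ := by
    rw [← inv_inv x, e, mul_inv_rev]
    rfl
  rw [← e'] at h
  rcases h with ⟨a, h⟩ | h
  · refine hx a ?_
    rw [h, mul_inv_rev, inv_mul_cancel_right]
    exact (h'⁻¹).2
  · refine hx' ?_
    rw [h, mul_inv_rev, inv_mul_cancel_right]
    exact (h'⁻¹).2

/-- The value of a Hecke operator at a function with support in `𝒦`. -/
lemma apply_single_one (hπ : ∀ x, π x = 0 ↔ ϖ ∣ x) (hrep : ∀ x, π (rep x) = x)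
    (hT : IsHeckeOperatorT ϖ hϖ T) (v : V) :
    T (compactIndSingle σ 1 v) = ∑ a, compactIndSingle σ (uAlpha ϖ hϖ (rep a))
        (heckeFunction T (alphaGL ϖ hϖ)⁻¹ (σ (intGL (uGL (rep a)))⁻¹ v)) +
      compactIndSingle σ (wAlpha ϖ hϖ)
        (heckeFunction T (alphaGL ϖ hϖ)⁻¹ (σ (intGL (wGL _))⁻¹ v)) := by
  have hu : ∀ x, (T (compactIndSingle σ 1 v)).1 (uAlpha ϖ hϖ x) =
      heckeFunction T (alphaGL ϖ hϖ)⁻¹ (σ (intGL (uGL x))⁻¹ v) := by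
    intro x
    rw [intertwining_apply_single, mul_one, uAlpha, mul_inv_rev, ← Subgroup.coe_inv,
      heckeFunction_mul_right]
  have hw : (T (compactIndSingle σ 1 v)).1 (wAlpha ϖ hϖ) =
      heckeFunction T (alphaGL ϖ hϖ)⁻¹ (σ (intGL (wGL _))⁻¹ v) := by
    rw [intertwining_apply_single, mul_one, wAlpha, mul_inv_rev, ← Subgroup.coe_inv,
      heckeFunction_mul_right]
  have hcoset : ∀ (f f' : compactInd σ) (x y : GL (Fin 2) F), x⁻¹ * y ∈ groupZK p F →
      f.1 y = f'.1 y → f.1 x = f'.1 x := by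
    intro f f' x y hxy h
    have e : x = y * ((⟨x⁻¹ * y, hxy⟩⁻¹ : groupZK p F) : GL (Fin 2) F) := by
      rw [Subgroup.coe_inv]
      group
    rw [e, compactInd_apply_mul, compactInd_apply_mul, h]
  simp only [← hu, ← hw]
  set f := T (compactIndSingle σ 1 v) with hf
  have hval : ∀ x, (∑ a, compactIndSingle σ (uAlpha ϖ hϖ (rep a)) (f.1 (uAlpha ϖ hϖ (rep a))) +
      compactIndSingle σ (wAlpha ϖ hϖ) (f.1 (wAlpha ϖ hϖ))).1 x =
      ∑ a, (compactIndSingle σ (uAlpha ϖ hϖ (rep a)) (f.1 (uAlpha ϖ hϖ (rep a)))).1 x +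
      (compactIndSingle σ (wAlpha ϖ hϖ) (f.1 (wAlpha ϖ hϖ))).1 x := by
    intro x
    rw [Submodule.coe_add, Submodule.coe_sum, Pi.add_apply, Finset.sum_apply]
  refine Subtype.ext (funext fun x => ?_)
  by_cases h1 : ∃ a, x⁻¹ * uAlpha ϖ hϖ (rep a) ∈ groupZK p F
  · obtain ⟨a, ha⟩ := h1
    refine hcoset _ _ x _ ha ?_
    rw [hval, compactIndSingle_apply_of_notMem (uAlpha_wAlpha_notMem hϖ _), add_zero,
      Finset.sum_eq_single a, compactIndSingle_apply_self]
    · intro b _ hb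
      exact compactIndSingle_apply_of_notMem
        (fun h => hb (eq_of_uAlpha_rep_mem hϖ hπ hrep h)) _
    · exact fun h => absurd (Finset.mem_univ _) h
  · by_cases h2 : x⁻¹ * wAlpha ϖ hϖ ∈ groupZK p F
    · refine hcoset _ _ x _ h2 ?_
      rw [hval, compactIndSingle_apply_self, Finset.sum_eq_zero, zero_add]
      exact fun a _ => compactIndSingle_apply_of_notMem (wAlpha_uAlpha_notMem hϖ _) _
    · push Not at h1
      rw [hval, compactIndSingle_apply_of_notMem h2, Finset.sum_eq_zero, add_zero, hf,
        intertwining_apply_single, mul_one, heckeFunction_eq_zero_of_notMem hϖ hπ hrep hT h1 h2]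
      · rfl
      · exact fun a _ => compactIndSingle_apply_of_notMem (h1 a) _

end Relations

section PowerSums

variable {p : ℕ} [Fact p.Prime] {F : Type*} [NormedField F] [NormedAlgebra ℚ_[p] F]
  [Algebra ℤ_[p] F]
  {k V : Type*} [Field k] [AddCommGroup V] [Module k V]
  {σ : Representation k (groupZK p F) V}
  {ϖ : integralClosure ℤ_[p] F} (hϖ : Irreducible ϖ) {𝔽 : Type*} [Field 𝔽] [Fintype 𝔽]
  {π : integralClosure ℤ_[p] F →+* 𝔽} {τ : 𝔽 →+* k} {rep : 𝔽 → integralClosure ℤ_[p] F}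
  {L : Type*} [CommRing L] [Algebra k L] [Module L V] [IsScalarTower k L V]
  {ρ : Representation L (GL (Fin 2) 𝔽) V} {r : ℕ} {ε : L} {g : ℕ → V}
  {T : Representation.IntertwiningMap (compactIndRep σ) (compactIndRep σ)}

/-- The sum of the `λ ^ s • [u_λ α, v]` over the representatives of the residue field. -/
noncomputable def powerSum (σ : Representation k (groupZK p F) V) (τ : 𝔽 →+* k)
    (rep : 𝔽 → integralClosure ℤ_[p] F) (s : ℕ) (v : V) : compactInd σ :=
  ∑ a, τ a ^ s • compactIndSingle σ (uAlpha ϖ hϖ (rep a)) v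

/-- Addition of `x` permutes the representatives of the residue field up to multiples of `ϖ`. -/
lemma exists_carry (hπ : ∀ x, π x = 0 ↔ ϖ ∣ x) (hrep : ∀ x, π (rep x) = x)
    (x : integralClosure ℤ_[p] F) :
    ∃ c : 𝔽 → integralClosure ℤ_[p] F, ∀ a, x + rep a = rep (a + π x) + ϖ * c a := by
  have h : ∀ a, ∃ c, x + rep a = rep (a + π x) + ϖ * c := by
    intro a
    obtain ⟨c, hc⟩ := (hπ (x + rep a - rep (a + π x))).1 (by
      rw [map_sub, map_add, hrep, hrep, add_comm, sub_self])
    exact ⟨c, by rw [← hc]; ring⟩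
  exact ⟨fun a => (h a).choose, fun a => (h a).choose_spec⟩

/-- The sum of the carries in the addition of `x` to the representatives is divisible by `ϖ`
if `ϖ ^ 2` divides the number of the representatives. -/
lemma sum_carry_eq_zero (hϖ : Irreducible ϖ) (hπ : ∀ x, π x = 0 ↔ ϖ ∣ x)
    (hq : ϖ ^ 2 ∣ (Fintype.card 𝔽 : integralClosure ℤ_[p] F)) {x : integralClosure ℤ_[p] F}
    {c : 𝔽 → integralClosure ℤ_[p] F} (hc : ∀ a, x + rep a = rep (a + π x) + ϖ * c a) :
    ∑ a, π (c a) = 0 := by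
  have h1 := Finset.sum_congr (rfl : (Finset.univ : Finset 𝔽) = Finset.univ) fun a _ => hc a
  have hp : ∑ a, rep (a + π x) = ∑ a, rep a := Equiv.sum_comp (Equiv.addRight (π x)) rep
  rw [Finset.sum_add_distrib, Finset.sum_add_distrib, ← Finset.mul_sum, hp, add_comm,
    add_right_inj, Finset.sum_const,
    Finset.card_univ, nsmul_eq_mul] at h1
  obtain ⟨m, hm⟩ := hq
  rw [hm, pow_two, mul_assoc, mul_assoc] at h1
  have h2 := mul_left_cancel₀ hϖ.ne_zero h1
  rw [← map_sum, ← h2, hπ]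
  exact dvd_mul_right _ _

lemma compactIndRep_uGL_single {x : integralClosure ℤ_[p] F} {c : 𝔽 → integralClosure ℤ_[p] F}
    (hc : ∀ a, x + rep a = rep (a + π x) + ϖ * c a) (a : 𝔽) (v : V) :
    compactIndRep σ (intGL (uGL x)) (compactIndSingle σ (uAlpha ϖ hϖ (rep a)) v) =
      compactIndSingle σ (uAlpha ϖ hϖ (rep (a + π x))) (σ (intGL (uGL (c a))) v) := by
  rw [compactIndRep_single, uGL_mul_uAlpha, hc, uAlpha_add_mul, compactIndSingle_mul]

/-- The upper unipotent matrices act on the power sums by the binomial formula. -/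
lemma compactIndRep_powerSum (hπ : ∀ x, π x = 0 ↔ ϖ ∣ x) (hrep : ∀ x, π (rep x) = x) (s : ℕ)
    {v : V} (hv : ∀ c : integralClosure ℤ_[p] F, σ (intGL (uGL c)) v = v)
    (x : integralClosure ℤ_[p] F) :
    compactIndRep σ (intGL (uGL x)) (powerSum hϖ σ τ rep s v) =
      powerSum hϖ σ τ rep s v + ∑ t ∈ Finset.range s,
        ((-τ (π x)) ^ (s - t) * (s.choose t : k)) • powerSum hϖ σ τ rep t v := by
  obtain ⟨c, hc⟩ := exists_carry hπ hrep x
  have e : compactIndRep σ (intGL (uGL x)) (powerSum hϖ σ τ rep s v) =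
      ∑ a, (τ a + -τ (π x)) ^ s • compactIndSingle σ (uAlpha ϖ hϖ (rep a)) v := by
    rw [powerSum, map_sum, ← Equiv.sum_comp (Equiv.addRight (π x))
      (fun a => (τ a + -τ (π x)) ^ s • compactIndSingle σ (uAlpha ϖ hϖ (rep a)) v)]
    refine Finset.sum_congr rfl fun a _ => ?_
    rw [map_smul, compactIndRep_uGL_single hϖ hc, hv]
    simp
  rw [e]
  simp only [add_pow, Finset.sum_range_succ, add_smul, Finset.sum_add_distrib, Finset.sum_smul,
    Nat.sub_self, pow_zero, mul_one, Nat.choose_self, Nat.cast_one]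
  rw [add_comm, powerSum, Finset.sum_comm]
  congr 1
  refine Finset.sum_congr rfl fun t _ => ?_
  rw [powerSum, Finset.smul_sum]
  refine Finset.sum_congr rfl fun a _ => ?_
  rw [smul_smul]
  congr 1
  ring

lemma sum_smul_single_eq_sum_powerSum (h : 𝔽 → k) (v : V) :
    ∑ a, h a • compactIndSingle σ (uAlpha ϖ hϖ (rep a)) v =
      ∑ t ∈ Finset.range (Fintype.card 𝔽), interpCoeff τ h t • powerSum hϖ σ τ rep t v := by
  simp only [powerSum, Finset.smul_sum]
  rw [Finset.sum_comm]
  refine Finset.sum_congr rfl fun a _ => ?_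
  rw [← sum_interpCoeff τ h a, Finset.sum_smul]
  refine Finset.sum_congr rfl fun t _ => ?_
  rw [smul_smul, smul_eq_mul, mul_comm]

variable [IsScalarTower ℤ_[p] ℚ_[p] F] [FiniteDimensional ℚ_[p] F]

lemma IsWeight.inv_intGL_uGL_apply (hW : IsWeight σ π τ ρ r ε g) (c : integralClosure ℤ_[p] F)
    (x : V) : σ (intGL (uGL c))⁻¹ x = ρ (uGL (-π c)) x := by
  rw [← map_inv, uGL_inv, hW.u_apply, map_neg]

lemma IsWeight.hecke_u_apply [CharP L p] (hW : IsWeight σ π τ ρ r ε g) (hπ : ∀ x, π x = 0 ↔ ϖ ∣ x)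
    (hsurj : Function.Surjective π) (hT : IsHeckeOperatorT ϖ hϖ T)
    (c : integralClosure ℤ_[p] F) :
    σ (intGL (uGL c)) (heckeFunction T (alphaGL ϖ hϖ)⁻¹ (g r)) =
      heckeFunction T (alphaGL ϖ hϖ)⁻¹ (g r) := by
  obtain ⟨l, hl⟩ := (hW.heckeFunction_apply hπ hsurj hT).2.2.1
  rw [hl, hW.map_smul, hW.u_apply, hW.monomial.u_apply_top]

/-- The image of `[1, g (r - t)]` under the Hecke operator. -/
lemma IsWeight.smul_powerSum_add_mem [CharP L p] (hW : IsWeight σ π τ ρ r ε g)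
    (hπ : ∀ x, π x = 0 ↔ ϖ ∣ x)
    (hsurj : Function.Surjective π) (hrep : ∀ x, π (rep x) = x) (hT : IsHeckeOperatorT ϖ hϖ T)
    {t : ℕ} (ht : ChooseLE p t r) :
    ((-1) ^ t * (r.choose t : k)) •
        powerSum hϖ σ τ rep t (heckeFunction T (alphaGL ϖ hϖ)⁻¹ (g r)) +
      (if t = r then compactIndSingle σ (wAlpha ϖ hϖ)
        (ε • heckeFunction T (alphaGL ϖ hϖ)⁻¹ (g r)) else 0) ∈
      LinearMap.range T.toLinearMap := by
  obtain ⟨hlin, hpos, -, -⟩ := hW.heckeFunction_apply hπ hsurj hT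
  refine ⟨compactIndSingle σ 1 (g (r - t)), ?_⟩
  change T _ = _
  rw [apply_single_one hϖ hπ hrep hT, powerSum, Finset.smul_sum]
  congr 1
  · refine Finset.sum_congr rfl fun a _ => ?_
    rw [hW.inv_intGL_uGL_apply, hrep]
    let Φ : V →ₗ[L] V := { toFun := heckeFunction T (alphaGL ϖ hϖ)⁻¹,
                           map_add' := map_add _, map_smul' := hlin }
    have h1 := hW.monomial.map_u_apply Φ hpos ht.le (-a)
    change heckeFunction T (alphaGL ϖ hϖ)⁻¹ _ = _ • heckeFunction T (alphaGL ϖ hϖ)⁻¹ _ at h1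
    have e : ((algebraMap k L).comp τ) (-a) ^ t * (r.choose t : L) =
        algebraMap k L ((-1) ^ t * (r.choose t : k) * τ a ^ t) := by
      simp only [RingHom.comp_apply, map_neg, map_mul, map_pow, map_natCast, map_one]
      rw [neg_pow]
      ring
    rw [h1, e, algebraMap_smul, _root_.map_smul, smul_smul]
  · have htr := ht.le
    rw [intGL_wGL_inv, hW.w_apply, hW.monomial.w_apply _ ht.sub, hlin, Nat.sub_sub_self htr]
    split_ifs with h
    · rw [h]
    · rw [hpos _ h, smul_zero, map_zero]

/-- The `powerSum t` with `t` below `r`, other than `powerSum r`, vanish in the cokernel. -/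
lemma IsWeight.powerSum_mem [CharP k p] [CharP L p] (hW : IsWeight σ π τ ρ r ε g)
    (hπ : ∀ x, π x = 0 ↔ ϖ ∣ x)
    (hsurj : Function.Surjective π) (hrep : ∀ x, π (rep x) = x) (hT : IsHeckeOperatorT ϖ hϖ T)
    {t : ℕ} (ht : ChooseLE p t r) (htr : t ≠ r) :
    powerSum hϖ σ τ rep t (heckeFunction T (alphaGL ϖ hϖ)⁻¹ (g r)) ∈
      LinearMap.range T.toLinearMap := by
  have h := smul_powerSum_add_mem (τ := τ) hϖ hW hπ hsurj hrep hT ht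
  rw [if_neg htr, add_zero] at h
  refine (Submodule.smul_mem_iff _ ?_).1 h
  exact mul_ne_zero (pow_ne_zero _ (neg_ne_zero.2 one_ne_zero)) (ht.cast_ne_zero k)

/-- In the cokernel `powerSum r` is a multiple of `[w α, g r]`. -/
lemma IsWeight.exists_powerSum_add_mem [CharP L p] (hW : IsWeight σ π τ ρ r ε g)
    (hπ : ∀ x, π x = 0 ↔ ϖ ∣ x)
    (hsurj : Function.Surjective π) (hrep : ∀ x, π (rep x) = x) (hT : IsHeckeOperatorT ϖ hϖ T) :
    ∃ κ : k, powerSum hϖ σ τ rep r (heckeFunction T (alphaGL ϖ hϖ)⁻¹ (g r)) +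
      κ • compactIndSingle σ (wAlpha ϖ hϖ) (ε • heckeFunction T (alphaGL ϖ hϖ)⁻¹ (g r)) ∈
      LinearMap.range T.toLinearMap := by
  have h := smul_powerSum_add_mem (τ := τ) hϖ hW hπ hsurj hrep hT (chooseLE_refl Fact.out r)
  rw [if_pos rfl, Nat.choose_self, Nat.cast_one, mul_one] at h
  refine ⟨(-1) ^ r, ?_⟩
  have h2 := Submodule.smul_mem _ ((-1 : k) ^ r) h
  rw [smul_add, smul_smul, ← mul_pow, neg_one_mul, neg_neg, one_pow, one_smul] at h2
  exact h2

end PowerSums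

section Invariance

variable {p : ℕ} [Fact p.Prime] {F : Type*} [NormedField F] [NormedAlgebra ℚ_[p] F]
  [Algebra ℤ_[p] F] [IsScalarTower ℤ_[p] ℚ_[p] F] [FiniteDimensional ℚ_[p] F]
  {k V : Type*} [Field k] [AddCommGroup V] [Module k V]
  {σ : Representation k (groupZK p F) V}
  {ϖ : integralClosure ℤ_[p] F} (hϖ : Irreducible ϖ) {𝔽 : Type*} [Field 𝔽] [Fintype 𝔽]
  {π : integralClosure ℤ_[p] F →+* 𝔽} {rep : 𝔽 → integralClosure ℤ_[p] F}
  {T : Representation.IntertwiningMap (compactIndRep σ) (compactIndRep σ)}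

lemma compactIndRep_mem_range (x : GL (Fin 2) F) {f : compactInd σ}
    (hf : f ∈ LinearMap.range T.toLinearMap) :
    compactIndRep σ x f ∈ LinearMap.range T.toLinearMap := by
  obtain ⟨f, rfl⟩ := hf
  exact ⟨compactIndRep σ x f, Representation.IntertwiningMap.isIntertwining _ _ T x f⟩

/-- The image of `y` in the cokernel of `T` is fixed by the image of the subgroup `S` of
`GL₂(𝒪_F)`. -/
def IsFixedModRange (T : Representation.IntertwiningMap (compactIndRep σ) (compactIndRep σ))
    (S : Subgroup (GL (Fin 2) (integralClosure ℤ_[p] F))) (y : compactInd σ) : Prop :=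
  ∀ κ ∈ S, compactIndRep σ (intGL κ : GL (Fin 2) F) y - y ∈ LinearMap.range T.toLinearMap

lemma mem_fixedVectors_cokernelRep {S : Subgroup (GL (Fin 2) (integralClosure ℤ_[p] F))}
    {y : compactInd σ} (hy : IsFixedModRange T S y) :
    (LinearMap.range T.toLinearMap).mkQ y ∈ fixedVectors (cokernelRep T)
      (S.map ((groupZK p F).subtype.comp intGL)) := by
  rintro ⟨_, κ, hκ, rfl⟩
  exact (Submodule.Quotient.eq _).2 (hy κ hκ)

lemma isFixedModRange_unipSubgroup {m : ℕ} {y : compactInd σ}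
    (hy : IsFixedModRange T (congrSubgroup ϖ m) y)
    (hu : ∀ x, compactIndRep σ ((intGL (uGL x) : groupZK p F) : GL (Fin 2) F) y - y ∈
      LinearMap.range T.toLinearMap) : IsFixedModRange T (unipSubgroup ϖ m) y := by
  intro κ hκ
  obtain ⟨x, κ', hκ', rfl⟩ := exists_eq_uGL_mul_of_mem_unipSubgroup hκ
  have h1 := compactIndRep_mem_range ((intGL (uGL x) : groupZK p F) : GL (Fin 2) F) (hy κ' hκ')
  have h2 := Submodule.add_mem _ h1 (hu x)
  rw [map_sub, sub_add_sub_cancel, ← Module.End.mul_apply, ← map_mul, ← Subgroup.coe_mul,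
    ← map_mul] at h2
  exact h2

lemma isFixedModRange_sumUAlpha {m : ℕ} {y : compactInd σ}
    (hy : IsFixedModRange T (congrSubgroup ϖ m) y) :
    IsFixedModRange T (congrSubgroup ϖ (m + 1)) (sumUAlpha hϖ σ rep y) := by
  intro κ hκ
  rw [sumUAlpha, LinearMap.sum_apply, map_sum, ← Finset.sum_sub_distrib]
  refine Submodule.sum_mem _ fun a _ => ?_
  obtain ⟨κ', hκ', e⟩ := exists_congrSubgroup_mul_eq ϖ hϖ hκ (rep a)
  rw [← Module.End.mul_apply, ← map_mul, uAlpha, e, map_mul, Module.End.mul_apply, ← map_sub]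
  exact compactIndRep_mem_range _ (hy κ' hκ')

lemma isFixedModRange_unipSubgroup_sumUAlpha (hπ : ∀ x, π x = 0 ↔ ϖ ∣ x)
    (hrep : ∀ x, π (rep x) = x) {m : ℕ} (hm : m ≠ 0) {y : compactInd σ}
    (hy : IsFixedModRange T (unipSubgroup ϖ m) y) :
    IsFixedModRange T (unipSubgroup ϖ m) (sumUAlpha hϖ σ rep y) := by
  refine isFixedModRange_unipSubgroup (fun κ hκ => ?_) (fun x => ?_)
  · rw [sumUAlpha, LinearMap.sum_apply, map_sum, ← Finset.sum_sub_distrib]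
    refine Submodule.sum_mem _ fun a _ => ?_
    obtain ⟨κ', hκ', e⟩ := exists_unipSubgroup_mul_eq ϖ hϖ hm hκ (rep a)
    rw [← Module.End.mul_apply, ← map_mul, uAlpha, e, map_mul, Module.End.mul_apply, ← map_sub]
    exact compactIndRep_mem_range _ (hy κ' hκ')
  · obtain ⟨c, hc⟩ := exists_carry hπ hrep x
    rw [sumUAlpha, LinearMap.sum_apply, map_sum]
    conv => enter [2, 2]; rw [← Equiv.sum_comp (Equiv.addRight (π x))]
    rw [← Finset.sum_sub_distrib]
    refine Submodule.sum_mem _ fun a _ => ?_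
    rw [← Module.End.mul_apply, ← map_mul, uGL_mul_uAlpha, hc, uAlpha_add_mul, map_mul,
      Module.End.mul_apply, Equiv.coe_addRight, ← map_sub]
    exact compactIndRep_mem_range _ (hy _ (uGL_mem_unipSubgroup ϖ m _))

lemma isFixedModRange_single (hcongr : ∀ κ ∈ congrSubgroup ϖ 1, σ (intGL κ) = 1)
    (v : 𝔽 → V) : IsFixedModRange T (congrSubgroup ϖ 2)
      (∑ a, compactIndSingle σ (uAlpha ϖ hϖ (rep a)) (v a)) := by
  intro κ hκ
  rw [map_sum, ← Finset.sum_sub_distrib]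
  refine Submodule.sum_mem _ fun a _ => ?_
  obtain ⟨κ', hκ', e⟩ := exists_congrSubgroup_mul_eq ϖ hϖ (m := 1) hκ (rep a)
  rw [compactIndRep_single, uAlpha, e, compactIndSingle_mul, hcongr κ' hκ', Module.End.one_apply,
    sub_self]
  exact Submodule.zero_mem _

/-- If the image of `S ^ n₀ y` in the cokernel is fixed by a compact open subgroup, where `S` is
the operator `∑ u_x α` and `y` is detected on the outermost vertices, then the images of the
`S ^ n y` for `n ≥ n₀` are linearly independent vectors fixed by this subgroup. -/
theorem not_isAdmissibleRep_of_isDetected (hπ : ∀ x, π x = 0 ↔ ϖ ∣ x)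
    (hrep : ∀ x, π (rep x) = x) (hT : IsHeckeOperatorT ϖ hϖ T)
    (hΦ : ∀ v, (∀ c, heckeFunction T (alphaGL ϖ hϖ)⁻¹ (σ (intGL (uGL c))⁻¹ v) = 0) → v = 0)
    {y : compactInd σ} (hy : IsDetected hϖ (heckeFunction T (alphaGL ϖ hϖ)⁻¹) y) {m n₀ : ℕ}
    (hm : m ≠ 0) (hfix : IsFixedModRange T (unipSubgroup ϖ m) ((sumUAlpha hϖ σ rep ^ n₀) y)) :
    ¬ IsAdmissibleRep (cokernelRep T) := by
  rintro ⟨-, hadm⟩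
  have hfin := hadm _ (isOpen_map_unipSubgroup hϖ hm) (isCompact_map_unipSubgroup hϖ hm)
  have hall : ∀ n, IsFixedModRange T (unipSubgroup ϖ m) ((sumUAlpha hϖ σ rep ^ (n + n₀)) y) := by
    intro n
    induction n with
    | zero => rwa [zero_add]
    | succ n ih =>
      rw [show n + 1 + n₀ = (n + n₀) + 1 by ring, pow_succ', Module.End.mul_apply]
      exact isFixedModRange_unipSubgroup_sumUAlpha hϖ hπ hrep hm ih
  have hli := (linearIndependent_iterate hϖ hπ hrep hT hΦ hy).comp (fun n => n + n₀)
    (add_left_injective n₀)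
  have hli' : LinearIndependent k fun n : ℕ =>
      (⟨_, mem_fixedVectors_cokernelRep (hall n)⟩ : fixedVectors (cokernelRep T)
        ((unipSubgroup ϖ m).map ((groupZK p F).subtype.comp intGL))) :=
    LinearIndependent.of_comp (Submodule.subtype _) hli
  exact not_finite_iff_infinite.2 inferInstance hli'.finite

end Invariance

/-! ### Invariant vectors in the cokernel -/

section Vectors

variable {p : ℕ} [Fact p.Prime] {F : Type*} [NormedField F] [NormedAlgebra ℚ_[p] F]
  [Algebra ℤ_[p] F] {k V : Type*} [Field k] [AddCommGroup V] [Module k V]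
  {σ : Representation k (groupZK p F) V}
  {ϖ : integralClosure ℤ_[p] F} (hϖ : Irreducible ϖ) {𝔽 : Type*} [Field 𝔽] [Fintype 𝔽]
  {π : integralClosure ℤ_[p] F →+* 𝔽} {τ : 𝔽 →+* k} {rep : 𝔽 → integralClosure ℤ_[p] F}

lemma powerSum_eq_sum_single (s : ℕ) (v : V) : powerSum hϖ σ τ rep s v =
    ∑ a, compactIndSingle σ (uAlpha ϖ hϖ (rep a)) (τ a ^ s • v) := by
  simp only [powerSum, map_smul]

lemma uAlpha_mul_wAlpha (y : integralClosure ℤ_[p] F) :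
    uAlpha ϖ hϖ y * wAlpha ϖ hϖ = (1 : GL (Fin 2) F) *
      (intGL (uGL y) * (intGL (wGL _) * scalarZK p (uniformizerUnit ϖ hϖ)) : groupZK p F) := by
  rw [uAlpha_eq_vertex, vertex_mul_wAlpha hϖ (y : F) 0, vertex, pow_zero, mul_one, one_mul,
    Subgroup.coe_mul (groupZK p F) (intGL (uGL y)), coe_intGL_uGL]

/-- If `ϖ ^ 2` divides `p` and the residue field is the prime field, then with the natural numbers
as representatives the carries in the addition of `x` are all equal. -/
lemma carry_eq_of_natCast (hϖ : Irreducible ϖ) (hπ : ∀ x, π x = 0 ↔ ϖ ∣ x)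
    [CharP 𝔽 p] (hp : ϖ ^ 2 ∣ (p : integralClosure ℤ_[p] F)) {n : 𝔽 → ℕ}
    (hn : ∀ a, (n a : 𝔽) = a) {x : integralClosure ℤ_[p] F} {c : 𝔽 → integralClosure ℤ_[p] F}
    (hc : ∀ a, x + (n a : integralClosure ℤ_[p] F) = (n (a + π x) : ℕ) + ϖ * c a) (a : 𝔽) :
    π (c a) = π (c 0) := by
  have h1 : ϖ ^ 2 ∣ ϖ * (c a - c 0) := by
    have e : ϖ * (c a - c 0) = (((n a : ℤ) + n (0 + π x) - n 0 - n (a + π x) : ℤ) :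
        integralClosure ℤ_[p] F) := by
      push_cast
      linear_combination hc 0 - hc a
    have h2 : (p : ℤ) ∣ ((n a : ℤ) + n (0 + π x) - n 0 - n (a + π x) : ℤ) := by
      rw [← CharP.intCast_eq_zero_iff 𝔽 p]
      push_cast
      rw [hn, hn, hn, hn]
      ring
    obtain ⟨z, hz⟩ := h2
    rw [e, hz]
    push_cast
    exact dvd_mul_of_dvd_left hp _
  rw [pow_two] at h1
  have h3 := (mul_dvd_mul_iff_left hϖ.ne_zero).1 h1
  rwa [← hπ, map_sub, sub_eq_zero] at h3

variable [IsScalarTower ℤ_[p] ℚ_[p] F] [FiniteDimensional ℚ_[p] F]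

lemma isDetected_sum_single (hπ : ∀ x, π x = 0 ↔ ϖ ∣ x) (hrep : ∀ x, π (rep x) = x)
    {Φ : Module.End k V} {v : 𝔽 → V}
    (hv : ¬ ∃ x, ∀ a, v a = Φ (σ (intGL (uGL (rep a)))⁻¹ x)) :
    IsDetected hϖ Φ (∑ a, compactIndSingle σ (uAlpha ϖ hϖ (rep a)) (v a)) := by
  have hval : ∀ z, (∑ a, compactIndSingle σ (uAlpha ϖ hϖ (rep a)) (v a)).1 z =
      ∑ a, (compactIndSingle σ (uAlpha ϖ hϖ (rep a)) (v a)).1 z := by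
    intro z
    rw [Submodule.coe_sum, Finset.sum_apply]
  have hmem : ∀ (a : 𝔽) (x : F) (m : ℕ), (vertex hϖ x m)⁻¹ * uAlpha ϖ hϖ (rep a) ∈ groupZK p F →
      m = 1 ∧ ‖(rep a : F) - x‖ ≤ ‖(ϖ : F)‖ ^ m := by
    intro a x m h
    rw [uAlpha_eq_vertex] at h
    exact eq_of_alphaGL_pow_mem ϖ hϖ h
  refine ⟨fun m hm x => ?_, fun x hx => ?_, fun ⟨x, hx⟩ => hv ⟨x, fun a => ?_⟩⟩
  · rw [hval]
    refine Finset.sum_eq_zero fun a _ => compactIndSingle_apply_of_notMem (fun h => ?_) _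
    have := (hmem a x m h).1
    omega
  · rw [hval]
    refine Finset.sum_eq_zero fun a _ => compactIndSingle_apply_of_notMem (fun h => hx ?_) _
    have h1 := (hmem a x 1 h).2
    have h2 : (rep a : F) - x ∈ integralClosure ℤ_[p] F := by
      rw [mem_integralClosure_iff_norm_le_one]
      rw [pow_one] at h1
      exact h1.trans (norm_uniformizer_lt_one hϖ).le
    have h3 := Subalgebra.sub_mem _ (rep a).2 h2
    rwa [sub_sub_cancel] at h3
  · rw [← hx, ← uAlpha_eq_vertex, hval, Finset.sum_eq_single a, compactIndSingle_apply_self]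
    · exact fun b _ hb => compactIndSingle_apply_of_notMem
        (fun h => hb (eq_of_uAlpha_rep_mem hϖ hπ hrep h)) _
    · exact fun h => absurd (Finset.mem_univ _) h

end Vectors

namespace IsWeight

variable {p : ℕ} [Fact p.Prime] {F : Type*} [NormedField F] [NormedAlgebra ℚ_[p] F]
  [Algebra ℤ_[p] F] [IsScalarTower ℤ_[p] ℚ_[p] F] [FiniteDimensional ℚ_[p] F]
  {k V : Type*} [Field k] [CharP k p] [AddCommGroup V] [Module k V]
  {σ : Representation k (groupZK p F) V}
  {ϖ : integralClosure ℤ_[p] F} (hϖ : Irreducible ϖ) {𝔽 : Type*} [Field 𝔽] [Fintype 𝔽]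
  {π : integralClosure ℤ_[p] F →+* 𝔽} {τ : 𝔽 →+* k} {rep : 𝔽 → integralClosure ℤ_[p] F}
  {L : Type*} [CommRing L] [CharP L p] [Algebra k L] [Module L V] [IsScalarTower k L V]
  {ρ : Representation L (GL (Fin 2) 𝔽) V} {r : ℕ} {ε : L} {g : ℕ → V}
  {T : Representation.IntertwiningMap (compactIndRep σ) (compactIndRep σ)}

lemma eq_zero_of_heckeFunction_eq_zero (hW : IsWeight σ π τ ρ r ε g)
    (hπ : ∀ x, π x = 0 ↔ ϖ ∣ x) (hsurj : Function.Surjective π) (hT : IsHeckeOperatorT ϖ hϖ T)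
    (v : V) (hv : ∀ c, heckeFunction T (alphaGL ϖ hϖ)⁻¹ (σ (intGL (uGL c))⁻¹ v) = 0) :
    v = 0 := by
  obtain ⟨hlin, hpos, -, hne⟩ := hW.heckeFunction_apply hπ hsurj hT
  let Φ : V →ₗ[L] V := { toFun := heckeFunction T (alphaGL ϖ hϖ)⁻¹,
                         map_add' := map_add _, map_smul' := hlin }
  refine hW.monomial.eq_zero_of_map_u_eq_zero hW.torsionFree Φ hpos hne fun b => ?_
  obtain ⟨c, hc⟩ := hsurj (-b)
  have h1 := hv c
  rw [hW.inv_intGL_uGL_apply, hc, neg_neg] at h1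
  exact h1

lemma isDetected_powerSum (hW : IsWeight σ π τ ρ r ε g)
    (hπ : ∀ x, π x = 0 ↔ ϖ ∣ x) (hsurj : Function.Surjective π) (hrep : ∀ x, π (rep x) = x)
    (hT : IsHeckeOperatorT ϖ hϖ T) {s : ℕ} (hs : s < Fintype.card 𝔽) (hsr : ¬ ChooseLE p s r) :
    IsDetected hϖ (heckeFunction T (alphaGL ϖ hϖ)⁻¹)
      (powerSum hϖ σ τ rep s (heckeFunction T (alphaGL ϖ hϖ)⁻¹ (g r))) := by
  obtain ⟨hlin, hpos, -, hne⟩ := hW.heckeFunction_apply hπ hsurj hT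
  let Φ : V →ₗ[L] V := { toFun := heckeFunction T (alphaGL ϖ hϖ)⁻¹,
                         map_add' := map_add _, map_smul' := hlin }
  rw [powerSum_eq_sum_single]
  refine isDetected_sum_single hϖ hπ hrep fun ⟨x, hx⟩ =>
    hW.monomial.not_exists_pow_smul_eq Φ hpos hne hs hsr ⟨x, fun b => ?_⟩
  have h1 := hx b
  rw [hW.inv_intGL_uGL_apply, hrep] at h1
  rw [← map_pow, RingHom.comp_apply, algebraMap_smul]
  exact (by rw [map_pow]; exact h1)

/-- The case in which `powerSum s` is itself fixed by the upper unipotent matrices. -/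
theorem not_isAdmissibleRep_of_minimal (hW : IsWeight σ π τ ρ r ε g)
    (hπ : ∀ x, π x = 0 ↔ ϖ ∣ x) (hsurj : Function.Surjective π)
    (hT : IsHeckeOperatorT ϖ hϖ T) {s : ℕ} (hs : s < Fintype.card 𝔽) (hsr : ¬ ChooseLE p s r)
    (hst : ∀ t < s, ChooseLE p t s → ChooseLE p t r ∧ t ≠ r) :
    ¬ IsAdmissibleRep (cokernelRep T) := by
  obtain ⟨rep, hrep⟩ := hsurj.hasRightInverse
  refine not_isAdmissibleRep_of_isDetected (m := 2) (n₀ := 0) hϖ hπ hrep hT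
    (hW.eq_zero_of_heckeFunction_eq_zero hϖ hπ hsurj hT)
    (hW.isDetected_powerSum hϖ hπ hsurj hrep hT hs hsr) two_ne_zero ?_
  rw [pow_zero, Module.End.one_apply]
  refine isFixedModRange_unipSubgroup ?_ fun x => ?_
  · rw [powerSum_eq_sum_single]
    exact isFixedModRange_single hϖ (hW.eq_one_of_mem_congrSubgroup hπ) _
  · rw [compactIndRep_powerSum hϖ hπ hrep s (hW.hecke_u_apply hϖ hπ hsurj hT), add_sub_cancel_left]
    refine Submodule.sum_mem _ fun t ht => ?_
    by_cases hts : ChooseLE p t s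
    · obtain ⟨h1, h2⟩ := hst t (Finset.mem_range.1 ht) hts
      exact Submodule.smul_mem _ _ (hW.powerSum_mem hϖ hπ hsurj hrep hT h1 h2)
    · rw [cast_choose_eq_zero k hts, mul_zero, zero_smul]
      exact Submodule.zero_mem _

/-- The case in which `powerSum (r + 1)` is fixed by the upper unipotent matrices up to multiples
of `[w α, g r]`, and its image under `∑ u_x α` is fixed. -/
theorem not_isAdmissibleRep_of_carry (hW : IsWeight σ π τ ρ r ε g)
    (hπ : ∀ x, π x = 0 ↔ ϖ ∣ x) (hsurj : Function.Surjective π) (hrep : ∀ x, π (rep x) = x)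
    (hT : IsHeckeOperatorT ϖ hϖ T) (hr : r + 1 < Fintype.card 𝔽)
    (hst : ∀ t < r, ChooseLE p t (r + 1) → ChooseLE p t r)
    (hcarry : ∀ (x : integralClosure ℤ_[p] F) (c : 𝔽 → integralClosure ℤ_[p] F),
      (∀ a, x + rep a = rep (a + π x) + ϖ * c a) →
      ∑ a, τ (π (c a)) • ρ (uGL (a + π x)) (g 0) = 0) :
    ¬ IsAdmissibleRep (cokernelRep T) := by
  set d := heckeFunction T (alphaGL ϖ hϖ)⁻¹ (g r) with hd
  obtain ⟨cd, hcd⟩ := (hW.heckeFunction_apply hπ hsurj hT).2.2.1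
  rw [← hd] at hcd
  obtain ⟨κ, hκ⟩ := hW.exists_powerSum_add_mem (T := T) hϖ hπ hsurj hrep hT
  rw [← hd] at hκ
  set y := powerSum hϖ σ τ rep (r + 1) d with hy
  set W := compactIndSingle σ (wAlpha ϖ hϖ) (ε • d) with hWd
  -- the effect of the upper unipotent matrices on `y`
  have hyu : ∀ x, compactIndRep σ ((intGL (uGL x) : groupZK p F) : GL (Fin 2) F) y - y -
      τ (π x) • (((r + 1 : ℕ) : k) * κ) • W ∈ LinearMap.range T.toLinearMap := by
    intro x
    rw [hy, compactIndRep_powerSum hϖ hπ hrep (r + 1) (hW.hecke_u_apply hϖ hπ hsurj hT),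
      add_sub_cancel_left, Finset.sum_range_succ, add_sub_assoc]
    refine Submodule.add_mem _ (Submodule.sum_mem _ fun t ht => ?_) ?_
    · rw [Finset.mem_range] at ht
      by_cases hts : ChooseLE p t (r + 1)
      · exact Submodule.smul_mem _ _
          (hW.powerSum_mem hϖ hπ hsurj hrep hT (hst t ht hts) (by omega))
      · rw [cast_choose_eq_zero k hts, mul_zero, zero_smul]
        exact Submodule.zero_mem _
    · have h1 := Submodule.smul_mem _ (-τ (π x) * ((r + 1 : ℕ) : k)) hκ
      rw [Nat.add_sub_cancel_left, pow_one, Nat.choose_succ_self_right]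
      convert h1 using 1
      module
  obtain ⟨lz, hlz⟩ := hW.exists_smul (uniformizerUnit ϖ hϖ)
  have hWy : ∀ z, compactIndRep σ (uAlpha ϖ hϖ z) W =
      compactIndSingle σ 1 ((ε * lz * cd * ε) • ρ (uGL (π z)) (g 0)) := by
    intro z
    rw [hWd, compactIndRep_single, uAlpha_mul_wAlpha, compactIndSingle_mul, map_mul, map_mul,
      Module.End.mul_apply, Module.End.mul_apply, hcd, hlz, smul_smul, smul_smul, hW.map_smul,
      hW.w_apply, hW.monomial.w_apply_top, hW.map_smul, hW.map_smul, hW.u_apply, smul_smul]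
    congr 2
    ring
  -- `y` is fixed by the congruence subgroup of level `2` and its image under `∑ u_x α` by that of
  -- level `3`
  refine not_isAdmissibleRep_of_isDetected (m := 3) (n₀ := 1) hϖ hπ hrep hT
    (hW.eq_zero_of_heckeFunction_eq_zero hϖ hπ hsurj hT)
    (hW.isDetected_powerSum hϖ hπ hsurj hrep hT (s := r + 1) hr
      (fun h => by have := h.le; omega)) three_ne_zero ?_
  rw [pow_one, ← hd, ← hy]
  refine isFixedModRange_unipSubgroup (isFixedModRange_sumUAlpha hϖ ?_) fun x => ?_
  · rw [hy, powerSum_eq_sum_single]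
    exact isFixedModRange_single hϖ (hW.eq_one_of_mem_congrSubgroup hπ) _
  · obtain ⟨c, hc⟩ := exists_carry hπ hrep x
    -- since `u_y α w α` is `u_y w` up to a scalar, the error terms are values at `1`
    have hsum : ∑ a, compactIndRep σ (uAlpha ϖ hϖ (rep (a + π x)))
        (τ (π (c a)) • (((r + 1 : ℕ) : k) * κ) • W) = 0 := by
      have hterm : ∀ a, compactIndRep σ (uAlpha ϖ hϖ (rep (a + π x)))
          (τ (π (c a)) • (((r + 1 : ℕ) : k) * κ) • W) =
          (((r + 1 : ℕ) : k) * κ) • compactIndSingle σ 1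
            ((ε * lz * cd * ε) • τ (π (c a)) • ρ (uGL (a + π x)) (g 0)) := by
        intro a
        rw [_root_.map_smul, _root_.map_smul, hWy, hrep, smul_comm]
        congr 1
        rw [← _root_.map_smul, smul_comm]
      rw [Finset.sum_congr rfl fun a _ => hterm a, ← Finset.smul_sum, ← map_sum,
        ← Finset.smul_sum, hcarry x c hc, smul_zero, map_zero, smul_zero]
    rw [← sub_zero (_ - _), ← hsum, sumUAlpha, LinearMap.sum_apply, map_sum]
    conv => enter [2, 1, 2]; rw [← Equiv.sum_comp (Equiv.addRight (π x))]
    rw [← Finset.sum_sub_distrib, ← Finset.sum_sub_distrib]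
    refine Submodule.sum_mem _ fun a _ => ?_
    rw [← Module.End.mul_apply, ← map_mul, uGL_mul_uAlpha, hc, uAlpha_add_mul, map_mul,
      Module.End.mul_apply, Equiv.coe_addRight, ← map_sub, ← map_sub]
    exact compactIndRep_mem_range _ (hyu _)

/-- The case of the maximal exponent. The vector `∑ [u_λ α, g (r - 1)]` is fixed up to a combination
of the `[u_λ α, g r]` whose coefficients are the carries. -/
theorem not_isAdmissibleRep_of_maximal (hW : IsWeight σ π τ ρ r ε g)
    (hπ : ∀ x, π x = 0 ↔ ϖ ∣ x) (hsurj : Function.Surjective π)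
    (hT : IsHeckeOperatorT ϖ hϖ T) (hr : r + 1 = Fintype.card 𝔽)
    (hle : ∀ t < r, ChooseLE p t r)
    (hq : ϖ ^ 2 ∣ (Fintype.card 𝔽 : integralClosure ℤ_[p] F)) :
    ¬ IsAdmissibleRep (cokernelRep T) := by
  obtain ⟨rep, hrep⟩ := hsurj.hasRightInverse
  have h1 : 1 < Fintype.card 𝔽 := Fintype.one_lt_card
  set d := heckeFunction T (alphaGL ϖ hϖ)⁻¹ (g r) with hd
  obtain ⟨hlin, hpos, ⟨cd, hcd⟩, hne⟩ := hW.heckeFunction_apply hπ hsurj hT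
  rw [← hd] at hcd hne
  have hr1 : ((r : ℕ) : L) ≠ 0 := by
    have := (hle 1 · |>.cast_ne_zero L)
    by_cases h : r = 1
    · subst h
      intro h0
      rw [Nat.cast_one] at h0
      exact hne (by rw [← one_smul L d, h0, zero_smul])
    · simpa using this (by omega)
  have hug : ∀ b, ρ (uGL b) (cd • g (r - 1)) = cd • g (r - 1) +
      (((algebraMap k L).comp τ) b * (r : L)) • d := by
    intro b
    rw [_root_.map_smul, hW.monomial.u_apply, hcd, smul_comm _ cd, ← smul_add]
    congr 1
    rw [← hr, show r + 1 = (r - 1) + 2 by omega, Finset.sum_range_succ', Finset.sum_range_succ',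
      Finset.sum_eq_zero, zero_add, add_comm]
    · congr 1
      · simp
      · rw [show r - 1 + (0 + 1) = r by omega, zero_add, pow_one, mul_smul]
        congr 2
        have : r.choose (r - 1) = r := by
          obtain ⟨n, rfl⟩ : ∃ n, r = n + 1 := ⟨r - 1, by omega⟩
          rw [Nat.add_sub_cancel, Nat.choose_succ_self_right]
        rw [this]
    · intro t _
      rw [hW.monomial.eq_zero_of_lt (by omega), smul_zero, smul_zero]
  refine not_isAdmissibleRep_of_isDetected (m := 2) (n₀ := 0) hϖ hπ hrep hT
    (hW.eq_zero_of_heckeFunction_eq_zero hϖ hπ hsurj hT)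
    (isDetected_sum_single hϖ hπ hrep (v := fun _ => cd • g (r - 1)) ?_) two_ne_zero ?_
  · -- the image of `Φ` consists of multiples of `g r`, which are fixed by `u_1`
    rintro ⟨x, hx⟩
    have hx0 := hx 0
    obtain ⟨l, hl⟩ := hW.monomial.exists_eq_sum (σ (intGL (uGL (rep 0)))⁻¹ x)
    rw [hl, map_sum, Finset.sum_eq_single r] at hx0
    · rw [hlin, ← hd, hcd] at hx0
      have h2 := hug 1
      rw [hx0, _root_.map_smul, _root_.map_smul, hW.monomial.u_apply_top, left_eq_add, map_one,
        one_mul] at h2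
      exact (hW.torsionFree _ _ h2).elim hr1 hne
    · intro i _ hi
      rw [hlin, hpos i hi, smul_zero]
    · intro h
      simp at h
  · rw [pow_zero, Module.End.one_apply]
    refine isFixedModRange_unipSubgroup
      (isFixedModRange_single hϖ (hW.eq_one_of_mem_congrSubgroup hπ) _) fun x => ?_
    obtain ⟨c, hc⟩ := exists_carry hπ hrep x
    let h : 𝔽 → k := fun b => τ (π (c (b - π x))) * (r : k)
    have e : compactIndRep σ ((intGL (uGL x) : groupZK p F) : GL (Fin 2) F)
        (∑ a, compactIndSingle σ (uAlpha ϖ hϖ (rep a)) (cd • g (r - 1))) -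
        ∑ a, compactIndSingle σ (uAlpha ϖ hϖ (rep a)) (cd • g (r - 1)) =
        ∑ a, h a • compactIndSingle σ (uAlpha ϖ hϖ (rep a)) d := by
      rw [map_sum, ← Equiv.sum_comp (Equiv.addRight (π x))
          (fun a => compactIndSingle σ (uAlpha ϖ hϖ (rep a)) (cd • g (r - 1))),
        ← Equiv.sum_comp (Equiv.addRight (π x))
          (fun a => h a • compactIndSingle σ (uAlpha ϖ hϖ (rep a)) d), ← Finset.sum_sub_distrib]
      refine Finset.sum_congr rfl fun a _ => ?_
      rw [compactIndRep_uGL_single hϖ hc, hW.u_apply, hug, Equiv.coe_addRight, map_add,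
        add_sub_cancel_left]
      have hh : ((algebraMap k L).comp τ) (π (c a)) * (r : L) = algebraMap k L (h (a + π x)) := by
        simp only [h, map_mul, map_natCast, RingHom.comp_apply, add_sub_cancel_right]
      rw [hh, algebraMap_smul, _root_.map_smul]
    rw [e, sum_smul_single_eq_sum_powerSum (τ := τ)]
    refine Submodule.sum_mem _ fun t ht => ?_
    rw [Finset.mem_range] at ht
    by_cases htr : t = r
    · -- the top coefficient vanishes since the carries add up to zero
      have h3 : ∑ a, h a = 0 := by
        rw [← Equiv.sum_comp (Equiv.addRight (π x))]
        simp only [h, Equiv.coe_addRight, add_sub_cancel_right]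
        rw [← Finset.sum_mul, ← map_sum, sum_carry_eq_zero hϖ hπ hq hc, map_zero, zero_mul]
      rw [interpCoeff_of_pos τ h (by omega) ht, show Fintype.card 𝔽 - 1 - t = 0 by omega]
      simp only [pow_zero, one_smul]
      rw [h3, neg_zero, zero_smul]
      exact Submodule.zero_mem _
    · exact Submodule.smul_mem _ _
        (hW.powerSum_mem hϖ hπ hsurj hrep hT (hle t (by omega)) htr)

end IsWeight

namespace IsWeight

variable {p : ℕ} [Fact p.Prime] {F : Type*} [NormedField F] [NormedAlgebra ℚ_[p] F]
  [Algebra ℤ_[p] F] [IsScalarTower ℤ_[p] ℚ_[p] F] [FiniteDimensional ℚ_[p] F]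
  {k V : Type*} [Field k] [CharP k p] [AddCommGroup V] [Module k V]
  {σ : Representation k (groupZK p F) V}
  {ϖ : integralClosure ℤ_[p] F} (hϖ : Irreducible ϖ) {𝔽 : Type*} [Field 𝔽] [Fintype 𝔽]
  {π : integralClosure ℤ_[p] F →+* 𝔽} {τ : 𝔽 →+* k}
  {L : Type*} [CommRing L] [CharP L p] [Algebra k L] [Module L V] [IsScalarTower k L V]
  {ρ : Representation L (GL (Fin 2) 𝔽) V} {r : ℕ} {ε : L} {g : ℕ → V}
  {T : Representation.IntertwiningMap (compactIndRep σ) (compactIndRep σ)}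

/-- The cokernel of a Hecke operator is not admissible. If the exponent `r` is not extremal, then
there is an exponent `s` as in `not_isAdmissibleRep_of_minimal` when the residue field has `p ^ 2`
elements, whereas `s = r + 1` is treated by `not_isAdmissibleRep_of_carry` when it has `p`. -/
theorem not_isAdmissibleRep (hW : IsWeight σ π τ ρ r ε g)
    (hπ : ∀ x, π x = 0 ↔ ϖ ∣ x) (hsurj : Function.Surjective π)
    (hT : IsHeckeOperatorT ϖ hϖ T)
    (hcard : (Fintype.card 𝔽 = p ∧ ϖ ^ 2 ∣ (p : integralClosure ℤ_[p] F)) ∨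
      Fintype.card 𝔽 = p ^ 2) :
    ¬ IsAdmissibleRep (cokernelRep T) := by
  have hp : p.Prime := Fact.out
  have hp2 := hp.two_le
  have : CharP 𝔽 p := RingHom.charP τ τ.injective p
  have hq : ϖ ^ 2 ∣ (Fintype.card 𝔽 : integralClosure ℤ_[p] F) := by
    rcases hcard with h | h
    · rw [h.1]
      exact h.2
    · rw [h, Nat.cast_pow]
      exact pow_dvd_pow_of_dvd (Ideal.mem_span_singleton.1 (natCast_mem_span_uniformizer hϖ)) 2
  have hr := hW.monomial.r_lt
  have h1 : 1 < Fintype.card 𝔽 := Fintype.one_lt_card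
  by_cases hmax : r + 1 = Fintype.card 𝔽
  · refine hW.not_isAdmissibleRep_of_maximal hϖ hπ hsurj hT hmax (fun t ht => ?_) hq
    rw [show r = Fintype.card 𝔽 - 1 by omega]
    exact chooseLE_card_sub_one p (by omega)
  by_cases h0 : r = 0
  · subst h0
    obtain ⟨rep, hrep⟩ := hsurj.hasRightInverse
    refine hW.not_isAdmissibleRep_of_carry hϖ hπ hsurj hrep hT (by omega)
      (fun t ht => absurd ht (Nat.not_lt_zero t)) fun x c hc => ?_
    simp only [hW.monomial.u_apply_top]
    rw [← Finset.sum_smul, ← map_sum, sum_carry_eq_zero hϖ hπ hq hc, map_zero, zero_smul]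
  rcases hcard with ⟨hcard, hdvd⟩ | hcard
  · have hcast : Function.Surjective (Nat.cast : ℕ → 𝔽) := fun a => by
      obtain ⟨z, rfl⟩ := (ZMod.castHom_bijective 𝔽 hcard).2 a
      exact ⟨z.val, by rw [← map_natCast (ZMod.castHom (dvd_refl p) 𝔽), ZMod.natCast_zmod_val]⟩
    -- with natural numbers as representatives the carries are equal
    obtain ⟨n, hn⟩ := hcast.hasRightInverse
    refine hW.not_isAdmissibleRep_of_carry hϖ hπ hsurj
      (rep := fun a => (n a : integralClosure ℤ_[p] F)) (fun a => by rw [map_natCast, hn]) hT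
      (by omega) (fun t ht _ => chooseLE_of_le_of_lt hp ht.le (by omega)) fun x c hc => ?_
    have hconst := carry_eq_of_natCast hϖ hπ hdvd hn hc
    have hsum : ∑ a, ρ (uGL (a + π x)) (g 0) = ∑ a, ρ (uGL a) (g 0) :=
      Equiv.sum_comp (Equiv.addRight (π x)) (fun b => ρ (uGL b) (g 0))
    simp only [hconst]
    rw [← Finset.smul_sum, hsum, hW.monomial.sum_u_apply_zero (by omega), smul_zero]
  · obtain ⟨s, hs, hsr, hst⟩ := exists_minimal_not_chooseLE hp h0 (by omega)
    exact hW.not_isAdmissibleRep_of_minimal hϖ hπ hsurj hT (by omega) hsr hst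

end IsWeight

section HeckeOperators

variable {p : ℕ} [Fact p.Prime] {F : Type*} [NormedField F] [NormedAlgebra ℚ_[p] F]
  [Algebra ℤ_[p] F] [IsScalarTower ℤ_[p] ℚ_[p] F]
  {k V : Type*} [Field k] [CharP k p] [AddCommGroup V] [Module k V]
  {σ : Representation k (groupZK p F) V}

/-- Existence of Hecke operators and failure of admissibility for their cokernels, when the centre
acts through a ring `L` of scalars. -/
theorem exists_isHeckeOperatorT_and_not_isAdmissibleRep (hF : Module.finrank ℚ_[p] F = 2)
    {ϖ : integralClosure ℤ_[p] F} (hϖ : Irreducible ϖ)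
    (τ₀ : (integralClosure ℤ_[p] F ⧸ (Ideal.span {ϖ} : Ideal (integralClosure ℤ_[p] F))) →+* k)
    (hσ : IsSmoothRep σ) (hirr : σ.IsIrreducible)
    {L : Type*} [CommRing L] [Algebra k L] [Module L V] [IsScalarTower k L V]
    (hlin : ∀ Ψ : Module.End k V, (∀ c x, Ψ (σ (scalarZK p c) x) = σ (scalarZK p c) (Ψ x)) →
      ∀ (l : L) x, Ψ (l • x) = l • Ψ x)
    (hsm : ∀ c, ∃ l : L, ∀ x, σ (scalarZK p c) x = l • x)
    (htf : ∀ (l : L) (x : V), l • x = 0 → l = 0 ∨ x = 0) :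
    (∃ T : Representation.IntertwiningMap (compactIndRep σ) (compactIndRep σ),
      IsHeckeOperatorT ϖ hϖ T) ∧
    ∀ T : Representation.IntertwiningMap (compactIndRep σ) (compactIndRep σ),
      IsHeckeOperatorT ϖ hϖ T → ¬ IsAdmissibleRep (cokernelRep T) := by
  have : FiniteDimensional ℚ_[p] F := Module.finite_of_finrank_eq_succ hF
  have := finite_residueField hF hϖ
  have := span_uniformizer_isMaximal hϖ
  let : Field (integralClosure ℤ_[p] F ⧸ (Ideal.span {ϖ} : Ideal (integralClosure ℤ_[p] F))) :=
    Ideal.Quotient.field _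
  let : Fintype (integralClosure ℤ_[p] F ⧸ (Ideal.span {ϖ} : Ideal (integralClosure ℤ_[p] F))) :=
    Fintype.ofFinite _
  let π := Ideal.Quotient.mk (Ideal.span {ϖ} : Ideal (integralClosure ℤ_[p] F))
  have hπ : ∀ x, π x = 0 ↔ ϖ ∣ x := fun x => by
    rw [Ideal.Quotient.eq_zero_iff_mem, Ideal.mem_span_singleton]
  have hsurj : Function.Surjective π := Ideal.Quotient.mk_surjective
  have := nontrivial_of_isIrreducible hirr
  have : Nontrivial L := Module.nontrivial L V
  have : CharP L p := charP_of_injective_algebraMap (algebraMap k L).injective p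
  obtain ⟨ρ, r, ε, g, hW⟩ := exists_isWeight hσ hirr hϖ hsurj hπ τ₀ hlin hsm htf
  refine ⟨?_, fun T hT => hW.not_isAdmissibleRep hϖ hπ hsurj hT ?_⟩
  · obtain ⟨Ψ, hΨ, hne⟩ := hW.exists_isHeckeValue
    exact exists_isHeckeOperatorT hϖ hΨ hne (hW.eq_one_of_mem_congrSubgroup hπ) hsurj hπ
  · rw [← Nat.card_eq_fintype_card]
    exact card_residueField_of_finrank_eq_two hF hϖ

end HeckeOperators

theorem mainTheorem8
    (p : ℕ) [Fact p.Prime]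
    (F : Type*) [NormedField F] [NormedAlgebra ℚ_[p] F]
    [Algebra ℤ_[p] F] [IsScalarTower ℤ_[p] ℚ_[p] F]
    (hF : Module.finrank ℚ_[p] F = 2)
    (ϖ : integralClosure ℤ_[p] F) (hϖ : Irreducible ϖ)
    (k : Type*) [Field k] [CharP k p]
    (τ₀ : (integralClosure ℤ_[p] F ⧸ Ideal.span {ϖ}) →+* k)
    (V : Type*) [AddCommGroup V] [Module k V]
    (σ : Representation k (groupZK p F) V)
    (hσ : IsSmoothRep σ) (hirr : σ.IsIrreducible) :
    (∃ T : Representation.IntertwiningMap (compactIndRep σ) (compactIndRep σ),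
      IsHeckeOperatorT ϖ hϖ T) ∧
    ∀ T : Representation.IntertwiningMap (compactIndRep σ) (compactIndRep σ),
      IsHeckeOperatorT ϖ hϖ T → ¬ IsAdmissibleRep (cokernelRep T) := by
  have : FiniteDimensional ℚ_[p] F := Module.finite_of_finrank_eq_succ hF
  obtain ⟨A, hA, hlin, hsm, htf⟩ := exists_central_scalars hirr
  let : CommRing A := open scoped IsMulCommutative in inferInstance
  exact exists_isHeckeOperatorT_and_not_isAdmissibleRep hF hϖ τ₀ hσ hirr hlin hsm htf
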